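/- **Theorem 2.1.** Let $k$ be a commutative ring, let $A$ and $B$ be associative unital $k$-algebras, let $\mathfrak C$ be an $A$-coring and $\mathfrak D$ a $B$-coring, with comultiplications $\Delta_{\mathfrak C},\Delta_{\mathfrak D}$ and counits $\epsilon_{\mathfrak C},\epsilon_{\mathfrak D}$. (On every bimodule, $k$ acts in the same way from both sides.) For a $\mathfrak C'$-$\mathfrak C$-bicomodule $M$ with right coaction $\rho_M$ and a $\mathfrak C$-$\mathfrak C''$-bicomodule $N$ with left coaction $\lambda_N$, where $\mathfrak C$ is an $A$-coring, the cotensor product is $$M\square_{\mathfrak C}N=\ker\bigl(\rho_M\otimes_AN-M\otimes_A\lambda_N : M\otimes_AN\to M\otimes_A\mathfrak C\otimes_AN\bigr).$$ A left $\mathfrak C$-comodule $N$ is *coflat* if $-\square_{\mathfrak C}N$ takes short exact sequences of right $\mathfrak C$-comodules (sequences of colinear maps that are exact as sequences of modules) to short exact sequences. A coring $\mathfrak C$ is *coseparable* if $\Delta_{\mathfrak C}$ has a left inverse $\mathfrak C\otimes_A\mathfrak C\to\mathfrak C$ that is a map of $\mathfrak C$-bicomodules. Let $X$ be a $\mathfrak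 C$-$\mathfrak D$-bicomodule and $\Lambda$ a $\mathfrak D$-$\mathfrak C$-bicomodule. Assume that at least one of the following holds: 1. ${}_A\mathfrak C$, ${}_B\mathfrak D$, $\mathfrak C_A$ and $\mathfrak D_B$ are flat, and the left comodules ${}_{\mathfrak C}X$ and ${}_{\mathfrak D}\Lambda$ are coflat; 2. $A$ and $B$ are von Neumann regular rings; 3. ${}_A\mathfrak C$ and ${}_B\mathfrak D$ are flat, and $\mathfrak C$ and $\mathfrak D$ are coseparable. Then each of $X\square_{\mathfrak D}\Lambda$, $\Lambda\square_{\mathfrak C}X$, $\mathfrak C\square_{\mathfrak C}X$ and $(X\square_{\mathfrak D}\Lambda)\square_{\mathfrak C}X$ has a unique bicomodule structure for which its inclusion into the corresponding tensor product ($X\otimes_B\Lambda$, etc.) is bicolinear. The coaction of $X$ is an isomorphism of bicomodules $X\simeq\mathfrak C\square_{\mathfrak C}X$, and the associativity isomorphisms of tensor products restrict to unique isomorphisms $$\Lambda\square_{\mathfrak C}(X\square_{\mathfrak D}\Lambda)\simeq(\Lambda\square_{\mathfrak C}X)\square_{\mathfrak D}\Lambda,\qquad X\square_{\mathfrak D}(\Lambda\square_{\mathfrak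 C}X)\simeq(X\square_{\mathfrak D}\Lambda)\square_{\mathfrak C}X,$$ $$\Lambda\square_{\mathfrak C}\bigl((X\square_{\mathfrak D}\Lambda)\square_{\mathfrak C}X\bigr)\simeq(\Lambda\square_{\mathfrak C}X)\square_{\mathfrak D}(\Lambda\square_{\mathfrak C}X).$$ Moreover, let $\psi:\mathfrak C\to X\square_{\mathfrak D}\Lambda$ and $\omega:\Lambda\square_{\mathfrak C}X\to\mathfrak D$ be bicolinear maps such that the composites $$\Lambda\simeq\Lambda\square_{\mathfrak C}\mathfrak C\xrightarrow{\Lambda\square\psi}\Lambda\square_{\mathfrak C}(X\square_{\mathfrak D}\Lambda)\simeq(\Lambda\square_{\mathfrak C}X)\square_{\mathfrak D}\Lambda\xrightarrow{\omega\square\Lambda}\mathfrak D\square_{\mathfrak D}\Lambda,$$ $$X\simeq\mathfrak C\square_{\mathfrak C}X\xrightarrow{\psi\square X}(X\square_{\mathfrak D}\Lambda)\square_{\mathfrak C}X\simeq X\square_{\mathfrak D}(\Lambda\square_{\mathfrak C}X)\xrightarrow{X\square\omega}X\square_{\mathfrak D}\mathfrak D$$ are the canonical isomorphisms $\Lambda\simeq\mathfrak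 D\square_{\mathfrak D}\Lambda$ and $X\simeq X\square_{\mathfrak D}\mathfrak D$ given by the coactions. Then $\psi\square X$ is bicolinear, and the $B$-bimodule $\Lambda\square_{\mathfrak C}X$ is a $B$-coring with comultiplication $$\Lambda\square_{\mathfrak C}X\simeq\Lambda\square_{\mathfrak C}(\mathfrak C\square_{\mathfrak C}X)\xrightarrow{\Lambda\square(\psi\square X)}\Lambda\square_{\mathfrak C}\bigl((X\square_{\mathfrak D}\Lambda)\square_{\mathfrak C}X\bigr)\simeq(\Lambda\square_{\mathfrak C}X)\square_{\mathfrak D}(\Lambda\square_{\mathfrak C}X)\hookrightarrow(\Lambda\square_{\mathfrak C}X)\otimes_B(\Lambda\square_{\mathfrak C}X)$$ and counit $\epsilon_{\mathfrak D}\circ\omega:\Lambda\square_{\mathfrak C}X\to B$. -/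

import Mathlib

open MulOpposite

universe u v

namespace GenComatrix

/-! Right `A`-modules are modules over `Aᵐᵒᵖ`; an `A`-`B`-bimodule is a left `A`-module and a right
`B`-module whose two actions commute. -/

/-! ### Bimodule maps -/

/-- Maps of `A`-`B`-bimodules. -/
structure BimodHom (A B M N : Type*) [Ring A] [Ring B]
    [AddCommGroup M] [Module A M] [Module Bᵐᵒᵖ M]
    [AddCommGroup N] [Module A N] [Module Bᵐᵒᵖ N] extends M →ₗ[A] N where
  map_rsmul' : ∀ (b : Bᵐᵒᵖ) (m : M), toFun (b • m) = b • toFun m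

namespace BimodHom

variable {A B M N P : Type*} [Ring A] [Ring B]
  [AddCommGroup M] [Module A M] [Module Bᵐᵒᵖ M]
  [AddCommGroup N] [Module A N] [Module Bᵐᵒᵖ N]
  [AddCommGroup P] [Module A P] [Module Bᵐᵒᵖ P]

instance : FunLike (BimodHom A B M N) M N where
  coe f := f.toFun
  coe_injective f g h := by
    cases f; cases g; congr; exact DFunLike.coe_injective h

instance : AddMonoidHomClass (BimodHom A B M N) M N where
  map_add f := f.map_add'
  map_zero f := f.toLinearMap.map_zero

/-- The underlying map of left modules. -/
def left (f : BimodHom A B M N) : M →ₗ[A] N := f.toLinearMap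

/-- The underlying map of right modules. -/
def right (f : BimodHom A B M N) : M →ₗ[Bᵐᵒᵖ] N where
  toFun := f
  map_add' := f.map_add'
  map_smul' := f.map_rsmul'

@[simp] theorem left_apply (f : BimodHom A B M N) (m : M) : f.left m = f m := rfl

@[simp] theorem right_apply (f : BimodHom A B M N) (m : M) : f.right m = f m := rfl

theorem map_lsmul (f : BimodHom A B M N) (a : A) (m : M) : f (a • m) = a • f m :=
  f.left.map_smul a m

theorem map_rsmul (f : BimodHom A B M N) (b : Bᵐᵒᵖ) (m : M) : f (b • m) = b • f m :=
  f.map_rsmul' b m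

@[ext] theorem ext {f g : BimodHom A B M N} (h : ∀ m, f m = g m) : f = g := DFunLike.ext _ _ h

/-- An additive map that respects both actions. -/
def mk' (f : M →+ N) (hl : ∀ (a : A) m, f (a • m) = a • f m)
    (hr : ∀ (b : Bᵐᵒᵖ) m, f (b • m) = b • f m) : BimodHom A B M N where
  toFun := f
  map_add' := f.map_add
  map_smul' := hl
  map_rsmul' := hr

@[simp] theorem mk'_apply (f : M →+ N) (hl : ∀ (a : A) m, f (a • m) = a • f m)
    (hr : ∀ (b : Bᵐᵒᵖ) m, f (b • m) = b • f m) (m : M) : mk' f hl hr m = f m := rfl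

variable (A B M) in
/-- The identity. -/
def id : BimodHom A B M M := mk' (AddMonoidHom.id M) (fun _ _ => rfl) (fun _ _ => rfl)

@[simp] theorem id_apply (m : M) : id A B M m = m := rfl

/-- Composition. -/
def comp (g : BimodHom A B N P) (f : BimodHom A B M N) : BimodHom A B M P :=
  mk' ((g : N →+ P).comp (f : M →+ N)) (fun a m => by simp [map_lsmul])
    (fun b m => by simp [map_rsmul])

@[simp] theorem comp_apply (g : BimodHom A B N P) (f : BimodHom A B M N) (m : M) :
    g.comp f m = g (f m) := rfl

end BimodHom

/-! ### The tensor product over a noncommutative ring -/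

section Tensor

/-- The relations `(m a) ⊗ n - m ⊗ (a n)`. -/
def balancedRel (A M N : Type*) [Ring A] [AddCommGroup M] [Module Aᵐᵒᵖ M]
    [AddCommGroup N] [Module A N] : AddSubgroup (TensorProduct ℤ M N) :=
  AddSubgroup.closure
    {t | ∃ (m : M) (a : A) (n : N), t = (op a • m) ⊗ₜ[ℤ] n - m ⊗ₜ[ℤ] (a • n)}

/-- `M ⊗_A N` for a right `A`-module `M` and a left `A`-module `N`. -/
def BTensor (A M N : Type*) [Ring A] [AddCommGroup M] [Module Aᵐᵒᵖ M]
    [AddCommGroup N] [Module A N] : Type _ :=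
  TensorProduct ℤ M N ⧸ balancedRel A M N

namespace BTensor

variable {A B R S M N P M' N' P' M'' N'' : Type*} [Ring A] [Ring B] [Ring R] [Ring S]

section Basic

variable [AddCommGroup M] [Module Aᵐᵒᵖ M] [AddCommGroup N] [Module A N] [AddCommGroup P]

instance : AddCommGroup (BTensor A M N) :=
  inferInstanceAs (AddCommGroup (TensorProduct ℤ M N ⧸ balancedRel A M N))

variable (A) in
/-- The pure tensor `m ⊗ n`. -/
def tmul (m : M) (n : N) : BTensor A M N :=
  QuotientAddGroup.mk' (balancedRel A M N) (m ⊗ₜ[ℤ] n)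

theorem add_tmul (m m' : M) (n : N) : tmul A (m + m') n = tmul A m n + tmul A m' n := by
  simp only [tmul, TensorProduct.add_tmul]; exact map_add _ _ _

theorem tmul_add (m : M) (n n' : N) : tmul A m (n + n') = tmul A m n + tmul A m n' := by
  simp only [tmul, TensorProduct.tmul_add]; exact map_add _ _ _

theorem smul_tmul (m : M) (a : A) (n : N) : tmul A (op a • m) n = tmul A m (a • n) := by
  have h : (op a • m) ⊗ₜ[ℤ] n - m ⊗ₜ[ℤ] (a • n) ∈ balancedRel A M N :=
    AddSubgroup.subset_closure ⟨m, a, n, rfl⟩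
  have h2 := (QuotientAddGroup.eq_zero_iff (N := balancedRel A M N) _).2 h
  exact sub_eq_zero.1 h2

@[elab_as_elim]
theorem induction_on {p : BTensor A M N → Prop} (t : BTensor A M N) (h0 : p 0)
    (ht : ∀ m n, p (tmul A m n)) (ha : ∀ x y, p x → p y → p (x + y)) : p t := by
  obtain ⟨x, rfl⟩ := QuotientAddGroup.mk'_surjective (balancedRel A M N) t
  induction x using TensorProduct.induction_on with
  | zero => exact h0
  | tmul m n => exact ht m n
  | add x y hx hy => exact ha _ _ hx hy

/-- The universal property of `M ⊗_A N` for balanced biadditive maps. -/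
def lift (f : M →+ N →+ P) (hf : ∀ m (a : A) n, f (op a • m) n = f m (a • n)) :
    BTensor A M N →+ P :=
  QuotientAddGroup.lift (balancedRel A M N)
    (TensorProduct.liftAddHom f (fun r m n => by simp))
    (by
      rw [balancedRel, AddSubgroup.closure_le]
      rintro t ⟨m, a, n, rfl⟩
      simp [hf])

@[simp] theorem lift_tmul (f : M →+ N →+ P)
    (hf : ∀ m (a : A) n, f (op a • m) n = f m (a • n)) (m : M) (n : N) :
    lift f hf (tmul A m n) = f m n := rfl

theorem hom_ext {f g : BTensor A M N →+ P} (h : ∀ m n, f (tmul A m n) = g (tmul A m n)) :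
    f = g := by
  ext t
  induction t using induction_on with
  | h0 => simp
  | ht m n => exact h m n
  | ha x y hx hy => simp [hx, hy]

/-- The biadditive map `(m, n) ↦ m ⊗ n`. -/
def mkHom : M →+ N →+ BTensor A M N :=
  AddMonoidHom.mk' (fun m => AddMonoidHom.mk' (fun n => tmul A m n) (tmul_add m))
    (fun m m' => by ext n; exact add_tmul m m' n)

@[simp] theorem mkHom_apply (m : M) (n : N) : mkHom (A := A) m n = tmul A m n := rfl

theorem zero_tmul (n : N) : tmul A (0 : M) n = 0 := map_zero ((mkHom (A := A)).flip n)

theorem tmul_zero (m : M) : tmul A m (0 : N) = 0 := map_zero (mkHom (A := A) m)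

end Basic

section Map

variable [AddCommGroup M] [Module Aᵐᵒᵖ M] [AddCommGroup N] [Module A N]
  [AddCommGroup M'] [Module Aᵐᵒᵖ M'] [AddCommGroup N'] [Module A N']

/-- `f ⊗_A g`. -/
def map (f : M →ₗ[Aᵐᵒᵖ] M') (g : N →ₗ[A] N') : BTensor A M N →+ BTensor A M' N' :=
  lift ((mkHom.compr₂ (AddMonoidHom.id _)).compl₂ g.toAddMonoidHom |>.comp f.toAddMonoidHom)
    (fun m a n => by
      simp only [AddMonoidHom.comp_apply, AddMonoidHom.compl₂_apply, AddMonoidHom.compr₂_apply,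
        LinearMap.toAddMonoidHom_coe, AddMonoidHom.id_apply, mkHom_apply, map_smul, smul_tmul])

@[simp] theorem map_tmul (f : M →ₗ[Aᵐᵒᵖ] M') (g : N →ₗ[A] N') (m : M) (n : N) :
    map f g (tmul A m n) = tmul A (f m) (g n) := rfl

theorem map_map [AddCommGroup M''] [Module Aᵐᵒᵖ M''] [AddCommGroup N''] [Module A N'']
    (f' : M' →ₗ[Aᵐᵒᵖ] M'') (g' : N' →ₗ[A] N'') (f : M →ₗ[Aᵐᵒᵖ] M') (g : N →ₗ[A] N')
    (t : BTensor A M N) : map f' g' (map f g t) = map (f'.comp f) (g'.comp g) t := by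
  induction t using induction_on with
  | h0 => simp
  | ht m n => simp
  | ha x y hx hy => simp [hx, hy]

end Map

section LeftModule

variable [AddCommGroup M] [Module R M] [Module Aᵐᵒᵖ M] [SMulCommClass R Aᵐᵒᵖ M]
  [AddCommGroup N] [Module A N]

/-- `M ⊗_A N` is a left `R`-module through `M`. -/
instance leftModule : Module R (BTensor A M N) where
  smul r t := map (DistribSMul.toLinearMap Aᵐᵒᵖ M r) LinearMap.id t
  one_smul t := DFunLike.congr_fun (g := AddMonoidHom.id (BTensor A M N)) (hom_ext (fun m n => by
    change tmul A ((1 : R) • m) n = _; simp)) t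
  mul_smul r s t := DFunLike.congr_fun
    (f := map (DistribSMul.toLinearMap Aᵐᵒᵖ M (r * s)) LinearMap.id)
    (g := (map (DistribSMul.toLinearMap Aᵐᵒᵖ M r) LinearMap.id).comp
      (map (DistribSMul.toLinearMap Aᵐᵒᵖ M s) LinearMap.id)) (hom_ext (fun m n => by
    simp [mul_smul])) t
  smul_zero r := map_zero _
  smul_add r := map_add _
  add_smul r s t := DFunLike.congr_fun
    (f := map (DistribSMul.toLinearMap Aᵐᵒᵖ M (r + s)) LinearMap.id)
    (g := (map (DistribSMul.toLinearMap Aᵐᵒᵖ M r) LinearMap.id) +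
      (map (DistribSMul.toLinearMap Aᵐᵒᵖ M s) LinearMap.id)) (hom_ext (fun m n => by
    simp [add_smul, add_tmul])) t
  zero_smul t := DFunLike.congr_fun
    (f := map (DistribSMul.toLinearMap Aᵐᵒᵖ M (0 : R)) LinearMap.id)
    (g := 0) (hom_ext (fun m n => by
    simp [zero_tmul])) t

theorem lsmul_tmul (r : R) (m : M) (n : N) : r • tmul A m n = tmul A (r • m) n := rfl

end LeftModule

section RightModule

variable [AddCommGroup M] [Module Aᵐᵒᵖ M]
  [AddCommGroup N] [Module A N] [Module Sᵐᵒᵖ N] [SMulCommClass A Sᵐᵒᵖ N]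

/-- Right multiplication by a scalar, as a map of left modules. -/
def rsmulHom (s : Sᵐᵒᵖ) : N →ₗ[A] N where
  toFun n := s • n
  map_add' := smul_add s
  map_smul' a n := (smul_comm a s n).symm

/-- `M ⊗_A N` is a right `S`-module through `N`. -/
instance rightModule : Module Sᵐᵒᵖ (BTensor A M N) where
  smul s t := map LinearMap.id (rsmulHom s) t
  one_smul t := DFunLike.congr_fun (g := AddMonoidHom.id (BTensor A M N)) (hom_ext (fun m n => by
    change tmul A m ((1 : Sᵐᵒᵖ) • n) = _; simp)) t
  mul_smul r s t := DFunLike.congr_fun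
    (f := map LinearMap.id (rsmulHom (r * s)))
    (g := (map LinearMap.id (rsmulHom r)).comp (map LinearMap.id (rsmulHom s)))
    (hom_ext (fun m n => by simp [rsmulHom, mul_smul])) t
  smul_zero r := map_zero _
  smul_add r := map_add _
  add_smul r s t := DFunLike.congr_fun
    (f := map LinearMap.id (rsmulHom (r + s)))
    (g := (map LinearMap.id (rsmulHom r)) + (map LinearMap.id (rsmulHom s)))
    (hom_ext (fun m n => by simp [rsmulHom, add_smul, tmul_add])) t
  zero_smul t := DFunLike.congr_fun
    (f := map LinearMap.id (rsmulHom (0 : Sᵐᵒᵖ)))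
    (g := 0) (hom_ext (fun m n => by
    simp [rsmulHom, tmul_zero])) t

theorem rsmul_tmul (s : Sᵐᵒᵖ) (m : M) (n : N) : s • tmul A m n = tmul A m (s • n) := rfl

end RightModule

section Bimodule

variable [AddCommGroup M] [Module R M] [Module Aᵐᵒᵖ M] [SMulCommClass R Aᵐᵒᵖ M]
  [AddCommGroup N] [Module A N] [Module Sᵐᵒᵖ N] [SMulCommClass A Sᵐᵒᵖ N]
  [AddCommGroup M'] [Module R M'] [Module Aᵐᵒᵖ M'] [SMulCommClass R Aᵐᵒᵖ M']
  [AddCommGroup N'] [Module A N'] [Module Sᵐᵒᵖ N'] [SMulCommClass A Sᵐᵒᵖ N']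

instance bimodule : SMulCommClass R Sᵐᵒᵖ (BTensor A M N) where
  smul_comm r s t := by
    induction t using induction_on with
    | h0 => simp
    | ht m n => rfl
    | ha x y hx hy => simp only [smul_add, hx, hy]

/-- `f ⊗_A g` for bimodule maps. -/
def mapBi (f : BimodHom R A M M') (g : BimodHom A S N N') :
    BimodHom R S (BTensor A M N) (BTensor A M' N') :=
  BimodHom.mk' (map f.right g.left)
    (fun r t => by
      induction t using induction_on with
      | h0 => simp
      | ht m n => simp [lsmul_tmul, f.map_lsmul]
      | ha x y hx hy => simp only [smul_add, map_add, hx, hy])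
    (fun r t => by
      induction t using induction_on with
      | h0 => simp
      | ht m n => simp [rsmul_tmul, g.map_rsmul]
      | ha x y hx hy => simp only [smul_add, map_add, hx, hy])

@[simp] theorem mapBi_tmul (f : BimodHom R A M M') (g : BimodHom A S N N') (m : M) (n : N) :
    mapBi f g (tmul A m n) = tmul A (f m) (g n) := rfl

end Bimodule

/-- A triadditive map from a function of three variables. -/
def triadd {M N P T : Type*} [AddCommGroup M] [AddCommGroup N] [AddCommGroup P] [AddCommGroup T]
    (f : M → N → P → T) (h₁ : ∀ m m' n p, f (m + m') n p = f m n p + f m' n p)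
    (h₂ : ∀ m n n' p, f m (n + n') p = f m n p + f m n' p)
    (h₃ : ∀ m n p p', f m n (p + p') = f m n p + f m n p') : M →+ N →+ P →+ T :=
  AddMonoidHom.mk' (fun m => AddMonoidHom.mk' (fun n => AddMonoidHom.mk' (f m n) (h₃ m n))
    (fun n n' => AddMonoidHom.ext (h₂ m n n')))
    (fun m m' => AddMonoidHom.ext fun n => AddMonoidHom.ext (h₁ m m' n))

theorem triadd_apply {M N P T : Type*} [AddCommGroup M] [AddCommGroup N] [AddCommGroup P]
    [AddCommGroup T]
    (f : M → N → P → T) (h₁ : ∀ m m' n p, f (m + m') n p = f m n p + f m' n p)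
    (h₂ : ∀ m n n' p, f m (n + n') p = f m n p + f m n' p)
    (h₃ : ∀ m n p p', f m n (p + p') = f m n p + f m n p') (m : M) (n : N) (p : P) :
    triadd f h₁ h₂ h₃ m n p = f m n p := rfl

section Assoc

variable [AddCommGroup M] [Module Aᵐᵒᵖ M]
  [AddCommGroup N] [Module A N] [Module Bᵐᵒᵖ N] [SMulCommClass A Bᵐᵒᵖ N]
  [AddCommGroup P] [Module B P]

/-- `(m ⊗ n) ⊗ p ↦ m ⊗ (n ⊗ p)`. -/
def assocHom : BTensor B (BTensor A M N) P →+ BTensor A M (BTensor B N P) :=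
  lift
    (lift
      (triadd (fun m n p => tmul A m (tmul B n p))
        (fun m m' n p => add_tmul m m' _)
        (fun m n n' p => by rw [add_tmul, tmul_add])
        (fun m n p p' => by rw [tmul_add, tmul_add]))
      (fun m a n => AddMonoidHom.ext fun p => by
        rw [triadd_apply, triadd_apply, smul_tmul, lsmul_tmul]))
    (fun t b p => by
      induction t using induction_on with
      | h0 => rw [smul_zero, map_zero, AddMonoidHom.zero_apply, AddMonoidHom.zero_apply]
      | ht m n =>
        rw [rsmul_tmul, lift_tmul, lift_tmul, triadd_apply, triadd_apply, smul_tmul]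
      | ha x y hx hy =>
        rw [smul_add, map_add, map_add, AddMonoidHom.add_apply, AddMonoidHom.add_apply, hx, hy])

/-- `m ⊗ (n ⊗ p) ↦ (m ⊗ n) ⊗ p`. -/
def assocInv : BTensor A M (BTensor B N P) →+ BTensor B (BTensor A M N) P :=
  (lift
    (AddMonoidHom.flip (lift
      (triadd (fun n p m => tmul B (tmul A m n) p)
        (fun n n' p m => by rw [tmul_add, add_tmul])
        (fun n p p' m => tmul_add _ p p')
        (fun n p m m' => by rw [add_tmul, add_tmul]))
      (fun n b p => AddMonoidHom.ext fun m => by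
        rw [triadd_apply, triadd_apply, ← smul_tmul, rsmul_tmul])))
    (fun m a t => by
      rw [AddMonoidHom.flip_apply, AddMonoidHom.flip_apply]
      induction t using induction_on with
      | h0 => rw [smul_zero, map_zero, AddMonoidHom.zero_apply, AddMonoidHom.zero_apply]
      | ht n p =>
        rw [lsmul_tmul, lift_tmul, lift_tmul, triadd_apply, triadd_apply, smul_tmul]
      | ha x y hx hy =>
        rw [smul_add, map_add, map_add, AddMonoidHom.add_apply, AddMonoidHom.add_apply, hx, hy]))

theorem assocHom_tmul (m : M) (n : N) (p : P) :
    assocHom (tmul B (tmul A m n) p) = tmul A m (tmul B n p) := rfl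

theorem assocInv_tmul (m : M) (n : N) (p : P) :
    assocInv (tmul A m (tmul B n p)) = tmul B (tmul A m n) p := rfl

variable (A B M N P) in
/-- `(M ⊗_A N) ⊗_B P ≃ M ⊗_A (N ⊗_B P)`. -/
def assoc : BTensor B (BTensor A M N) P ≃+ BTensor A M (BTensor B N P) :=
  AddMonoidHom.toAddEquiv assocHom assocInv
    (by
      refine hom_ext fun t p => ?_
      induction t using induction_on with
      | h0 =>
        rw [zero_tmul, map_zero, map_zero]
      | ht m n => rfl
      | ha x y hx hy => simp only [add_tmul, map_add, hx, hy])
    (by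
      refine hom_ext fun m t => ?_
      induction t using induction_on with
      | h0 =>
        rw [tmul_zero, map_zero, map_zero]
      | ht n p => rfl
      | ha x y hx hy => simp only [tmul_add, map_add, hx, hy])

@[simp] theorem assoc_tmul (m : M) (n : N) (p : P) :
    assoc A B M N P (tmul B (tmul A m n) p) = tmul A m (tmul B n p) := rfl

@[simp] theorem assoc_symm_tmul (m : M) (n : N) (p : P) :
    (assoc A B M N P).symm (tmul A m (tmul B n p)) = tmul B (tmul A m n) p := rfl

theorem assoc_lsmul [Module R M] [SMulCommClass R Aᵐᵒᵖ M] (r : R)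
    (t : BTensor B (BTensor A M N) P) :
    assoc A B M N P (r • t) = r • assoc A B M N P t := by
  induction t using induction_on with
  | h0 => simp
  | ht t p =>
    induction t using induction_on with
    | h0 =>
      rw [zero_tmul]; simp
    | ht m n => rfl
    | ha x y hx hy => simp only [add_tmul, smul_add, map_add, hx, hy]
  | ha x y hx hy => simp only [smul_add, map_add, hx, hy]

theorem assoc_rsmul [Module Sᵐᵒᵖ P] [SMulCommClass B Sᵐᵒᵖ P] (s : Sᵐᵒᵖ)
    (t : BTensor B (BTensor A M N) P) :
    assoc A B M N P (s • t) = s • assoc A B M N P t := by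
  induction t using induction_on with
  | h0 => simp
  | ht t p =>
    induction t using induction_on with
    | h0 =>
      rw [zero_tmul]; simp
    | ht m n => rfl
    | ha x y hx hy => simp only [add_tmul, smul_add, map_add, hx, hy]
  | ha x y hx hy => simp only [smul_add, map_add, hx, hy]

variable [Module R M] [SMulCommClass R Aᵐᵒᵖ M] [Module Sᵐᵒᵖ P] [SMulCommClass B Sᵐᵒᵖ P]

variable (A B R S M N P) in
/-- The associativity isomorphism as a bimodule map. -/
def assocBi : BimodHom R S (BTensor B (BTensor A M N) P) (BTensor A M (BTensor B N P)) :=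
  BimodHom.mk' (assoc A B M N P).toAddMonoidHom assoc_lsmul assoc_rsmul

@[simp] theorem assocBi_apply (t : BTensor B (BTensor A M N) P) :
    assocBi A B R S M N P t = assoc A B M N P t := rfl

variable (A B R S M N P) in
/-- The inverse of the associativity isomorphism as a bimodule map. -/
def assocBiSymm : BimodHom R S (BTensor A M (BTensor B N P)) (BTensor B (BTensor A M N) P) :=
  BimodHom.mk' (assoc A B M N P).symm.toAddMonoidHom
    (fun r t => by
      apply (assoc A B M N P).injective
      simp [assoc_lsmul])
    (fun s t => by
      apply (assoc A B M N P).injective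
      simp [assoc_rsmul])

@[simp] theorem assocBiSymm_apply (t : BTensor A M (BTensor B N P)) :
    assocBiSymm A B R S M N P t = (assoc A B M N P).symm t := rfl

end Assoc

section Unit

variable [AddCommGroup M] [Module Aᵐᵒᵖ M] [AddCommGroup N] [Module A N]

variable (A N) in
/-- `A ⊗_A N → N`, `a ⊗ n ↦ a n`. -/
def lid : BTensor A A N →+ N :=
  lift (AddMonoidHom.mk' (fun a => AddMonoidHom.mk' (fun n => a • n) (smul_add a))
    (fun a a' => by ext n; simp [add_smul])) (fun a b n => by simp [mul_smul])

variable (A M) in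
/-- `M ⊗_A A → M`, `m ⊗ a ↦ m a`. -/
def rid : BTensor A M A →+ M :=
  lift (AddMonoidHom.mk' (fun m => AddMonoidHom.mk' (fun a => op a • m)
    (fun a a' => by simp [add_smul]))
    (fun m m' => by ext a; simp)) (fun m a b => by simp [mul_smul])

@[simp] theorem lid_tmul (a : A) (n : N) : lid A N (tmul A a n) = a • n := rfl

@[simp] theorem rid_tmul (m : M) (a : A) : rid A M (tmul A m a) = op a • m := rfl

end Unit

end BTensor

end Tensor

open BTensor

/-! ### Ring- and module-theoretic conditions -/

/-- Von Neumann regular rings: every `a` is of the form `a x a`. -/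
def IsVonNeumannRegular (A : Type*) [Ring A] : Prop := ∀ a : A, ∃ x : A, a = a * x * a

/-- The left `A`-module `N` is flat: `- ⊗_A N` preserves injections. -/
def LeftFlat (A N : Type u) [Ring A] [AddCommGroup N] [Module A N] : Prop :=
  ∀ (M M' : Type u) [AddCommGroup M] [Module Aᵐᵒᵖ M] [AddCommGroup M'] [Module Aᵐᵒᵖ M']
    (f : M →ₗ[Aᵐᵒᵖ] M'), Function.Injective f →
    Function.Injective (BTensor.map f (LinearMap.id : N →ₗ[A] N))

/-- The right `A`-module `M` is flat: `M ⊗_A -` preserves injections. -/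
def RightFlat (A M : Type u) [Ring A] [AddCommGroup M] [Module Aᵐᵒᵖ M] : Prop :=
  ∀ (N N' : Type u) [AddCommGroup N] [Module A N] [AddCommGroup N'] [Module A N']
    (f : N →ₗ[A] N'), Function.Injective f →
    Function.Injective (BTensor.map (LinearMap.id : M →ₗ[Aᵐᵒᵖ] M) f)

/-- Over `k`-algebras `A` and `B`, the elements of `k` act on the `A`-`B`-bimodule `M` in the same
way from the left and from the right. -/
def IsCentral (k A B M : Type*) [CommRing k] [Ring A] [Algebra k A] [Ring B] [Algebra k B]
    [AddCommGroup M] [Module A M] [Module Bᵐᵒᵖ M] : Prop :=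
  ∀ (r : k) (m : M), algebraMap k A r • m = op (algebraMap k B r) • m

/-! ### Colinearity of maps between modules with coactions -/

section Colinear

variable {A B C D M N : Type*} [Ring A] [Ring B]
  [AddCommGroup C] [Module A C] [Module Aᵐᵒᵖ C] [SMulCommClass A Aᵐᵒᵖ C]
  [AddCommGroup D] [Module B D] [Module Bᵐᵒᵖ D] [SMulCommClass B Bᵐᵒᵖ D]

/-- `(C ⊗_A f) ∘ lM = lN ∘ f`. -/
def IsLeftColinear [AddCommGroup M] [Module A M] [AddCommGroup N] [Module A N]
    (lM : M →ₗ[A] BTensor A C M) (lN : N →ₗ[A] BTensor A C N) (f : M →ₗ[A] N) : Prop :=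
  ∀ m, BTensor.map (LinearMap.id : C →ₗ[Aᵐᵒᵖ] C) f (lM m) = lN (f m)

/-- `(f ⊗_B D) ∘ rM = rN ∘ f`. -/
def IsRightColinear [AddCommGroup M] [Module Bᵐᵒᵖ M] [AddCommGroup N] [Module Bᵐᵒᵖ N]
    (rM : M →ₗ[Bᵐᵒᵖ] BTensor B M D) (rN : N →ₗ[Bᵐᵒᵖ] BTensor B N D) (f : M →ₗ[Bᵐᵒᵖ] N) : Prop :=
  ∀ m, BTensor.map f (LinearMap.id : D →ₗ[B] D) (rM m) = rN (f m)

/-- `f` is both left and right colinear. -/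
def IsBicolinear
    [AddCommGroup M] [Module A M] [Module Bᵐᵒᵖ M] [SMulCommClass A Bᵐᵒᵖ M]
    [AddCommGroup N] [Module A N] [Module Bᵐᵒᵖ N] [SMulCommClass A Bᵐᵒᵖ N]
    (lM : BimodHom A B M (BTensor A C M)) (rM : BimodHom A B M (BTensor B M D))
    (lN : BimodHom A B N (BTensor A C N)) (rN : BimodHom A B N (BTensor B N D))
    (f : BimodHom A B M N) : Prop :=
  IsLeftColinear lM.left lN.left f.left ∧ IsRightColinear rM.right rN.right f.right

end Colinear

/-! ### Coactions on a tensor product -/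

section TensorCoaction

variable {A B B' C D M N : Type*} [Ring A] [Ring B] [Ring B']
  [AddCommGroup C] [Module A C] [Module Aᵐᵒᵖ C] [SMulCommClass A Aᵐᵒᵖ C]
  [AddCommGroup D] [Module B' D] [Module B'ᵐᵒᵖ D] [SMulCommClass B' B'ᵐᵒᵖ D]
  [AddCommGroup M] [Module A M] [Module Bᵐᵒᵖ M] [SMulCommClass A Bᵐᵒᵖ M]
  [AddCommGroup N] [Module B N] [Module B'ᵐᵒᵖ N] [SMulCommClass B B'ᵐᵒᵖ N]

variable (N) in
/-- The left coaction `lM ⊗_B N` on `M ⊗_B N`. -/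
def tensorLeftCoact (lM : BimodHom A B M (BTensor A C M)) :
    BimodHom A B' (BTensor B M N) (BTensor A C (BTensor B M N)) :=
  (assocBi A B A B' C M N).comp (mapBi lM (BimodHom.id B B' N))

variable (M) in
/-- The right coaction `M ⊗_B rN` on `M ⊗_B N`. -/
def tensorRightCoact (rN : BimodHom B B' N (BTensor B' N D)) :
    BimodHom A B' (BTensor B M N) (BTensor B' (BTensor B M N) D) :=
  (assocBiSymm B B' A B' M N D).comp (mapBi (BimodHom.id A B M) rN)

end TensorCoaction

/-! ### Corings, comodules and bicomodules -/

/-- An `A`-coring structure on the `A`-bimodule `C`, for a `k`-algebra `A`. -/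
structure Coring (k A C : Type*) [CommRing k] [Ring A] [Algebra k A]
    [AddCommGroup C] [Module A C] [Module Aᵐᵒᵖ C] [SMulCommClass A Aᵐᵒᵖ C] where
  central : IsCentral k A A C
  comul : BimodHom A A C (BTensor A C C)
  counit : BimodHom A A C A
  coassoc : ∀ c, assoc A A C C C (mapBi comul (BimodHom.id A A C) (comul c)) =
    mapBi (BimodHom.id A A C) comul (comul c)
  counit_left : ∀ c, lid A C (mapBi counit (BimodHom.id A A C) (comul c)) = c
  counit_right : ∀ c, rid A C (mapBi (BimodHom.id A A C) counit (comul c)) = c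

section Comodules

variable {k : Type v} {A B C D M : Type u} [CommRing k]
  [Ring A] [Algebra k A] [Ring B] [Algebra k B]
  [AddCommGroup C] [Module A C] [Module Aᵐᵒᵖ C] [SMulCommClass A Aᵐᵒᵖ C]
  [AddCommGroup D] [Module B D] [Module Bᵐᵒᵖ D] [SMulCommClass B Bᵐᵒᵖ D]

/-- A right comodule structure on the right `A`-module `M`. -/
structure RightComod (𝓒 : Coring k A C) (M : Type u) [AddCommGroup M] [Module Aᵐᵒᵖ M] where
  coact : M →ₗ[Aᵐᵒᵖ] BTensor A M C
  coassoc : ∀ m, assoc A A M C C (BTensor.map coact LinearMap.id (coact m)) =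
    BTensor.map LinearMap.id 𝓒.comul.left (coact m)
  counit : ∀ m, rid A M (BTensor.map LinearMap.id 𝓒.counit.left (coact m)) = m

/-- A `𝓒`-`𝓓`-bicomodule structure on the `A`-`B`-bimodule `M`. -/
structure Bicomod (𝓒 : Coring k A C) (𝓓 : Coring k B D) (M : Type u)
    [AddCommGroup M] [Module A M] [Module Bᵐᵒᵖ M] [SMulCommClass A Bᵐᵒᵖ M] where
  central : IsCentral k A B M
  lcoact : BimodHom A B M (BTensor A C M)
  rcoact : BimodHom A B M (BTensor B M D)
  lcoassoc : ∀ m, assoc A A C C M (mapBi 𝓒.comul (BimodHom.id A B M) (lcoact m)) =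
    mapBi (BimodHom.id A A C) lcoact (lcoact m)
  lcounit : ∀ m, lid A M (mapBi 𝓒.counit (BimodHom.id A B M) (lcoact m)) = m
  rcoassoc : ∀ m, assoc B B M D D (mapBi rcoact (BimodHom.id B B D) (rcoact m)) =
    mapBi (BimodHom.id A B M) 𝓓.comul (rcoact m)
  rcounit : ∀ m, rid B M (mapBi (BimodHom.id A B M) 𝓓.counit (rcoact m)) = m
  compat : ∀ m, assoc A B C M D (mapBi lcoact (BimodHom.id B B D) (rcoact m)) =
    mapBi (BimodHom.id A A C) rcoact (lcoact m)

/-- A coring as a bicomodule over itself. -/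
def Coring.self (𝓒 : Coring k A C) : Bicomod 𝓒 𝓒 C where
  central := 𝓒.central
  lcoact := 𝓒.comul
  rcoact := 𝓒.comul
  lcoassoc := 𝓒.coassoc
  lcounit := 𝓒.counit_left
  rcoassoc := 𝓒.coassoc
  rcounit := 𝓒.counit_right
  compat := 𝓒.coassoc

/-- The coring is coseparable: its comultiplication has a bicolinear left inverse, where `C ⊗_A C`
carries the coactions `Δ ⊗_A C` and `C ⊗_A Δ`. -/
def Coring.IsCoseparable (𝓒 : Coring k A C) : Prop :=
  ∃ π : BimodHom A A (BTensor A C C) C,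
    IsBicolinear (tensorLeftCoact C 𝓒.comul) (tensorRightCoact C 𝓒.comul) 𝓒.comul 𝓒.comul π ∧
    ∀ c, π (𝓒.comul c) = c

/-- Morphisms of bicomodules. -/
structure BicomodHom {𝓒 : Coring k A C} {𝓓 : Coring k B D} {M N : Type u}
    [AddCommGroup M] [Module A M] [Module Bᵐᵒᵖ M] [SMulCommClass A Bᵐᵒᵖ M]
    [AddCommGroup N] [Module A N] [Module Bᵐᵒᵖ N] [SMulCommClass A Bᵐᵒᵖ N]
    (P : Bicomod 𝓒 𝓓 M) (Q : Bicomod 𝓒 𝓓 N) where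
  toHom : BimodHom A B M N
  bicolinear : IsBicolinear P.lcoact P.rcoact Q.lcoact Q.rcoact toHom

end Comodules

/-! ### The cotensor product -/

section CotensorSubgroup

variable {A C M N M' N' : Type*} [Ring A]
  [AddCommGroup C] [Module A C] [Module Aᵐᵒᵖ C] [SMulCommClass A Aᵐᵒᵖ C]
  [AddCommGroup M] [Module Aᵐᵒᵖ M] [AddCommGroup N] [Module A N]
  [AddCommGroup M'] [Module Aᵐᵒᵖ M'] [AddCommGroup N'] [Module A N']

/-- The kernel of `ρ ⊗_A N - M ⊗_A l : M ⊗_A N → M ⊗_A C ⊗_A N`. -/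
def cotensorSubgroup (ρ : M →ₗ[Aᵐᵒᵖ] BTensor A M C) (l : N →ₗ[A] BTensor A C N) :
    AddSubgroup (BTensor A M N) :=
  AddMonoidHom.ker ((assoc A A M C N).toAddMonoidHom.comp (BTensor.map ρ LinearMap.id) -
    BTensor.map LinearMap.id l)

theorem mem_cotensorSubgroup {ρ : M →ₗ[Aᵐᵒᵖ] BTensor A M C} {l : N →ₗ[A] BTensor A C N}
    {t : BTensor A M N} : t ∈ cotensorSubgroup ρ l ↔
      assoc A A M C N (BTensor.map ρ LinearMap.id t) = BTensor.map LinearMap.id l t := by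
  rw [cotensorSubgroup, AddMonoidHom.mem_ker, AddMonoidHom.sub_apply, sub_eq_zero]
  rfl

/-- `id ⊗ g` as a map of left modules. -/
def lTensorLeft (g : N →ₗ[A] N') : BTensor A C N →ₗ[A] BTensor A C N' where
  toFun := BTensor.map LinearMap.id g
  map_add' := map_add _
  map_smul' a t := by
    induction t using BTensor.induction_on with
    | h0 => simp
    | ht m n => rfl
    | ha x y hx hy => simp_all only [smul_add, map_add]

/-- `f ⊗ id` as a map of right modules. -/
def rTensorRight (f : M →ₗ[Aᵐᵒᵖ] M') : BTensor A M C →ₗ[Aᵐᵒᵖ] BTensor A M' C where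
  toFun := BTensor.map f LinearMap.id
  map_add' := map_add _
  map_smul' a t := by
    induction t using BTensor.induction_on with
    | h0 => simp
    | ht m n => rfl
    | ha x y hx hy => simp_all only [smul_add, map_add]

theorem assoc_naturality (f : M →ₗ[Aᵐᵒᵖ] M') (g : N →ₗ[A] N')
    (t : BTensor A (BTensor A M C) N) :
    assoc A A M' C N' (BTensor.map (rTensorRight f) g t) =
      BTensor.map f (lTensorLeft g) (assoc A A M C N t) := by
  induction t using BTensor.induction_on with
  | h0 => simp
  | ht t n =>
    induction t using BTensor.induction_on with
    | h0 =>
      rw [zero_tmul]; simp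
    | ht m c => rfl
    | ha x y hx hy => simp only [add_tmul, map_add, hx, hy]
  | ha x y hx hy => simp only [map_add, hx, hy]

theorem map_mem_cotensorSubgroup
    {ρ : M →ₗ[Aᵐᵒᵖ] BTensor A M C} {l : N →ₗ[A] BTensor A C N}
    {ρ' : M' →ₗ[Aᵐᵒᵖ] BTensor A M' C} {l' : N' →ₗ[A] BTensor A C N'}
    (f : M →ₗ[Aᵐᵒᵖ] M') (g : N →ₗ[A] N')
    (hf : IsRightColinear ρ ρ' f) (hg : IsLeftColinear l l' g)
    {t : BTensor A M N} (ht : t ∈ cotensorSubgroup ρ l) :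
    BTensor.map f g t ∈ cotensorSubgroup ρ' l' := by
  rw [mem_cotensorSubgroup] at ht ⊢
  have hf' : ρ'.comp f = (rTensorRight f).comp ρ := LinearMap.ext fun m => (hf m).symm
  have hg' : l'.comp g = (lTensorLeft g).comp l := LinearMap.ext fun n => (hg n).symm
  have h1 : BTensor.map ρ' LinearMap.id (BTensor.map f g t) =
      BTensor.map (rTensorRight f) g (BTensor.map ρ LinearMap.id t) := by
    rw [map_map, map_map, hf']; rfl
  have h2 : BTensor.map LinearMap.id l' (BTensor.map f g t) =
      BTensor.map f (lTensorLeft g) (BTensor.map LinearMap.id l t) := by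
    rw [map_map, map_map, hg']; rfl
  rw [h1, h2, assoc_naturality, ht]

/-- `f □ g`, the restriction of `f ⊗ g` to the cotensor products. -/
def cotensorSubgroupMap
    {ρ : M →ₗ[Aᵐᵒᵖ] BTensor A M C} {l : N →ₗ[A] BTensor A C N}
    {ρ' : M' →ₗ[Aᵐᵒᵖ] BTensor A M' C} {l' : N' →ₗ[A] BTensor A C N'}
    (f : M →ₗ[Aᵐᵒᵖ] M') (g : N →ₗ[A] N')
    (hf : IsRightColinear ρ ρ' f) (hg : IsLeftColinear l l' g) :
    cotensorSubgroup ρ l →+ cotensorSubgroup ρ' l' :=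
  ((BTensor.map f g).comp (cotensorSubgroup ρ l).subtype).codRestrict _
    (fun t => map_mem_cotensorSubgroup f g hf hg t.2)

end CotensorSubgroup

section Coflat

variable {k : Type v} {A C N : Type u} [CommRing k] [Ring A] [Algebra k A]
  [AddCommGroup C] [Module A C] [Module Aᵐᵒᵖ C] [SMulCommClass A Aᵐᵒᵖ C]
  [AddCommGroup N] [Module A N]

theorem isLeftColinear_id (l : N →ₗ[A] BTensor A C N) :
    IsLeftColinear l l LinearMap.id := fun m => by
  have h : BTensor.map (LinearMap.id : C →ₗ[Aᵐᵒᵖ] C) (LinearMap.id : N →ₗ[A] N) =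
      AddMonoidHom.id _ := hom_ext fun _ _ => rfl
  rw [h]; rfl

theorem isRightColinear_id {M : Type*} [AddCommGroup M] [Module Aᵐᵒᵖ M]
    (r : M →ₗ[Aᵐᵒᵖ] BTensor A M C) :
    IsRightColinear r r LinearMap.id := fun m => by
  have h : BTensor.map (LinearMap.id : M →ₗ[Aᵐᵒᵖ] M) (LinearMap.id : C →ₗ[A] C) =
      AddMonoidHom.id _ := hom_ext fun _ _ => rfl
  rw [h]; rfl

/-- `N`, with left coaction `l`, is coflat: the functor `- □_C N` on right `C`-comodules takes
short exact sequences to short exact sequences. -/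
def IsCoflat (𝓒 : Coring k A C) (l : N →ₗ[A] BTensor A C N) : Prop :=
  ∀ (M₁ M₂ M₃ : Type u)
    [AddCommGroup M₁] [Module Aᵐᵒᵖ M₁] [AddCommGroup M₂] [Module Aᵐᵒᵖ M₂]
    [AddCommGroup M₃] [Module Aᵐᵒᵖ M₃]
    (P₁ : RightComod 𝓒 M₁) (P₂ : RightComod 𝓒 M₂) (P₃ : RightComod 𝓒 M₃)
    (f : M₁ →ₗ[Aᵐᵒᵖ] M₂) (g : M₂ →ₗ[Aᵐᵒᵖ] M₃)
    (hf : IsRightColinear P₁.coact P₂.coact f) (hg : IsRightColinear P₂.coact P₃.coact g),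
    Function.Injective f → Function.Exact f g → Function.Surjective g →
      Function.Injective (cotensorSubgroupMap f LinearMap.id hf (isLeftColinear_id l)) ∧
      Function.Exact (cotensorSubgroupMap f LinearMap.id hf (isLeftColinear_id l))
        (cotensorSubgroupMap g LinearMap.id hg (isLeftColinear_id l)) ∧
      Function.Surjective (cotensorSubgroupMap g LinearMap.id hg (isLeftColinear_id l))

end Coflat

section Cotensor

variable {k : Type v} [CommRing k] {A₁ A₂ A₃ C₁ C₂ C₃ M N M' N' : Type u}
  [Ring A₁] [Algebra k A₁] [Ring A₂] [Algebra k A₂] [Ring A₃] [Algebra k A₃]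
  [AddCommGroup C₁] [Module A₁ C₁] [Module A₁ᵐᵒᵖ C₁] [SMulCommClass A₁ A₁ᵐᵒᵖ C₁]
  [AddCommGroup C₂] [Module A₂ C₂] [Module A₂ᵐᵒᵖ C₂] [SMulCommClass A₂ A₂ᵐᵒᵖ C₂]
  [AddCommGroup C₃] [Module A₃ C₃] [Module A₃ᵐᵒᵖ C₃] [SMulCommClass A₃ A₃ᵐᵒᵖ C₃]
  {𝓒₁ : Coring k A₁ C₁} {𝓒₂ : Coring k A₂ C₂} {𝓒₃ : Coring k A₃ C₃}
  [AddCommGroup M] [Module A₁ M] [Module A₂ᵐᵒᵖ M] [SMulCommClass A₁ A₂ᵐᵒᵖ M]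
  [AddCommGroup N] [Module A₂ N] [Module A₃ᵐᵒᵖ N] [SMulCommClass A₂ A₃ᵐᵒᵖ N]
  [AddCommGroup M'] [Module A₁ M'] [Module A₂ᵐᵒᵖ M'] [SMulCommClass A₁ A₂ᵐᵒᵖ M']
  [AddCommGroup N'] [Module A₂ N'] [Module A₃ᵐᵒᵖ N'] [SMulCommClass A₂ A₃ᵐᵒᵖ N']

/-- The cotensor product of two bicomodules. -/
def Cotensor (P : Bicomod 𝓒₁ 𝓒₂ M) (Q : Bicomod 𝓒₂ 𝓒₃ N) : Type u :=
  cotensorSubgroup P.rcoact.right Q.lcoact.left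

namespace Cotensor

instance (P : Bicomod 𝓒₁ 𝓒₂ M) (Q : Bicomod 𝓒₂ 𝓒₃ N) : AddCommGroup (Cotensor P Q) :=
  inferInstanceAs (AddCommGroup (cotensorSubgroup P.rcoact.right Q.lcoact.left))

/-- The inclusion into the tensor product, as an additive map. -/
def val (P : Bicomod 𝓒₁ 𝓒₂ M) (Q : Bicomod 𝓒₂ 𝓒₃ N) : Cotensor P Q →+ BTensor A₂ M N :=
  (cotensorSubgroup P.rcoact.right Q.lcoact.left).subtype

theorem val_injective (P : Bicomod 𝓒₁ 𝓒₂ M) (Q : Bicomod 𝓒₂ 𝓒₃ N) :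
    Function.Injective (val P Q) := Subtype.val_injective

theorem lsmul_mem (P : Bicomod 𝓒₁ 𝓒₂ M) (Q : Bicomod 𝓒₂ 𝓒₃ N) (a : A₁) {t : BTensor A₂ M N}
    (ht : t ∈ cotensorSubgroup P.rcoact.right Q.lcoact.left) :
    a • t ∈ cotensorSubgroup P.rcoact.right Q.lcoact.left := by
  rw [mem_cotensorSubgroup] at ht ⊢
  have h1 := (mapBi P.rcoact (BimodHom.id A₂ A₃ N)).map_lsmul a t
  have h2 := (mapBi (BimodHom.id A₁ A₂ M) Q.lcoact).map_lsmul a t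
  have h3 := congrArg (fun x => a • x) ht
  exact (congrArg _ h1).trans ((assoc_lsmul a _).trans (h3.trans h2.symm))

theorem rsmul_mem (P : Bicomod 𝓒₁ 𝓒₂ M) (Q : Bicomod 𝓒₂ 𝓒₃ N) (a : A₃ᵐᵒᵖ)
    {t : BTensor A₂ M N} (ht : t ∈ cotensorSubgroup P.rcoact.right Q.lcoact.left) :
    a • t ∈ cotensorSubgroup P.rcoact.right Q.lcoact.left := by
  rw [mem_cotensorSubgroup] at ht ⊢
  have h1 := (mapBi P.rcoact (BimodHom.id A₂ A₃ N)).map_rsmul a t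
  have h2 := (mapBi (BimodHom.id A₁ A₂ M) Q.lcoact).map_rsmul a t
  have h3 := congrArg (fun x => a • x) ht
  exact (congrArg _ h1).trans ((assoc_rsmul a _).trans (h3.trans h2.symm))

instance (P : Bicomod 𝓒₁ 𝓒₂ M) (Q : Bicomod 𝓒₂ 𝓒₃ N) : Module A₁ (Cotensor P Q) where
  smul a t := ⟨a • val P Q t, lsmul_mem P Q a t.2⟩
  one_smul t := val_injective P Q (one_smul A₁ (val P Q t))
  mul_smul a b t := val_injective P Q (mul_smul a b (val P Q t))
  smul_zero a := val_injective P Q (smul_zero (A := BTensor A₂ M N) a)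
  smul_add a s t := val_injective P Q (smul_add a (val P Q s) (val P Q t))
  add_smul a b t := val_injective P Q (add_smul a b (val P Q t))
  zero_smul t := val_injective P Q (zero_smul A₁ (val P Q t))

instance (P : Bicomod 𝓒₁ 𝓒₂ M) (Q : Bicomod 𝓒₂ 𝓒₃ N) : Module A₃ᵐᵒᵖ (Cotensor P Q) where
  smul a t := ⟨a • val P Q t, rsmul_mem P Q a t.2⟩
  one_smul t := val_injective P Q (one_smul A₃ᵐᵒᵖ (val P Q t))
  mul_smul a b t := val_injective P Q (mul_smul a b (val P Q t))
  smul_zero a := val_injective P Q (smul_zero (A := BTensor A₂ M N) a)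
  smul_add a s t := val_injective P Q (smul_add a (val P Q s) (val P Q t))
  add_smul a b t := val_injective P Q (add_smul a b (val P Q t))
  zero_smul t := val_injective P Q (zero_smul A₃ᵐᵒᵖ (val P Q t))

instance (P : Bicomod 𝓒₁ 𝓒₂ M) (Q : Bicomod 𝓒₂ 𝓒₃ N) :
    SMulCommClass A₁ A₃ᵐᵒᵖ (Cotensor P Q) where
  smul_comm a b t := val_injective P Q (smul_comm a b (val P Q t))

/-- The inclusion `M □ N → M ⊗ N`. -/
def incl (P : Bicomod 𝓒₁ 𝓒₂ M) (Q : Bicomod 𝓒₂ 𝓒₃ N) :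
    BimodHom A₁ A₃ (Cotensor P Q) (BTensor A₂ M N) :=
  BimodHom.mk' (val P Q) (fun _ _ => rfl) (fun _ _ => rfl)

/-- `f □ g` for a right colinear `f` and a left colinear `g`. -/
def map {P : Bicomod 𝓒₁ 𝓒₂ M} {Q : Bicomod 𝓒₂ 𝓒₃ N} {P' : Bicomod 𝓒₁ 𝓒₂ M'}
    {Q' : Bicomod 𝓒₂ 𝓒₃ N'} (f : BimodHom A₁ A₂ M M') (g : BimodHom A₂ A₃ N N')
    (hf : IsRightColinear P.rcoact.right P'.rcoact.right f.right)
    (hg : IsLeftColinear Q.lcoact.left Q'.lcoact.left g.left) :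
    BimodHom A₁ A₃ (Cotensor P Q) (Cotensor P' Q') :=
  BimodHom.mk' (cotensorSubgroupMap f.right g.left hf hg)
    (fun a t => val_injective P' Q' ((mapBi f g).map_lsmul a (val P Q t)))
    (fun a t => val_injective P' Q' ((mapBi f g).map_rsmul a (val P Q t)))

theorem incl_map {P : Bicomod 𝓒₁ 𝓒₂ M} {Q : Bicomod 𝓒₂ 𝓒₃ N} {P' : Bicomod 𝓒₁ 𝓒₂ M'}
    {Q' : Bicomod 𝓒₂ 𝓒₃ N'} (f : BimodHom A₁ A₂ M M') (g : BimodHom A₂ A₃ N N')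
    (hf : IsRightColinear P.rcoact.right P'.rcoact.right f.right)
    (hg : IsLeftColinear Q.lcoact.left Q'.lcoact.left g.left) (t : Cotensor P Q) :
    incl P' Q' (map f g hf hg t) = mapBi f g (incl P Q t) := rfl

/-- `f □ N`. -/
def mapLeft {P : Bicomod 𝓒₁ 𝓒₂ M} {P' : Bicomod 𝓒₁ 𝓒₂ M'} (f : BicomodHom P P')
    (Q : Bicomod 𝓒₂ 𝓒₃ N) : BimodHom A₁ A₃ (Cotensor P Q) (Cotensor P' Q) :=
  map f.toHom (BimodHom.id A₂ A₃ N) f.bicolinear.2 (isLeftColinear_id Q.lcoact.left)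

/-- `M □ g`. -/
def mapRight (P : Bicomod 𝓒₁ 𝓒₂ M) {Q : Bicomod 𝓒₂ 𝓒₃ N} {Q' : Bicomod 𝓒₂ 𝓒₃ N'}
    (g : BicomodHom Q Q') : BimodHom A₁ A₃ (Cotensor P Q) (Cotensor P Q') :=
  map (BimodHom.id A₁ A₂ M) g.toHom (isRightColinear_id P.rcoact.right) g.bicolinear.1

/-- The canonical map `M → M □ C` (an isomorphism) given by the right coaction. -/
def coactRight (P : Bicomod 𝓒₁ 𝓒₂ M) : BimodHom A₁ A₂ M (Cotensor P 𝓒₂.self) :=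
  BimodHom.mk' ((P.rcoact : M →+ BTensor A₂ M C₂).codRestrict _
      (fun m => mem_cotensorSubgroup.2 (P.rcoassoc m)))
    (fun a m => val_injective P 𝓒₂.self (P.rcoact.map_lsmul a m))
    (fun a m => val_injective P 𝓒₂.self (P.rcoact.map_rsmul a m))

/-- The canonical map `N → C □ N` (an isomorphism) given by the left coaction. -/
def coactLeft (Q : Bicomod 𝓒₂ 𝓒₃ N) : BimodHom A₂ A₃ N (Cotensor 𝓒₂.self Q) :=
  BimodHom.mk' ((Q.lcoact : N →+ BTensor A₂ C₂ N).codRestrict _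
      (fun m => mem_cotensorSubgroup.2 (Q.lcoassoc m)))
    (fun a m => val_injective 𝓒₂.self Q (Q.lcoact.map_lsmul a m))
    (fun a m => val_injective 𝓒₂.self Q (Q.lcoact.map_rsmul a m))

/-- The bicomodule structure `S` on `M □ N` is the one induced from the bicomodule `M ⊗ N`: the
inclusion `M □ N → M ⊗ N` is bicolinear. -/
def IsInduced (P : Bicomod 𝓒₁ 𝓒₂ M) (Q : Bicomod 𝓒₂ 𝓒₃ N)
    (S : Bicomod 𝓒₁ 𝓒₃ (Cotensor P Q)) : Prop :=
  IsBicolinear S.lcoact S.rcoact (tensorLeftCoact N P.lcoact) (tensorRightCoact M Q.rcoact)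
    (incl P Q)

end Cotensor

end Cotensor

section CotensorAssoc

variable {k : Type v} [CommRing k] {A₁ A₂ A₃ A₄ C₁ C₂ C₃ C₄ L M N : Type u}
  [Ring A₁] [Algebra k A₁] [Ring A₂] [Algebra k A₂] [Ring A₃] [Algebra k A₃]
  [Ring A₄] [Algebra k A₄]
  [AddCommGroup C₁] [Module A₁ C₁] [Module A₁ᵐᵒᵖ C₁] [SMulCommClass A₁ A₁ᵐᵒᵖ C₁]
  [AddCommGroup C₂] [Module A₂ C₂] [Module A₂ᵐᵒᵖ C₂] [SMulCommClass A₂ A₂ᵐᵒᵖ C₂]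
  [AddCommGroup C₃] [Module A₃ C₃] [Module A₃ᵐᵒᵖ C₃] [SMulCommClass A₃ A₃ᵐᵒᵖ C₃]
  [AddCommGroup C₄] [Module A₄ C₄] [Module A₄ᵐᵒᵖ C₄] [SMulCommClass A₄ A₄ᵐᵒᵖ C₄]
  {𝓒₁ : Coring k A₁ C₁} {𝓒₂ : Coring k A₂ C₂} {𝓒₃ : Coring k A₃ C₃} {𝓒₄ : Coring k A₄ C₄}
  [AddCommGroup L] [Module A₁ L] [Module A₂ᵐᵒᵖ L] [SMulCommClass A₁ A₂ᵐᵒᵖ L]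
  [AddCommGroup M] [Module A₂ M] [Module A₃ᵐᵒᵖ M] [SMulCommClass A₂ A₃ᵐᵒᵖ M]
  [AddCommGroup N] [Module A₃ N] [Module A₄ᵐᵒᵖ N] [SMulCommClass A₃ A₄ᵐᵒᵖ N]

/-- `α` is the canonical isomorphism `L □ (M □ N) ≃ (L □ M) □ N`, that is, the restriction of the
canonical isomorphism `L ⊗ (M ⊗ N) ≃ (L ⊗ M) ⊗ N`. Here `S` and `T` are the bicomodule structures
of `L □ M` and `M □ N`. -/
def Cotensor.IsAssoc {P : Bicomod 𝓒₁ 𝓒₂ L} {Q : Bicomod 𝓒₂ 𝓒₃ M} {R : Bicomod 𝓒₃ 𝓒₄ N}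
    (S : Bicomod 𝓒₁ 𝓒₃ (Cotensor P Q)) (T : Bicomod 𝓒₂ 𝓒₄ (Cotensor Q R))
    (α : Cotensor P T ≃+ Cotensor S R) : Prop :=
  ∀ t, assoc A₂ A₃ L M N
      (mapBi (Cotensor.incl P Q) (BimodHom.id A₃ A₄ N) (Cotensor.incl S R (α t))) =
    mapBi (BimodHom.id A₁ A₂ L) (Cotensor.incl Q R) (Cotensor.incl P T t)

/-- `γ` is the canonical isomorphism `L □ ((M □ L) □ M) ≃ (L □ M) □ (L □ M)`, that is, the
restriction of the canonical isomorphism `L ⊗ ((M ⊗ L) ⊗ M) ≃ (L ⊗ M) ⊗ (L ⊗ M)`. Here `S`, `T` and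
`U` are the bicomodule structures of `M □ L`, `L □ M` and `(M □ L) □ M`. Elements of both sides are
compared in `L ⊗ (M ⊗ (L ⊗ M))`. -/
def Cotensor.IsMiddleAssoc {M : Type u}
    [AddCommGroup M] [Module A₂ M] [Module A₁ᵐᵒᵖ M] [SMulCommClass A₂ A₁ᵐᵒᵖ M]
    {P : Bicomod 𝓒₁ 𝓒₂ L} {Q : Bicomod 𝓒₂ 𝓒₁ M}
    (S : Bicomod 𝓒₂ 𝓒₂ (Cotensor Q P)) (T : Bicomod 𝓒₁ 𝓒₁ (Cotensor P Q))
    (U : Bicomod 𝓒₂ 𝓒₁ (Cotensor S Q)) (γ : Cotensor P U ≃+ Cotensor T T) : Prop :=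
  ∀ w, assoc A₂ A₁ L M (BTensor A₂ L M)
      (mapBi (Cotensor.incl P Q) (Cotensor.incl P Q) (Cotensor.incl T T (γ w))) =
    mapBi (BimodHom.id A₁ A₂ L)
      ((assocBi A₁ A₂ A₂ A₁ M L M).comp
        ((mapBi (Cotensor.incl Q P) (BimodHom.id A₂ A₁ M)).comp (Cotensor.incl S Q)))
      (Cotensor.incl P U w)

end CotensorAssoc

end GenComatrix

/-!
All four cotensor products are kernels, inside tensor products, of differences
`ρ ⊗ N - M ⊗ λ`, and the only obstacle to working with them as with tensor products is that a
functor `W ⊗ -` or `- ⊗ V` need not preserve such a kernel. The three hypotheses are three ways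
to remove it (`LPres`, `RPres` and `LPreserving` record what is preserved).

* Over a von Neumann regular ring every module is flat: finitely many elements of a left ideal have
  a common right unit in the ideal, so that character modules satisfy Baer's criterion.
* If `N` is coflat over a left flat coring, then `W ⊗ (M □ N)` and `(W ⊗ M) □ N` are right exact
  functors of `W` that agree for free `W` (`IsCoflat.lPres`). Moreover `N` is left flat, since
  `W ⊗ N` is a natural retract of `(W ⊗ C) □ N` (`IsCoflat.leftFlat`).
* Over a coseparable coring the coaction of `N` has a colinear retraction, so that the kernel
  `M □ N` is split and every additive functor preserves it.

Given this, `M □ N` is a subbicomodule of `M ⊗ N` (`exists_induced`), and both `L □ (M □ N)` and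
`(L □ M) □ N` are the intersection of two kernels inside `L ⊗ M ⊗ N` (`exists_addEquiv`), which
gives the associativity isomorphisms.

For the coring, let `Ψ` be the composite `C → X □ L → X ⊗ L`. The maps
`l ⊗ x ↦ l₀ ⊗ Ψ(l₁) ⊗ x` and `l ⊗ x ↦ l ⊗ Ψ(x₋₁) ⊗ x₀` from `L ⊗ X` to
`(L ⊗ X) ⊗ (L ⊗ X)` agree on `L □ X`, by the definition of the cotensor product, and
their common restriction is the comultiplication. The first has the form `Θ ⊗ X`, the second has
the form `L ⊗ Θ'`; such maps commute, and this is coassociativity. The triangle identities say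
that `ω` turns `Θ` and `Θ'` into the coactions of `L` and `X`, so the counit axioms for `L □ X`
reduce to those for the comodules `L` and `X` (`exists_coring`).
-/

namespace GenComatrix

open BTensor

/-! ### Exactness of tensor products -/

namespace BimodHom

variable {A B K M N P Y : Type*} [Ring A] [Ring B]
  [AddCommGroup K] [Module A K] [Module Bᵐᵒᵖ K]
  [AddCommGroup M] [Module A M] [Module Bᵐᵒᵖ M]
  [AddCommGroup N] [Module A N] [Module Bᵐᵒᵖ N]
  [AddCommGroup Y] [Module A Y] [Module Bᵐᵒᵖ Y]

/-- The underlying additive map. -/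
abbrev add (f : BimodHom A B M N) : M →+ N := (f : M →+ N)

/-- The difference of two bimodule maps. -/
def sub (f g : BimodHom A B M N) : BimodHom A B M N :=
  mk' ((f : M →+ N) - (g : M →+ N)) (fun a m => by simp [map_lsmul, smul_sub])
    (fun b m => by simp [map_rsmul, smul_sub])

/-- A bimodule map whose values lie in the image of an injective bimodule map `j` factors
through `j`. -/
theorem exists_lift {j : BimodHom A B K Y} (hj : Function.Injective j) (f : BimodHom A B M Y)
    (h : ∀ m, ∃ k, j k = f m) : ∃ g : BimodHom A B M K, ∀ m, j (g m) = f m := by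
  choose g hg using h
  refine ⟨mk' (AddMonoidHom.mk' g fun x y => hj ?_) (fun a m => hj ?_) (fun b m => hj ?_), hg⟩
  · rw [map_add, hg, hg, hg, map_add]
  · change j (g _) = j (a • g m)
    rw [map_lsmul, hg, hg, map_lsmul]
  · change j (g _) = j (b • g m)
    rw [map_rsmul, hg, hg, map_rsmul]

end BimodHom

namespace BTensor

section Exact

variable {A K Y Z V W W' V' : Type*} [Ring A]

/-- `W ⊗_A f`. -/
abbrev lT (W : Type*) [AddCommGroup W] [Module Aᵐᵒᵖ W]
    [AddCommGroup K] [Module A K] [AddCommGroup Y] [Module A Y] (f : K →ₗ[A] Y) :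
    BTensor A W K →+ BTensor A W Y := BTensor.map LinearMap.id f

/-- `f ⊗_A V`. -/
abbrev rT (V : Type*) [AddCommGroup V] [Module A V]
    [AddCommGroup K] [Module Aᵐᵒᵖ K] [AddCommGroup Y] [Module Aᵐᵒᵖ Y] (f : K →ₗ[Aᵐᵒᵖ] Y) :
    BTensor A K V →+ BTensor A Y V := BTensor.map f LinearMap.id

theorem map_surjective [AddCommGroup K] [Module Aᵐᵒᵖ K] [AddCommGroup Y] [Module Aᵐᵒᵖ Y]
    [AddCommGroup V] [Module A V] [AddCommGroup V'] [Module A V']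
    {f : K →ₗ[Aᵐᵒᵖ] Y} {g : V →ₗ[A] V'} (hf : Function.Surjective f)
    (hg : Function.Surjective g) : Function.Surjective (BTensor.map f g) := by
  intro t
  induction t using BTensor.induction_on with
  | h0 => exact ⟨0, map_zero _⟩
  | ht y v =>
    obtain ⟨k, rfl⟩ := hf y
    obtain ⟨w, rfl⟩ := hg v
    exact ⟨tmul A k w, rfl⟩
  | ha x y hx hy =>
    obtain ⟨a, rfl⟩ := hx
    obtain ⟨b, rfl⟩ := hy
    exact ⟨a + b, map_add _ _ _⟩

section Left

variable [AddCommGroup W] [Module Aᵐᵒᵖ W] [AddCommGroup K] [Module A K]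
  [AddCommGroup Y] [Module A Y] [AddCommGroup Z] [Module A Z]

theorem lT_sub (f g : K →ₗ[A] Y) (t : BTensor A W K) : lT W (f - g) t = lT W f t - lT W g t := by
  have h : lT W (f - g) = lT W f - lT W g := hom_ext fun w k => by
    change tmul A w (f k - g k) = tmul A w (f k) - tmul A w (g k)
    exact map_sub (mkHom (A := A) w) _ _
  rw [h]; rfl

/-- Right exactness of `W ⊗_A -`. -/
theorem lT_exact {f : K →ₗ[A] Y} {g : Y →ₗ[A] Z} (h : Function.Exact f g)
    (hg : Function.Surjective g) : Function.Exact (lT W f) (lT W g) := by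
  have hk : ∀ (w : W) (y y' : Y), g y = g y' →
      (QuotientAddGroup.mk' (lT W f).range) (tmul A w y) =
      (QuotientAddGroup.mk' (lT W f).range) (tmul A w y') := by
    intro w y y' hy
    have h1 : g (y - y') = 0 := by rw [map_sub, hy, sub_self]
    obtain ⟨k, hk⟩ := (h _).1 h1
    rw [← sub_eq_zero, ← map_sub]
    refine (QuotientAddGroup.eq_zero_iff _).2 ⟨tmul A w k, ?_⟩
    rw [BTensor.map_tmul, hk]
    exact map_sub (mkHom (A := A) w) _ _
  have hs := Function.surjInv_eq hg
  let φ : BTensor A W Z →+ BTensor A W Y ⧸ (lT W f).range := BTensor.lift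
    (AddMonoidHom.mk' (fun w => AddMonoidHom.mk'
      (fun z => QuotientAddGroup.mk' (lT W f).range (tmul A w (Function.surjInv hg z)))
      (fun z z' => by
        rw [← map_add, ← tmul_add]
        exact hk _ _ _ (by rw [map_add, hs, hs, hs])))
      (fun w w' => by
        ext z
        change QuotientAddGroup.mk' (lT W f).range _ = QuotientAddGroup.mk' (lT W f).range _ +
          QuotientAddGroup.mk' (lT W f).range _
        rw [← map_add, ← add_tmul]))
    (fun w a z => by
      change QuotientAddGroup.mk' (lT W f).range _ = QuotientAddGroup.mk' (lT W f).range _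
      rw [smul_tmul]
      exact hk _ _ _ (by rw [map_smul, hs, hs]))
  have hφ : φ.comp (lT W g) = QuotientAddGroup.mk' (lT W f).range := hom_ext fun w y => by
    exact hk _ _ _ (by rw [hs]; rfl)
  intro t
  constructor
  · intro ht
    have := DFunLike.congr_fun hφ t
    rw [AddMonoidHom.comp_apply, ht, map_zero] at this
    exact (QuotientAddGroup.eq_zero_iff (N := (lT W f).range) t).1 this.symm
  · rintro ⟨s, rfl⟩
    rw [BTensor.map_map]
    have : g ∘ₗ f = 0 := LinearMap.ext fun x => h.apply_apply_eq_zero x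
    rw [this]
    induction s using BTensor.induction_on with
    | h0 => simp
    | ht m n => exact tmul_zero _
    | ha x y hx hy => rw [map_add, hx, hy, add_zero]

end Left

section Right

variable [AddCommGroup V] [Module A V] [AddCommGroup K] [Module Aᵐᵒᵖ K]
  [AddCommGroup Y] [Module Aᵐᵒᵖ Y] [AddCommGroup Z] [Module Aᵐᵒᵖ Z]

theorem rT_sub (f g : K →ₗ[Aᵐᵒᵖ] Y) (t : BTensor A K V) :
    rT V (f - g) t = rT V f t - rT V g t := by
  have h : rT V (f - g) = rT V f - rT V g := hom_ext fun k v => by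
    change tmul A (f k - g k) v = tmul A (f k) v - tmul A (g k) v
    exact map_sub ((mkHom (A := A)).flip v) _ _
  rw [h]; rfl

/-- Right exactness of `- ⊗_A V`. -/
theorem rT_exact {f : K →ₗ[Aᵐᵒᵖ] Y} {g : Y →ₗ[Aᵐᵒᵖ] Z} (h : Function.Exact f g)
    (hg : Function.Surjective g) : Function.Exact (rT V f) (rT V g) := by
  have hk : ∀ (v : V) (y y' : Y), g y = g y' →
      (QuotientAddGroup.mk' (rT V f).range) (tmul A y v) =
      (QuotientAddGroup.mk' (rT V f).range) (tmul A y' v) := by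
    intro v y y' hy
    have h1 : g (y - y') = 0 := by rw [map_sub, hy, sub_self]
    obtain ⟨k, hk⟩ := (h _).1 h1
    rw [← sub_eq_zero, ← map_sub]
    refine (QuotientAddGroup.eq_zero_iff _).2 ⟨tmul A k v, ?_⟩
    rw [BTensor.map_tmul, hk]
    exact map_sub ((mkHom (A := A)).flip v) _ _
  have hs := Function.surjInv_eq hg
  let φ : BTensor A Z V →+ BTensor A Y V ⧸ (rT V f).range := BTensor.lift
    (AddMonoidHom.mk' (fun z => AddMonoidHom.mk'
      (fun v => QuotientAddGroup.mk' (rT V f).range (tmul A (Function.surjInv hg z) v))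
      (fun v v' => by
        rw [← map_add, ← tmul_add]))
      (fun z z' => by
        ext v
        change QuotientAddGroup.mk' (rT V f).range _ = QuotientAddGroup.mk' (rT V f).range _ +
          QuotientAddGroup.mk' (rT V f).range _
        rw [← map_add, ← add_tmul]
        exact hk _ _ _ (by rw [map_add, hs, hs, hs])))
    (fun z a v => by
      change QuotientAddGroup.mk' (rT V f).range _ = QuotientAddGroup.mk' (rT V f).range _
      rw [← smul_tmul]
      exact hk _ _ _ (by rw [map_smul, hs, hs]))
  have hφ : φ.comp (rT V g) = QuotientAddGroup.mk' (rT V f).range := hom_ext fun w y => by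
    exact hk _ _ _ (by rw [hs]; rfl)
  intro t
  constructor
  · intro ht
    have := DFunLike.congr_fun hφ t
    rw [AddMonoidHom.comp_apply, ht, map_zero] at this
    exact (QuotientAddGroup.eq_zero_iff (N := (rT V f).range) t).1 this.symm
  · rintro ⟨s, rfl⟩
    rw [BTensor.map_map]
    have : g ∘ₗ f = 0 := LinearMap.ext fun x => h.apply_apply_eq_zero x
    rw [this]
    induction s using BTensor.induction_on with
    | h0 => simp
    | ht m n => exact zero_tmul _
    | ha x y hx hy => rw [map_add, hx, hy, add_zero]

end Right

end Exact

/-- `W ⊗_A -` takes the kernel `i` of `d` to the kernel of `W ⊗_A d`. -/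
def LExact {A K Y Z : Type*} (W : Type*) [Ring A] [AddCommGroup W] [Module Aᵐᵒᵖ W]
    [AddCommGroup K] [Module A K] [AddCommGroup Y] [Module A Y] [AddCommGroup Z] [Module A Z]
    (i : K →ₗ[A] Y) (d : Y →ₗ[A] Z) : Prop :=
  Function.Injective (lT W i) ∧ Function.Exact (lT W i) (lT W d)

/-- `- ⊗_A V` takes the kernel `i` of `d` to the kernel of `d ⊗_A V`. -/
def RExact {A K Y Z : Type*} (V : Type*) [Ring A] [AddCommGroup V] [Module A V]
    [AddCommGroup K] [Module Aᵐᵒᵖ K] [AddCommGroup Y] [Module Aᵐᵒᵖ Y]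
    [AddCommGroup Z] [Module Aᵐᵒᵖ Z] (i : K →ₗ[Aᵐᵒᵖ] Y) (d : Y →ₗ[Aᵐᵒᵖ] Z) : Prop :=
  Function.Injective (rT V i) ∧ Function.Exact (rT V i) (rT V d)

theorem LExact.of_rightFlat {A K Y Z W : Type u} [Ring A] [AddCommGroup W] [Module Aᵐᵒᵖ W]
    [AddCommGroup K] [Module A K] [AddCommGroup Y] [Module A Y] [AddCommGroup Z] [Module A Z]
    (hW : RightFlat A W) {i : K →ₗ[A] Y} {d : Y →ₗ[A] Z} (hi : Function.Injective i)
    (h : Function.Exact i d) : LExact W i d := by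
  refine ⟨hW _ _ i hi, fun t => ?_⟩
  have h1 : Function.Exact i d.rangeRestrict := fun y => by
    rw [← h y, Subtype.ext_iff]; rfl
  rw [← lT_exact h1 d.surjective_rangeRestrict t]
  have h2 : lT W d t = lT W d.range.subtype (lT W d.rangeRestrict t) := by
    rw [BTensor.map_map]; rfl
  rw [h2]
  exact map_eq_zero_iff _ (hW _ _ _ d.range.injective_subtype)

theorem RExact.of_leftFlat {A K Y Z V : Type u} [Ring A] [AddCommGroup V] [Module A V]
    [AddCommGroup K] [Module Aᵐᵒᵖ K] [AddCommGroup Y] [Module Aᵐᵒᵖ Y]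
    [AddCommGroup Z] [Module Aᵐᵒᵖ Z]
    (hV : LeftFlat A V) {i : K →ₗ[Aᵐᵒᵖ] Y} {d : Y →ₗ[Aᵐᵒᵖ] Z} (hi : Function.Injective i)
    (h : Function.Exact i d) : RExact V i d := by
  refine ⟨hV _ _ i hi, fun t => ?_⟩
  have h1 : Function.Exact i d.rangeRestrict := fun y => by
    rw [← h y, Subtype.ext_iff]; rfl
  rw [← rT_exact h1 d.surjective_rangeRestrict t]
  have h2 : rT V d t = rT V d.range.subtype (rT V d.rangeRestrict t) := by
    rw [BTensor.map_map]; rfl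
  rw [h2]
  exact map_eq_zero_iff _ (hV _ _ _ d.range.injective_subtype)

section AssocNat

variable {A B M N P M' N' P' : Type*} [Ring A] [Ring B]
  [AddCommGroup M] [Module Aᵐᵒᵖ M]
  [AddCommGroup N] [Module A N] [Module Bᵐᵒᵖ N] [SMulCommClass A Bᵐᵒᵖ N]
  [AddCommGroup P] [Module B P]
  [AddCommGroup M'] [Module Aᵐᵒᵖ M']
  [AddCommGroup N'] [Module A N'] [Module Bᵐᵒᵖ N'] [SMulCommClass A Bᵐᵒᵖ N']
  [AddCommGroup P'] [Module B P']

/-- Additive maps out of `(M ⊗ N) ⊗ P` that agree on pure tensors are equal. -/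
theorem hom_ext₂ {T : Type*} [AddCommGroup T] {f g : BTensor B (BTensor A M N) P →+ T}
    (h : ∀ m n p, f (tmul B (tmul A m n) p) = g (tmul B (tmul A m n) p)) : f = g := by
  refine hom_ext fun t p => ?_
  have : (f.comp ((mkHom (A := B)).flip p)) = (g.comp ((mkHom (A := B)).flip p)) :=
    hom_ext fun m n => h m n p
  exact DFunLike.congr_fun this t

/-- Additive maps out of `M ⊗ (N ⊗ P)` that agree on pure tensors are equal. -/
theorem hom_ext₂' {T : Type*} [AddCommGroup T] {f g : BTensor A M (BTensor B N P) →+ T}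
    (h : ∀ m n p, f (tmul A m (tmul B n p)) = g (tmul A m (tmul B n p))) : f = g := by
  refine hom_ext fun m t => ?_
  have : (f.comp (mkHom (A := A) m)) = (g.comp (mkHom (A := A) m)) :=
    hom_ext fun n p => h m n p
  exact DFunLike.congr_fun this t

/-- A right linear map `f` tensored with a module on the right, as a map of right modules. -/
def rTBi (f : M →ₗ[Aᵐᵒᵖ] M') : BTensor A M N →ₗ[Bᵐᵒᵖ] BTensor A M' N where
  toFun := BTensor.map f LinearMap.id
  map_add' := map_add _
  map_smul' a t := by
    induction t using BTensor.induction_on with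
    | h0 => simp
    | ht m n => rfl
    | ha x y hx hy => simp_all only [smul_add, map_add]

/-- A left linear map `g` tensored with a module on the left, as a map of left modules. -/
def lTBi (g : P →ₗ[B] P') : BTensor B N P →ₗ[A] BTensor B N P' where
  toFun := BTensor.map LinearMap.id g
  map_add' := map_add _
  map_smul' a t := by
    induction t using BTensor.induction_on with
    | h0 => simp
    | ht m n => rfl
    | ha x y hx hy => simp_all only [smul_add, map_add]

theorem assoc_rTBi (f : M →ₗ[Aᵐᵒᵖ] M') (t : BTensor B (BTensor A M N) P) :
    assoc A B M' N P (rT P (rTBi f) t) = rT (BTensor B N P) f (assoc A B M N P t) :=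
  DFunLike.congr_fun (f := (assoc A B M' N P).toAddMonoidHom.comp (rT P (rTBi f)))
    (g := (rT (BTensor B N P) f).comp (assoc A B M N P).toAddMonoidHom)
    (hom_ext₂ fun _ _ _ => rfl) t

theorem assoc_lTBi (g : P →ₗ[B] P') (t : BTensor B (BTensor A M N) P) :
    assoc A B M N P' (lT (BTensor A M N) g t) = lT M (lTBi (A := A) (N := N) g)
      (assoc A B M N P t) :=
  DFunLike.congr_fun (f := (assoc A B M N P').toAddMonoidHom.comp (lT (BTensor A M N) g))
    (g := (lT M (lTBi (A := A) (N := N) g)).comp (assoc A B M N P).toAddMonoidHom)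
    (hom_ext₂ fun _ _ _ => rfl) t

end AssocNat

end BTensor

/-- The tensor product of a left flat bimodule and a left flat module is left flat. -/
theorem LeftFlat.bTensor {A B N P : Type u} [Ring A] [Ring B]
    [AddCommGroup N] [Module A N] [Module Bᵐᵒᵖ N] [SMulCommClass A Bᵐᵒᵖ N]
    [AddCommGroup P] [Module B P] (hN : LeftFlat A N) (hP : LeftFlat B P) :
    LeftFlat A (BTensor B N P) := by
  intro M M' _ _ _ _ f hf
  have h1 : Function.Injective (rTBi (B := B) (N := N) f) := hN M M' f hf
  have h2 := hP _ _ _ h1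
  intro s t hst
  obtain ⟨s, rfl⟩ := (assoc A B M N P).surjective s
  obtain ⟨t, rfl⟩ := (assoc A B M N P).surjective t
  congr 1
  apply h2
  apply (assoc A B M' N P).injective
  rw [assoc_rTBi, assoc_rTBi]
  exact hst

/-- Free right modules are right flat. -/
theorem rightFlat_finsupp (A ι : Type u) [Ring A] : RightFlat A (ι →₀ Aᵐᵒᵖ) := by
  classical
  intro N N' _ _ _ _ f hf
  -- `coord N i` sends `g ⊗ n` to `g i • n`; together the coordinates determine a tensor
  let coord (N : Type u) [AddCommGroup N] [Module A N] (i : ι) :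
      BTensor A (ι →₀ Aᵐᵒᵖ) N →+ N := BTensor.lift
    (AddMonoidHom.mk' (fun g => AddMonoidHom.mk' (fun n => (g i).unop • n) (smul_add _))
      (fun g g' => by ext n; simp [add_smul]))
    (fun g a n => by simp [mul_smul])
  have key : ∀ t : BTensor A (ι →₀ Aᵐᵒᵖ) N, ∃ s : Finset ι, ∀ s' : Finset ι, s ⊆ s' →
      t = ∑ i ∈ s', tmul A (Finsupp.single i 1) (coord N i t) := by
    intro t
    induction t using BTensor.induction_on with
    | h0 => exact ⟨∅, fun s' _ => by simp [tmul_zero]⟩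
    | ht g n =>
      refine ⟨g.support, fun s' hs' => ?_⟩
      have h1 : ∀ i, tmul A (Finsupp.single i (1 : Aᵐᵒᵖ)) (coord N i (tmul A g n)) =
          (mkHom (A := A)).flip n (Finsupp.single i (g i)) := fun i => by
        change tmul A _ ((g i).unop • n) = tmul A _ n
        rw [← smul_tmul, Finsupp.smul_single]
        simp
      rw [Finset.sum_congr rfl fun i _ => h1 i, ← map_sum]
      have h2 : ∑ i ∈ s', Finsupp.single i (g i) = g :=
        (Finsupp.sum_of_support_subset g hs' (fun i a => Finsupp.single i a) (by simp)).symm.trans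
          g.sum_single
      rw [h2]; rfl
    | ha x y hx hy =>
      obtain ⟨s, hs⟩ := hx
      obtain ⟨s', hs'⟩ := hy
      refine ⟨s ∪ s', fun u hu => ?_⟩
      have h1 := hs u (Finset.union_subset_left hu)
      have h2 := hs' u (Finset.union_subset_right hu)
      simp only [map_add, tmul_add, Finset.sum_add_distrib]
      rw [← h1, ← h2]
  have hnat : ∀ i t, coord N' i (BTensor.map LinearMap.id f t) = f (coord N i t) := fun i t =>
    DFunLike.congr_fun (f := (coord N' i).comp (BTensor.map LinearMap.id f))
      (g := f.toAddMonoidHom.comp (coord N i))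
      (hom_ext fun g n => (f.map_smul _ _).symm) t
  rw [injective_iff_map_eq_zero]
  intro t ht
  obtain ⟨s, hs⟩ := key t
  rw [hs s subset_rfl]
  refine Finset.sum_eq_zero fun i _ => ?_
  have : coord N i t = 0 := hf (by rw [← hnat, ht, map_zero, map_zero])
  rw [this, tmul_zero]

/-! ### Flatness over von Neumann regular rings -/

section Regular

/-- In a von Neumann regular ring, finitely many elements of a left ideal `I` have a common
right unit in `I`. -/
theorem exists_right_unit {R : Type*} [Ring R] (hR : IsVonNeumannRegular R) (I : Ideal R)
    (s : Finset R) (hs : ∀ a ∈ s, a ∈ I) : ∃ e ∈ I, ∀ a ∈ s, a * e = a := by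
  classical
  induction s using Finset.induction_on with
  | empty => exact ⟨0, I.zero_mem, by simp⟩
  | insert b s _ ih =>
    obtain ⟨e, he, hes⟩ := ih fun a ha => hs a (Finset.mem_insert_of_mem ha)
    have hb := hs b (Finset.mem_insert_self b s)
    obtain ⟨x, hx⟩ := hR (b - b * e)
    set c := b - b * e with hc
    have hcI : c ∈ I := I.sub_mem hb (I.mul_mem_left b he)
    -- `1 - e' = (1 - e) (1 - x c)`
    refine ⟨e + x * c - e * (x * c), I.sub_mem (I.add_mem he (I.mul_mem_left x hcI))
      (I.mul_mem_left _ (I.mul_mem_left x hcI)), fun a ha => ?_⟩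
    rcases Finset.mem_insert.1 ha with rfl | ha
    · have : a * (e + x * c - e * (x * c)) = a * e + (a - a * e) * x * c := by noncomm_ring
      rw [this, ← hc, ← hx, hc]; abel
    · have : a * (e + x * c - e * (x * c)) = a * e + (a - a * e) * x * c := by noncomm_ring
      rw [this, hes a ha]; simp

theorem exists_char_extension {M M' : Type*} [AddCommGroup M] [AddCommGroup M'] (f : M →+ M')
    (χ : M →+ AddCircle (1 : ℚ)) (h : ∀ m, f m = 0 → χ m = 0) :
    ∃ χ' : M' →+ AddCircle (1 : ℚ), ∀ m, χ' (f m) = χ m := by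
  have h1 := CharacterModule.dual_surjective_of_injective (R := ℤ)
    (QuotientAddGroup.kerLift f).toIntLinearMap (QuotientAddGroup.kerLift_injective f)
  obtain ⟨χ', h2⟩ := h1 (QuotientAddGroup.lift f.ker χ h)
  exact ⟨χ', fun m => DFunLike.congr_fun (F := _ →+ AddCircle (1 : ℚ)) h2
    (QuotientAddGroup.mk' f.ker m)⟩

/-- The character module of an `S`-module `N` is a left module over `R ≃ Sᵐᵒᵖ`. If `R` is von
Neumann regular, it is injective. This is the extension property, in terms of balanced maps
`M → N → ℚ / ℤ`; the isomorphism `σ` allows left and right modules `N` to be treated at once. -/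
theorem exists_balanced_extension {R S N M M' : Type*} [Ring R] [Ring S] (σ : R ≃+* Sᵐᵒᵖ)
    (hR : IsVonNeumannRegular R) [AddCommGroup N] [Module S N] [AddCommGroup M] [Module R M]
    [AddCommGroup M'] [Module R M'] (f : M →ₗ[R] M') (hf : Function.Injective f)
    (φ : M →+ N →+ AddCircle (1 : ℚ)) (hφ : ∀ r m n, φ (r • m) n = φ m ((σ r).unop • n)) :
    ∃ φ' : M' →+ N →+ AddCircle (1 : ℚ), (∀ r m n, φ' (r • m) n = φ' m ((σ r).unop • n)) ∧
      ∀ m, φ' (f m) = φ m := by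
  classical
  let _ : Module R (N →+ AddCircle (1 : ℚ)) :=
    { smul := fun r χ => χ.comp (DistribSMul.toAddMonoidHom N (σ r).unop)
      one_smul := fun χ => by
        ext n; change χ ((σ 1).unop • n) = χ n; simp
      mul_smul := fun r s χ => by
        ext n
        change χ ((σ (r * s)).unop • n) = χ ((σ s).unop • (σ r).unop • n)
        simp [mul_smul]
      smul_zero := fun r => rfl
      smul_add := fun r χ χ' => rfl
      add_smul := fun r s χ => by
        ext n
        change χ ((σ (r + s)).unop • n) = χ ((σ r).unop • n) + χ ((σ s).unop • n)
        simp [add_smul]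
      zero_smul := fun χ => by
        ext n; change χ ((σ 0).unop • n) = 0; simp }
  have hsm : ∀ (r : R) (χ : N →+ AddCircle (1 : ℚ)) n, (r • χ) n = χ ((σ r).unop • n) :=
    fun _ _ _ => rfl
  have baer : Module.Baer R (N →+ AddCircle (1 : ℚ)) := by
    -- A linear map `g : I → Hom(N, ℚ / ℤ)` is a character `G` of `I ⊗ N`. By means of common right
    -- units, `G` vanishes on the kernel of `θ : a ⊗ n ↦ a n`, so it extends along `θ` to `N`.
    intro I g
    let θ : TensorProduct ℤ I N →+ N := TensorProduct.liftAddHom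
      (AddMonoidHom.mk' (fun a : I => DistribSMul.toAddMonoidHom N (σ (a : R)).unop)
        (fun a b => by ext n; simp [add_smul]))
      (fun r a n => by
        rw [map_zsmul]
        exact (map_zsmul (DistribSMul.toAddMonoidHom N (σ (a : R)).unop) r n).symm)
    let G : TensorProduct ℤ I N →+ AddCircle (1 : ℚ) :=
      TensorProduct.liftAddHom g.toAddMonoidHom (fun r a n => by simp)
    have key : ∀ t, ∃ s : Finset R, (∀ a ∈ s, a ∈ I) ∧
        ∀ e (he : e ∈ I), (∀ a ∈ s, a * e = a) → G t = g ⟨e, he⟩ (θ t) := by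
      intro t
      induction t using TensorProduct.induction_on with
      | zero => exact ⟨∅, by simp, fun e he _ => by simp⟩
      | tmul a n =>
        refine ⟨{(a : R)}, by simp, fun e he h => ?_⟩
        have h1 : a = (a : R) • (⟨e, he⟩ : I) := Subtype.ext (h a (by simp)).symm
        change g a n = g ⟨e, he⟩ ((σ (a : R)).unop • n)
        rw [← hsm, ← map_smul, ← h1]
      | add x y hx hy =>
        obtain ⟨s, hs, h1⟩ := hx
        obtain ⟨s', hs', h2⟩ := hy
        refine ⟨s ∪ s', fun a ha => ?_, fun e he h => ?_⟩
        · exact (Finset.mem_union.1 ha).elim (hs a) (hs' a)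
        · rw [map_add, map_add, map_add, h1 e he fun a ha => h a (Finset.mem_union_left _ ha),
            h2 e he fun a ha => h a (Finset.mem_union_right _ ha)]
    obtain ⟨χ, hχ⟩ := exists_char_extension θ G fun t ht => by
      obtain ⟨s, hs, h⟩ := key t
      obtain ⟨e, he, h'⟩ := exists_right_unit hR I s hs
      rw [h e he h', ht, map_zero]
    refine ⟨LinearMap.toSpanSingleton R _ χ, fun a ha => ?_⟩
    ext n
    exact hχ ((⟨a, ha⟩ : I) ⊗ₜ n)
  obtain ⟨φ', h⟩ := baer.extension_property f hf
    { toFun := φ, map_add' := φ.map_add, map_smul' := fun r m => by ext n; exact hφ r m n }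
  exact ⟨φ'.toAddMonoidHom, fun r m n => DFunLike.congr_fun (φ'.map_smul r m) n,
    fun m => LinearMap.congr_fun h m⟩

theorem IsVonNeumannRegular.op {A : Type*} [Ring A] (hA : IsVonNeumannRegular A) :
    IsVonNeumannRegular Aᵐᵒᵖ := fun a => by
  obtain ⟨x, hx⟩ := hA a.unop
  exact ⟨MulOpposite.op x, unop_injective (by simpa [mul_assoc] using hx)⟩

theorem IsVonNeumannRegular.leftFlat {A : Type u} [Ring A] (hA : IsVonNeumannRegular A)
    (N : Type u) [AddCommGroup N] [Module A N] : LeftFlat A N := by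
  intro M M' _ _ _ _ f hf
  rw [injective_iff_map_eq_zero]
  intro t ht
  refine CharacterModule.eq_zero_of_character_apply fun χ => ?_
  obtain ⟨φ', hb, hφ'⟩ := exists_balanced_extension (RingEquiv.refl Aᵐᵒᵖ) hA.op f hf
    (mkHom.compr₂ (χ : BTensor A M N →+ AddCircle (1 : ℚ)))
    (fun r m n => congrArg χ (smul_tmul m r.unop n))
  have h : (BTensor.lift φ' fun m a n => hb (MulOpposite.op a) m n).comp
      (BTensor.map f LinearMap.id) = χ := hom_ext fun m n => DFunLike.congr_fun (hφ' m) n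
  rw [← h]
  exact (congrArg _ ht).trans (map_zero _)

theorem IsVonNeumannRegular.rightFlat {A : Type u} [Ring A] (hA : IsVonNeumannRegular A)
    (M : Type u) [AddCommGroup M] [Module Aᵐᵒᵖ M] : RightFlat A M := by
  intro N N' _ _ _ _ f hf
  rw [injective_iff_map_eq_zero]
  intro t ht
  refine CharacterModule.eq_zero_of_character_apply fun χ => ?_
  obtain ⟨φ', hb, hφ'⟩ := exists_balanced_extension (RingEquiv.opOp A) hA f hf
    (mkHom.compr₂ (χ : BTensor A M N →+ AddCircle (1 : ℚ))).flip
    (fun r n m => congrArg χ (smul_tmul m r n).symm)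
  have h : (BTensor.lift φ'.flip fun m a n => (hb a n m).symm).comp
      (BTensor.map LinearMap.id f) = χ := hom_ext fun m n => DFunLike.congr_fun (hφ' n) m
  rw [← h]
  exact (congrArg _ ht).trans (map_zero _)

end Regular

/-! ### Naturality of the associativity and unit isomorphisms -/

namespace BTensor

section Nat

variable {R A B S M N P M' N' P' M'' N'' : Type*} [Ring R] [Ring A] [Ring B] [Ring S]
  [AddCommGroup M] [Module R M] [Module Aᵐᵒᵖ M] [SMulCommClass R Aᵐᵒᵖ M]
  [AddCommGroup N] [Module A N] [Module Bᵐᵒᵖ N] [SMulCommClass A Bᵐᵒᵖ N]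
  [AddCommGroup P] [Module B P] [Module Sᵐᵒᵖ P] [SMulCommClass B Sᵐᵒᵖ P]
  [AddCommGroup M'] [Module R M'] [Module Aᵐᵒᵖ M'] [SMulCommClass R Aᵐᵒᵖ M']
  [AddCommGroup N'] [Module A N'] [Module Bᵐᵒᵖ N'] [SMulCommClass A Bᵐᵒᵖ N']
  [AddCommGroup P'] [Module B P'] [Module Sᵐᵒᵖ P'] [SMulCommClass B Sᵐᵒᵖ P']
  [AddCommGroup M''] [Module R M''] [Module Aᵐᵒᵖ M''] [SMulCommClass R Aᵐᵒᵖ M'']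
  [AddCommGroup N''] [Module A N''] [Module Bᵐᵒᵖ N''] [SMulCommClass A Bᵐᵒᵖ N'']

theorem mapBi_mapBi (f' : BimodHom R A M' M'') (g' : BimodHom A B N' N'')
    (f : BimodHom R A M M') (g : BimodHom A B N N') (t : BTensor A M N) :
    mapBi f' g' (mapBi f g t) = mapBi (f'.comp f) (g'.comp g) t :=
  map_map _ _ _ _ t

theorem mapBi_id (t : BTensor A M N) :
    mapBi (BimodHom.id R A M) (BimodHom.id A B N) t = t :=
  DFunLike.congr_fun (f := (mapBi (BimodHom.id R A M) (BimodHom.id A B N)).add)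
    (g := AddMonoidHom.id (BTensor A M N)) (hom_ext fun _ _ => rfl) t

theorem assoc_mapBi (f : BimodHom R A M M') (g : BimodHom A B N N') (h : BimodHom B S P P')
    (t : BTensor B (BTensor A M N) P) :
    assoc A B M' N' P' (mapBi (mapBi f g) h t) = mapBi f (mapBi g h) (assoc A B M N P t) :=
  DFunLike.congr_fun
    (f := (assoc A B M' N' P').toAddMonoidHom.comp (mapBi (mapBi f g) h).add)
    (g := (mapBi f (mapBi g h)).add.comp (assoc A B M N P).toAddMonoidHom)
    (hom_ext₂ fun _ _ _ => rfl) t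

theorem assoc_symm_mapBi (f : BimodHom R A M M') (g : BimodHom A B N N') (h : BimodHom B S P P')
    (t : BTensor A M (BTensor B N P)) :
    (assoc A B M' N' P').symm (mapBi f (mapBi g h) t) =
      mapBi (mapBi f g) h ((assoc A B M N P).symm t) := by
  rw [AddEquiv.symm_apply_eq, assoc_mapBi, AddEquiv.apply_symm_apply]

variable (A B N) in
/-- `A ⊗_A N → N` as a bimodule map. -/
def lidBi : BimodHom A B (BTensor A A N) N :=
  BimodHom.mk' (lid A N)
    (fun a t => by
      induction t using BTensor.induction_on with
      | h0 => simp
      | ht b n => simp [lsmul_tmul, mul_smul]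
      | ha x y hx hy => simp only [smul_add, map_add, hx, hy])
    (fun b t => by
      induction t using BTensor.induction_on with
      | h0 => simp
      | ht a n => simp [rsmul_tmul, smul_comm]
      | ha x y hx hy => simp only [smul_add, map_add, hx, hy])

end Nat

section Split

variable {A K Y Z W V : Type*} [Ring A]

theorem lT_id [AddCommGroup W] [Module Aᵐᵒᵖ W] [AddCommGroup K] [Module A K]
    (t : BTensor A W K) : lT W (LinearMap.id : K →ₗ[A] K) t = t :=
  DFunLike.congr_fun (f := lT W (LinearMap.id : K →ₗ[A] K)) (g := AddMonoidHom.id _)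
    (hom_ext fun _ _ => rfl) t

theorem rT_id [AddCommGroup V] [Module A V] [AddCommGroup K] [Module Aᵐᵒᵖ K]
    (t : BTensor A K V) : rT V (LinearMap.id : K →ₗ[Aᵐᵒᵖ] K) t = t :=
  DFunLike.congr_fun (f := rT V (LinearMap.id : K →ₗ[Aᵐᵒᵖ] K)) (g := AddMonoidHom.id _)
    (hom_ext fun _ _ => rfl) t

theorem lT_lT [AddCommGroup W] [Module Aᵐᵒᵖ W]
    [AddCommGroup K] [Module A K] [AddCommGroup Y] [Module A Y] [AddCommGroup Z] [Module A Z]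
    (g : Y →ₗ[A] Z) (f : K →ₗ[A] Y) (t : BTensor A W K) :
    lT W g (lT W f t) = lT W (g ∘ₗ f) t :=
  DFunLike.congr_fun (f := (lT W g).comp (lT W f)) (g := lT W (g ∘ₗ f))
    (hom_ext fun _ _ => rfl) t

theorem rT_rT [AddCommGroup V] [Module A V]
    [AddCommGroup K] [Module Aᵐᵒᵖ K] [AddCommGroup Y] [Module Aᵐᵒᵖ Y]
    [AddCommGroup Z] [Module Aᵐᵒᵖ Z]
    (g : Y →ₗ[Aᵐᵒᵖ] Z) (f : K →ₗ[Aᵐᵒᵖ] Y) (t : BTensor A K V) :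
    rT V g (rT V f t) = rT V (g ∘ₗ f) t :=
  DFunLike.congr_fun (f := (rT V g).comp (rT V f)) (g := rT V (g ∘ₗ f))
    (hom_ext fun _ _ => rfl) t

theorem LExact.of_split [AddCommGroup W] [Module Aᵐᵒᵖ W]
    [AddCommGroup K] [Module A K] [AddCommGroup Y] [Module A Y] [AddCommGroup Z] [Module A Z]
    {i : K →ₗ[A] Y} {d : Y →ₗ[A] Z} {p : Y →ₗ[A] K} {h : Z →ₗ[A] Y}
    (hpi : ∀ x, p (i x) = x) (hip : ∀ y, i (p y) = y + h (d y)) (hdi : ∀ x, d (i x) = 0) :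
    LExact W i d := by
  have h1 : p ∘ₗ i = LinearMap.id := LinearMap.ext hpi
  have h2 : i ∘ₗ p - h ∘ₗ d = LinearMap.id := LinearMap.ext fun y => by simp [hip]
  refine ⟨Function.LeftInverse.injective (g := lT W p) fun t => ?_, fun t => ⟨fun ht =>
    ⟨lT W p t, ?_⟩, ?_⟩⟩
  · rw [lT_lT, h1]; exact lT_id t
  · have h3 := lT_id t
    rw [← h2, lT_sub] at h3
    have h4 : lT W (h ∘ₗ d) t = lT W h (lT W d t) := (lT_lT h d t).symm
    rw [h4, ht, map_zero, sub_zero] at h3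
    rw [lT_lT]; exact h3
  · rintro ⟨s, rfl⟩
    rw [lT_lT]
    exact DFunLike.congr_fun (g := 0) (hom_ext fun w x => by
      change tmul A w (d (i x)) = 0
      rw [hdi, tmul_zero]) s

theorem RExact.of_split [AddCommGroup V] [Module A V]
    [AddCommGroup K] [Module Aᵐᵒᵖ K] [AddCommGroup Y] [Module Aᵐᵒᵖ Y]
    [AddCommGroup Z] [Module Aᵐᵒᵖ Z]
    {i : K →ₗ[Aᵐᵒᵖ] Y} {d : Y →ₗ[Aᵐᵒᵖ] Z} {p : Y →ₗ[Aᵐᵒᵖ] K} {h : Z →ₗ[Aᵐᵒᵖ] Y}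
    (hpi : ∀ x, p (i x) = x) (hip : ∀ y, i (p y) = y + h (d y)) (hdi : ∀ x, d (i x) = 0) :
    RExact V i d := by
  have h1 : p ∘ₗ i = LinearMap.id := LinearMap.ext hpi
  have h2 : i ∘ₗ p - h ∘ₗ d = LinearMap.id := LinearMap.ext fun y => by simp [hip]
  refine ⟨Function.LeftInverse.injective (g := rT V p) fun t => ?_, fun t => ⟨fun ht =>
    ⟨rT V p t, ?_⟩, ?_⟩⟩
  · rw [rT_rT, h1]; exact rT_id t
  · have h3 := rT_id t
    rw [← h2, rT_sub] at h3
    have h4 : rT V (h ∘ₗ d) t = rT V h (rT V d t) := (rT_rT h d t).symm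
    rw [h4, ht, map_zero, sub_zero] at h3
    rw [rT_rT]; exact h3
  · rintro ⟨s, rfl⟩
    rw [rT_rT]
    exact DFunLike.congr_fun (g := 0) (hom_ext fun x w => by
      change tmul A (d (i x)) w = 0
      rw [hdi, zero_tmul]) s

end Split

end BTensor

/-! ### The cotensor product as a kernel -/

section Diff

variable {A₁ A₂ A₃ C M N : Type*} [Ring A₁] [Ring A₂] [Ring A₃]
  [AddCommGroup C] [Module A₂ C] [Module A₂ᵐᵒᵖ C] [SMulCommClass A₂ A₂ᵐᵒᵖ C]
  [AddCommGroup M] [Module A₁ M] [Module A₂ᵐᵒᵖ M] [SMulCommClass A₁ A₂ᵐᵒᵖ M]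
  [AddCommGroup N] [Module A₂ N] [Module A₃ᵐᵒᵖ N] [SMulCommClass A₂ A₃ᵐᵒᵖ N]

/-- `ρ ⊗_A N - M ⊗_A l : M ⊗_A N → M ⊗_A C ⊗_A N` as a bimodule map. -/
def cotensorDiff (ρ : BimodHom A₁ A₂ M (BTensor A₂ M C)) (l : BimodHom A₂ A₃ N (BTensor A₂ C N)) :
    BimodHom A₁ A₃ (BTensor A₂ M N) (BTensor A₂ M (BTensor A₂ C N)) :=
  ((assocBi A₂ A₂ A₁ A₃ M C N).comp (mapBi ρ (BimodHom.id A₂ A₃ N))).sub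
    (mapBi (BimodHom.id A₁ A₂ M) l)

theorem cotensorDiff_eq_zero {ρ : BimodHom A₁ A₂ M (BTensor A₂ M C)}
    {l : BimodHom A₂ A₃ N (BTensor A₂ C N)} {t : BTensor A₂ M N} :
    cotensorDiff ρ l t = 0 ↔ assoc A₂ A₂ M C N (mapBi ρ (BimodHom.id A₂ A₃ N) t) =
      mapBi (BimodHom.id A₁ A₂ M) l t := sub_eq_zero

theorem mem_cotensorSubgroup_iff {ρ : BimodHom A₁ A₂ M (BTensor A₂ M C)}
    {l : BimodHom A₂ A₃ N (BTensor A₂ C N)} {t : BTensor A₂ M N} :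
    t ∈ cotensorSubgroup ρ.right l.left ↔ cotensorDiff ρ l t = 0 := Iff.rfl

end Diff

section Pair

variable {k : Type v} [CommRing k] {A₁ A₂ A₃ C₁ C₂ C₃ M N : Type u}
  [Ring A₁] [Algebra k A₁] [Ring A₂] [Algebra k A₂] [Ring A₃] [Algebra k A₃]
  [AddCommGroup C₁] [Module A₁ C₁] [Module A₁ᵐᵒᵖ C₁] [SMulCommClass A₁ A₁ᵐᵒᵖ C₁]
  [AddCommGroup C₂] [Module A₂ C₂] [Module A₂ᵐᵒᵖ C₂] [SMulCommClass A₂ A₂ᵐᵒᵖ C₂]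
  [AddCommGroup C₃] [Module A₃ C₃] [Module A₃ᵐᵒᵖ C₃] [SMulCommClass A₃ A₃ᵐᵒᵖ C₃]
  {𝓒₁ : Coring k A₁ C₁} {𝓒₂ : Coring k A₂ C₂} {𝓒₃ : Coring k A₃ C₃}
  [AddCommGroup M] [Module A₁ M] [Module A₂ᵐᵒᵖ M] [SMulCommClass A₁ A₂ᵐᵒᵖ M]
  [AddCommGroup N] [Module A₂ N] [Module A₃ᵐᵒᵖ N] [SMulCommClass A₂ A₃ᵐᵒᵖ N]

namespace Cotensor

theorem incl_injective (P : Bicomod 𝓒₁ 𝓒₂ M) (Q : Bicomod 𝓒₂ 𝓒₃ N) :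
    Function.Injective (incl P Q) := Subtype.val_injective

theorem exact_incl (P : Bicomod 𝓒₁ 𝓒₂ M) (Q : Bicomod 𝓒₂ 𝓒₃ N) :
    Function.Exact (incl P Q) (cotensorDiff P.rcoact Q.lcoact) := fun t =>
  ⟨fun h => ⟨⟨t, mem_cotensorSubgroup_iff.2 h⟩, rfl⟩,
    fun ⟨s, hs⟩ => hs ▸ mem_cotensorSubgroup_iff.1 s.2⟩

theorem mem_range_incl {P : Bicomod 𝓒₁ 𝓒₂ M} {Q : Bicomod 𝓒₂ 𝓒₃ N} {t : BTensor A₂ M N}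
    (h : assoc A₂ A₂ M C₂ N (mapBi P.rcoact (BimodHom.id A₂ A₃ N) t) =
      mapBi (BimodHom.id A₁ A₂ M) Q.lcoact t) : ∃ s, incl P Q s = t :=
  ((exact_incl P Q) t).1 (cotensorDiff_eq_zero.2 h)

theorem incl_balanced (P : Bicomod 𝓒₁ 𝓒₂ M) (Q : Bicomod 𝓒₂ 𝓒₃ N) (s : Cotensor P Q) :
    assoc A₂ A₂ M C₂ N (mapBi P.rcoact (BimodHom.id A₂ A₃ N) (incl P Q s)) =
      mapBi (BimodHom.id A₁ A₂ M) Q.lcoact (incl P Q s) :=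
  cotensorDiff_eq_zero.1 (((exact_incl P Q) _).2 ⟨s, rfl⟩)

/-- `W ⊗ -` preserves the kernel that defines the cotensor product. -/
abbrev LPres (W : Type u) [AddCommGroup W] [Module A₁ᵐᵒᵖ W] (P : Bicomod 𝓒₁ 𝓒₂ M)
    (Q : Bicomod 𝓒₂ 𝓒₃ N) : Prop :=
  LExact W (incl P Q).left (cotensorDiff P.rcoact Q.lcoact).left

/-- `- ⊗ V` preserves the kernel that defines the cotensor product. -/
abbrev RPres (V : Type u) [AddCommGroup V] [Module A₃ V] (P : Bicomod 𝓒₁ 𝓒₂ M)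
    (Q : Bicomod 𝓒₂ 𝓒₃ N) : Prop :=
  RExact V (incl P Q).right (cotensorDiff P.rcoact Q.lcoact).right

theorem lPres_of_rightFlat {W : Type u} [AddCommGroup W] [Module A₁ᵐᵒᵖ W]
    (hW : RightFlat A₁ W) (P : Bicomod 𝓒₁ 𝓒₂ M) (Q : Bicomod 𝓒₂ 𝓒₃ N) : LPres W P Q :=
  .of_rightFlat hW (incl_injective P Q) (exact_incl P Q)

theorem rPres_of_leftFlat {V : Type u} [AddCommGroup V] [Module A₃ V]
    (hV : LeftFlat A₃ V) (P : Bicomod 𝓒₁ 𝓒₂ M) (Q : Bicomod 𝓒₂ 𝓒₃ N) : RPres V P Q :=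
  .of_leftFlat hV (incl_injective P Q) (exact_incl P Q)

end Cotensor

/-! ### Coseparable corings -/

/-- If the left coaction of `N` has a colinear retraction that is a bimodule map, then the kernel
`M □ N` splits in a way that all tensor functors preserve. -/
theorem Cotensor.split_of_retraction (P : Bicomod 𝓒₁ 𝓒₂ M) (Q : Bicomod 𝓒₂ 𝓒₃ N)
    (ζ : BimodHom A₂ A₃ (BTensor A₂ C₂ N) N) (hζ : ∀ n, ζ (Q.lcoact n) = n)
    (hc : ∀ s, Q.lcoact (ζ s) =
      mapBi (BimodHom.id A₂ A₂ C₂) ζ (tensorLeftCoact (B' := A₃) N 𝓒₂.comul s)) :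
    ∃ (p : BimodHom A₁ A₃ (BTensor A₂ M N) (Cotensor P Q))
      (h : BimodHom A₁ A₃ (BTensor A₂ M (BTensor A₂ C₂ N)) (BTensor A₂ M N)),
      (∀ x, p (incl P Q x) = x) ∧
      ∀ y, incl P Q (p y) = y + h (cotensorDiff P.rcoact Q.lcoact y) := by
  -- the two maps `f g : M ⊗ N → M ⊗ (C ⊗ N)` satisfy `h g = 1` and `f h f = g h f`
  let f := (assocBi A₂ A₂ A₁ A₃ M C₂ N).comp (mapBi P.rcoact (BimodHom.id A₂ A₃ N))
  let g := mapBi (BimodHom.id A₁ A₂ M) Q.lcoact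
  let h := mapBi (BimodHom.id A₁ A₂ M) ζ
  have hg : ∀ t, h (g t) = t := fun t => by
    refine (mapBi_mapBi _ _ _ _ t).trans ?_
    rw [show ζ.comp Q.lcoact = BimodHom.id _ _ _ from BimodHom.ext hζ]
    exact mapBi_id t
  have h1 : ∀ s, f (h s) = mapBi (BimodHom.id A₁ A₂ M) (mapBi (BimodHom.id A₂ A₂ C₂) ζ)
      (assoc A₂ A₂ M C₂ (BTensor A₂ C₂ N) (mapBi P.rcoact (BimodHom.id A₂ A₃ _) s)) := fun s => by
    rw [← assoc_mapBi]
    change assoc _ _ _ _ _ (mapBi _ _ (mapBi _ _ s)) = _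
    rw [mapBi_mapBi, mapBi_mapBi]
    congr 2
    exact congrArg₂ mapBi (BimodHom.ext fun m => (mapBi_id _).symm) rfl
  have h2 : ∀ t, assoc A₂ A₂ M C₂ (BTensor A₂ C₂ N)
      (mapBi P.rcoact (BimodHom.id A₂ A₃ _) (f t)) =
      mapBi (BimodHom.id A₁ A₂ M) (tensorLeftCoact (B' := A₃) N 𝓒₂.comul) (f t) := by
    intro t
    have e1 : ∀ (y : BTensor A₂ M C₂) (n : N), assoc A₂ A₂ M C₂ (BTensor A₂ C₂ N)
        (mapBi P.rcoact (BimodHom.id A₂ A₃ _) (assoc A₂ A₂ M C₂ N (tmul A₂ y n))) =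
        mapBi (BimodHom.id A₁ A₂ M) (assocBi A₂ A₂ A₂ A₃ C₂ C₂ N)
          (assoc A₂ A₂ M (BTensor A₂ C₂ C₂) N (tmul A₂ (assoc A₂ A₂ M C₂ C₂
            (mapBi P.rcoact (BimodHom.id A₂ A₂ C₂) y)) n)) := by
      intro y n
      induction y using BTensor.induction_on with
      | h0 => simp only [zero_tmul, map_zero]
      | ha x y hx hy => simp only [add_tmul, map_add, hx, hy]
      | ht m c =>
        change assoc A₂ A₂ M C₂ (BTensor A₂ C₂ N) (tmul A₂ (P.rcoact m) (tmul A₂ c n)) =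
          mapBi _ _ (assoc A₂ A₂ M (BTensor A₂ C₂ C₂) N (tmul A₂ (assoc A₂ A₂ M C₂ C₂
            (tmul A₂ (P.rcoact m) c)) n))
        generalize P.rcoact m = z
        induction z using BTensor.induction_on with
        | h0 => simp only [zero_tmul, map_zero]
        | ha x y hx hy => simp only [add_tmul, map_add, hx, hy]
        | ht m' c' => rfl
    have e2 : ∀ (y : BTensor A₂ M C₂) (n : N), mapBi (BimodHom.id A₁ A₂ M)
        (tensorLeftCoact (B' := A₃) N 𝓒₂.comul) (assoc A₂ A₂ M C₂ N (tmul A₂ y n)) =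
        mapBi (BimodHom.id A₁ A₂ M) (assocBi A₂ A₂ A₂ A₃ C₂ C₂ N)
          (assoc A₂ A₂ M (BTensor A₂ C₂ C₂) N (tmul A₂
            (mapBi (BimodHom.id A₁ A₂ M) 𝓒₂.comul y) n)) := by
      intro y n
      induction y using BTensor.induction_on with
      | h0 => simp only [zero_tmul, map_zero]
      | ha x y hx hy => simp only [add_tmul, map_add, hx, hy]
      | ht m c => rfl
    induction t using BTensor.induction_on with
    | h0 => simp only [map_zero]
    | ha x y hx hy => simp only [map_add, hx, hy]
    | ht m n =>
      refine (e1 (P.rcoact m) n).trans (Eq.trans ?_ (e2 (P.rcoact m) n).symm)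
      rw [P.rcoassoc]
  have h3 : ∀ t, f (h (f t)) = g (h (f t)) := fun t => by
    rw [h1, h2]
    change mapBi _ _ (mapBi _ _ (f t)) = mapBi _ _ (mapBi _ _ (f t))
    rw [mapBi_mapBi, mapBi_mapBi]
    exact DFunLike.congr_fun (congrArg₂ mapBi rfl (BimodHom.ext fun s => (hc s).symm)) _
  obtain ⟨p, hp⟩ := BimodHom.exists_lift (incl_injective P Q) (h.comp f)
    fun t => mem_range_incl (h3 t)
  refine ⟨p, h, fun x => incl_injective P Q ?_, fun y => ?_⟩
  · rw [hp]
    change h (f (incl P Q x)) = _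
    have : f (incl P Q x) = g (incl P Q x) := incl_balanced P Q x
    rw [this, hg]
  · rw [hp]
    have : cotensorDiff P.rcoact Q.lcoact y = f y - g y := rfl
    rw [this, map_sub, hg]
    change h (f y) = _
    abel

/-- Left comodules over a coseparable coring are relatively injective: the coaction has a colinear
retraction `c ⊗ n ↦ ε(π(c ⊗ n₋₁)) n₀`. -/
theorem Coring.IsCoseparable.exists_retraction (h : 𝓒₂.IsCoseparable) (Q : Bicomod 𝓒₂ 𝓒₃ N) :
    ∃ ζ : BimodHom A₂ A₃ (BTensor A₂ C₂ N) N, (∀ n, ζ (Q.lcoact n) = n) ∧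
      ∀ s, Q.lcoact (ζ s) =
        mapBi (BimodHom.id A₂ A₂ C₂) ζ (tensorLeftCoact (B' := A₃) N 𝓒₂.comul s) := by
  obtain ⟨π, ⟨hl, hr⟩, hπ⟩ := h
  let δ := 𝓒₂.counit.comp π
  have L1 : ∀ z, rid A₂ C₂ (mapBi (BimodHom.id A₂ A₂ C₂) δ
      (tensorLeftCoact (B' := A₂) C₂ 𝓒₂.comul z)) = π z := fun z => by
    have h1 : mapBi (BimodHom.id A₂ A₂ C₂) π (tensorLeftCoact (B' := A₂) C₂ 𝓒₂.comul z) =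
      𝓒₂.comul (π z) := hl z
    have h2 := 𝓒₂.counit_right (π z)
    rw [← h1, mapBi_mapBi] at h2
    exact h2
  have L2 : ∀ z, lid A₂ C₂ (mapBi δ (BimodHom.id A₂ A₂ C₂)
      (tensorRightCoact (A := A₂) C₂ 𝓒₂.comul z)) = π z := fun z => by
    have h1 : mapBi π (BimodHom.id A₂ A₂ C₂) (tensorRightCoact (A := A₂) C₂ 𝓒₂.comul z) =
      𝓒₂.comul (π z) := hr z
    have h2 := 𝓒₂.counit_left (π z)
    rw [← h1, mapBi_mapBi] at h2
    exact h2
  let G := (lidBi A₂ A₃ N).comp ((mapBi δ (BimodHom.id A₂ A₃ N)).comp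
    (assocBiSymm A₂ A₂ A₂ A₃ C₂ C₂ N))
  let G' := (lidBi A₂ A₃ (BTensor A₂ C₂ N)).comp
    ((mapBi δ (BimodHom.id A₂ A₃ (BTensor A₂ C₂ N))).comp
      (assocBiSymm A₂ A₂ A₂ A₃ C₂ C₂ (BTensor A₂ C₂ N)))
  let lN := mapBi (BimodHom.id A₂ A₂ C₂) Q.lcoact
  let η : BTensor A₂ C₂ (BTensor A₂ C₂ N) → BTensor A₂ C₂ N := fun t =>
    mapBi π (BimodHom.id A₂ A₃ N) ((assoc A₂ A₂ C₂ C₂ N).symm t)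
  have a1 : ∀ t, Q.lcoact (G t) = G' (mapBi (BimodHom.id A₂ A₂ C₂) lN t) := fun t =>
    DFunLike.congr_fun (f := Q.lcoact.add.comp G.add)
      (g := G'.add.comp (mapBi (BimodHom.id A₂ A₂ C₂) lN).add)
      (hom_ext₂' fun c d n => Q.lcoact.map_lsmul (δ (tmul A₂ c d)) n) t
  have a2 : ∀ s, mapBi (BimodHom.id A₂ A₂ C₂) lN (lN s) =
      mapBi (BimodHom.id A₂ A₂ C₂) (tensorLeftCoact (B' := A₃) N 𝓒₂.comul) (lN s) := fun s => by
    change mapBi _ _ (mapBi _ _ s) = mapBi _ _ (mapBi _ _ s)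
    rw [mapBi_mapBi, mapBi_mapBi]
    exact DFunLike.congr_fun (congrArg₂ mapBi rfl (BimodHom.ext fun n => (Q.lcoassoc n).symm)) _
  have a3 : ∀ t, G' (mapBi (BimodHom.id A₂ A₂ C₂)
      (tensorLeftCoact (B' := A₃) N 𝓒₂.comul) t) = η t := by
    have e : ∀ (c : C₂) (y : BTensor A₂ C₂ C₂) (n : N),
        G' (tmul A₂ c (assoc A₂ A₂ C₂ C₂ N (tmul A₂ y n))) =
        tmul A₂ (lid A₂ C₂ (mapBi δ (BimodHom.id A₂ A₂ C₂)
          ((assoc A₂ A₂ C₂ C₂ C₂).symm (tmul A₂ c y)))) n := by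
      intro c y n
      induction y using BTensor.induction_on with
      | h0 => simp only [zero_tmul, tmul_zero, map_zero]
      | ha x y hx hy => simp only [add_tmul, tmul_add, map_add, hx, hy]
      | ht a b => rfl
    exact fun t => DFunLike.congr_fun
      (f := G'.add.comp
        (mapBi (BimodHom.id A₂ A₂ C₂) (tensorLeftCoact (B' := A₃) N 𝓒₂.comul)).add)
      (g := (mapBi π (BimodHom.id A₂ A₃ N)).add.comp
        (assoc A₂ A₂ C₂ C₂ N).symm.toAddMonoidHom)
      (hom_ext₂' fun c d n => (e c (𝓒₂.comul d) n).trans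
        (congrArg (fun x => tmul A₂ x n) (L2 (tmul A₂ c d)))) t
  have b1 : ∀ (y : BTensor A₂ C₂ C₂) (n : N),
      mapBi (BimodHom.id A₂ A₂ C₂) lN (assoc A₂ A₂ C₂ C₂ N (tmul A₂ y n)) =
      assoc A₂ A₂ C₂ C₂ _ (tmul A₂ y (Q.lcoact n)) := fun y n => by
    rw [← assoc_mapBi]
    congr 1
    change tmul A₂ (mapBi _ _ y) _ = _
    rw [mapBi_id]; rfl
  have b2 : ∀ (c : C₂) (z : BTensor A₂ C₂ N), mapBi (BimodHom.id A₂ A₂ C₂) G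
      (assoc A₂ A₂ C₂ C₂ _ (tmul A₂ (𝓒₂.comul c) z)) = η (tmul A₂ c z) := by
    have e : ∀ (y : BTensor A₂ C₂ C₂) (d : C₂) (n : N), mapBi (BimodHom.id A₂ A₂ C₂) G
        (assoc A₂ A₂ C₂ C₂ _ (tmul A₂ y (tmul A₂ d n))) =
        tmul A₂ (rid A₂ C₂ (mapBi (BimodHom.id A₂ A₂ C₂) δ
          (assoc A₂ A₂ C₂ C₂ C₂ (tmul A₂ y d)))) n := by
      intro y d n
      induction y using BTensor.induction_on with
      | h0 => simp only [zero_tmul, map_zero]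
      | ha x y hx hy => simp only [add_tmul, map_add, hx, hy]
      | ht a b => exact (smul_tmul a (δ (tmul A₂ b d)) n).symm
    intro c z
    induction z using BTensor.induction_on with
    | h0 => simp only [η, tmul_zero, map_zero]
    | ha x y hx hy =>
      simp only [η] at hx hy ⊢
      simp only [tmul_add, map_add, hx, hy]
    | ht d n =>
      refine (e _ d n).trans ?_
      exact congrArg (fun x => tmul A₂ x n) (L1 (tmul A₂ c d))
  refine ⟨G.comp lN, fun n => ?_, fun s => ?_⟩
  · change G (mapBi _ _ _) = n
    rw [← Q.lcoassoc]
    change lid A₂ N (mapBi δ _ ((assoc A₂ A₂ C₂ C₂ N).symm (assoc A₂ A₂ C₂ C₂ N _))) = n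
    rw [AddEquiv.symm_apply_apply, mapBi_mapBi]
    rw [show δ.comp 𝓒₂.comul = 𝓒₂.counit from
      BimodHom.ext fun c => congrArg (fun x => 𝓒₂.counit x) (hπ c)]
    exact Q.lcounit n
  · change Q.lcoact (G (lN s)) = _
    rw [a1, a2, a3]
    have e : ∀ t, mapBi (BimodHom.id A₂ A₂ C₂) (G.comp lN) t =
        mapBi (BimodHom.id A₂ A₂ C₂) G (mapBi (BimodHom.id A₂ A₂ C₂) lN t) := fun t => by
      rw [mapBi_mapBi]; rfl
    rw [e]
    induction s using BTensor.induction_on with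
    | h0 => simp only [η, map_zero]
    | ha x y hx hy =>
      simp only [η] at hx hy ⊢
      simp only [map_add, hx, hy]
    | ht c n =>
      refine (b2 c (Q.lcoact n)).symm.trans ?_
      rw [← b1]; rfl

namespace Cotensor

theorem lPres_of_isCoseparable (h : 𝓒₂.IsCoseparable) (W : Type u) [AddCommGroup W]
    [Module A₁ᵐᵒᵖ W] (P : Bicomod 𝓒₁ 𝓒₂ M) (Q : Bicomod 𝓒₂ 𝓒₃ N) : LPres W P Q := by
  obtain ⟨ζ, hζ, hc⟩ := h.exists_retraction Q
  obtain ⟨p, h, hpi, hip⟩ := split_of_retraction P Q ζ hζ hc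
  exact .of_split (p := p.left) (h := h.left) hpi hip
    fun x => ((exact_incl P Q) _).2 ⟨x, rfl⟩

theorem rPres_of_isCoseparable (h : 𝓒₂.IsCoseparable) (V : Type u) [AddCommGroup V]
    [Module A₃ V] (P : Bicomod 𝓒₁ 𝓒₂ M) (Q : Bicomod 𝓒₂ 𝓒₃ N) : RPres V P Q := by
  obtain ⟨ζ, hζ, hc⟩ := h.exists_retraction Q
  obtain ⟨p, h, hpi, hip⟩ := split_of_retraction P Q ζ hζ hc
  exact .of_split (p := p.right) (h := h.right) hpi hip
    fun x => ((exact_incl P Q) _).2 ⟨x, rfl⟩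

end Cotensor

end Pair

/-! ### Coflat comodules -/

section Coflat

variable {k : Type v} [CommRing k] {A₁ A₂ A₃ C₁ C₂ C₃ M N : Type u}
  [Ring A₁] [Algebra k A₁] [Ring A₂] [Algebra k A₂] [Ring A₃] [Algebra k A₃]
  [AddCommGroup C₁] [Module A₁ C₁] [Module A₁ᵐᵒᵖ C₁] [SMulCommClass A₁ A₁ᵐᵒᵖ C₁]
  [AddCommGroup C₂] [Module A₂ C₂] [Module A₂ᵐᵒᵖ C₂] [SMulCommClass A₂ A₂ᵐᵒᵖ C₂]
  [AddCommGroup C₃] [Module A₃ C₃] [Module A₃ᵐᵒᵖ C₃] [SMulCommClass A₃ A₃ᵐᵒᵖ C₃]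
  {𝓒₁ : Coring k A₁ C₁} {𝓒₂ : Coring k A₂ C₂} {𝓒₃ : Coring k A₃ C₃}
  [AddCommGroup M] [Module A₁ M] [Module A₂ᵐᵒᵖ M] [SMulCommClass A₁ A₂ᵐᵒᵖ M]
  [AddCommGroup N] [Module A₂ N] [Module A₃ᵐᵒᵖ N] [SMulCommClass A₂ A₃ᵐᵒᵖ N]

/-- The coaction `W ⊗ ρ` on `W ⊗ M`, for a right module `W` without further structure. -/
def tensorRightCoactLin (W : Type u) [AddCommGroup W] [Module A₁ᵐᵒᵖ W] (P : Bicomod 𝓒₁ 𝓒₂ M) :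
    BTensor A₁ W M →ₗ[A₂ᵐᵒᵖ] BTensor A₂ (BTensor A₁ W M) C₂ where
  toFun t := (assoc A₁ A₂ W M C₂).symm (lT W P.rcoact.left t)
  map_add' s t := by rw [map_add, map_add]
  map_smul' a t := by
    rw [AddEquiv.symm_apply_eq, RingHom.id_apply, assoc_rsmul, AddEquiv.apply_symm_apply]
    induction t using BTensor.induction_on with
    | h0 => simp only [smul_zero, map_zero]
    | ha x y hx hy => simp only [smul_add, map_add, hx, hy]
    | ht w m => exact congrArg (tmul A₁ w) (P.rcoact.map_rsmul a m)

/-- The right comodule `W ⊗ M`, for a right module `W` and a bicomodule `M`. -/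
def tensorRightComod (W : Type u) [AddCommGroup W] [Module A₁ᵐᵒᵖ W] (P : Bicomod 𝓒₁ 𝓒₂ M) :
    RightComod 𝓒₂ (BTensor A₁ W M) where
  coact := tensorRightCoactLin W P
  coassoc t := by
    have e1 : ∀ (w : W) (y : BTensor A₂ M C₂), assoc A₂ A₂ (BTensor A₁ W M) C₂ C₂
        (BTensor.map (tensorRightCoactLin W P)
          LinearMap.id ((assoc A₁ A₂ W M C₂).symm (tmul A₁ w y))) =
        (assoc A₁ A₂ W M (BTensor A₂ C₂ C₂)).symm (tmul A₁ w (assoc A₂ A₂ M C₂ C₂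
          (mapBi P.rcoact (BimodHom.id A₂ A₂ C₂) y))) := by
      intro w y
      induction y using BTensor.induction_on with
      | h0 => simp only [tmul_zero, map_zero]
      | ha x y hx hy => simp only [tmul_add, map_add, hx, hy]
      | ht m c =>
        change assoc A₂ A₂ (BTensor A₁ W M) C₂ C₂ (tmul A₂
          ((assoc A₁ A₂ W M C₂).symm (tmul A₁ w (P.rcoact m))) c) =
          (assoc A₁ A₂ W M (BTensor A₂ C₂ C₂)).symm (tmul A₁ w (assoc A₂ A₂ M C₂ C₂
            (tmul A₂ (P.rcoact m) c)))
        generalize P.rcoact m = z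
        induction z using BTensor.induction_on with
        | h0 => simp only [tmul_zero, zero_tmul, map_zero]
        | ha x y hx hy => simp only [tmul_add, add_tmul, map_add, hx, hy]
        | ht m c => rfl
    have e2 : ∀ (w : W) (y : BTensor A₂ M C₂), lT (BTensor A₁ W M) 𝓒₂.comul.left
        ((assoc A₁ A₂ W M C₂).symm (tmul A₁ w y)) =
        (assoc A₁ A₂ W M (BTensor A₂ C₂ C₂)).symm (tmul A₁ w
          (mapBi (BimodHom.id A₁ A₂ M) 𝓒₂.comul y)) := by
      intro w y
      induction y using BTensor.induction_on with
      | h0 => simp only [tmul_zero, map_zero]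
      | ha x y hx hy => simp only [tmul_add, map_add, hx, hy]
      | ht m c => rfl
    induction t using BTensor.induction_on with
    | h0 => simp only [map_zero]
    | ha x y hx hy => simp only [map_add, hx, hy]
    | ht w m =>
      refine (e1 w (P.rcoact m)).trans (Eq.trans ?_ (e2 w (P.rcoact m)).symm)
      rw [P.rcoassoc]
  counit t := by
    have e : ∀ (w : W) (y : BTensor A₂ M C₂), rid A₂ (BTensor A₁ W M)
        (lT (BTensor A₁ W M) 𝓒₂.counit.left ((assoc A₁ A₂ W M C₂).symm (tmul A₁ w y))) =
        tmul A₁ w (rid A₂ M (mapBi (BimodHom.id A₁ A₂ M) 𝓒₂.counit y)) := by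
      intro w y
      induction y using BTensor.induction_on with
      | h0 => simp only [tmul_zero, map_zero]
      | ha x y hx hy => simp only [tmul_add, map_add, hx, hy]
      | ht m c => rfl
    induction t using BTensor.induction_on with
    | h0 => simp only [map_zero]
    | ha x y hx hy => simp only [map_add, hx, hy]
    | ht w m =>
      refine (e w (P.rcoact m)).trans ?_
      rw [P.rcounit]

theorem tensorRightComod_coact {W : Type u} [AddCommGroup W] [Module A₁ᵐᵒᵖ W]
    (P : Bicomod 𝓒₁ 𝓒₂ M) (t : BTensor A₁ W M) : (tensorRightComod W P).coact t =
      (assoc A₁ A₂ W M C₂).symm (lT W P.rcoact.left t) := rfl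

theorem isRightColinear_rTBi {W W' : Type u} [AddCommGroup W] [Module A₁ᵐᵒᵖ W]
    [AddCommGroup W'] [Module A₁ᵐᵒᵖ W'] (f : W →ₗ[A₁ᵐᵒᵖ] W') (P : Bicomod 𝓒₁ 𝓒₂ M) :
    IsRightColinear (tensorRightComod W P).coact (tensorRightComod W' P).coact (rTBi f) := by
  intro t
  rw [tensorRightComod_coact, tensorRightComod_coact]
  apply (assoc A₁ A₂ W' M C₂).injective
  rw [assoc_rTBi, AddEquiv.apply_symm_apply, AddEquiv.apply_symm_apply]
  exact DFunLike.congr_fun (f := (rT (BTensor A₂ M C₂) f).comp (lT W P.rcoact.left))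
    (g := (lT W' P.rcoact.left).comp (rT M f)) (hom_ext fun _ _ => rfl) t

/-- The cotensor product of `W ⊗ M` with `N`, inside `W ⊗ (M ⊗ N)`. -/
theorem mem_cotensorSubgroup_tensorRightComod {W : Type u} [AddCommGroup W] [Module A₁ᵐᵒᵖ W]
    (P : Bicomod 𝓒₁ 𝓒₂ M) (Q : Bicomod 𝓒₂ 𝓒₃ N) (t : BTensor A₂ (BTensor A₁ W M) N) :
    t ∈ cotensorSubgroup (tensorRightComod W P).coact Q.lcoact.left ↔
      lT W (cotensorDiff P.rcoact Q.lcoact).left (assoc A₁ A₂ W M N t) = 0 := by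
  rw [mem_cotensorSubgroup,
    ← (assoc A₁ A₂ W M (BTensor A₂ C₂ N)).injective.eq_iff, ← sub_eq_zero]
  let f := (assocBi A₂ A₂ A₁ A₃ M C₂ N).comp (mapBi P.rcoact (BimodHom.id A₂ A₃ N))
  let g := mapBi (BimodHom.id A₁ A₂ M) Q.lcoact
  have h1 : assoc A₁ A₂ W M (BTensor A₂ C₂ N) (assoc A₂ A₂ (BTensor A₁ W M) C₂ N
      (rT N (tensorRightComod W P).coact t)) = lT W f.left (assoc A₁ A₂ W M N t) := by
    refine DFunLike.congr_fun (f := (assoc A₁ A₂ W M (BTensor A₂ C₂ N)).toAddMonoidHom.comp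
      ((assoc A₂ A₂ (BTensor A₁ W M) C₂ N).toAddMonoidHom.comp
        (rT N (tensorRightComod W P).coact)))
      (g := (lT W f.left).comp (assoc A₁ A₂ W M N).toAddMonoidHom)
      (hom_ext₂ fun w m n => ?_) t
    change assoc A₁ A₂ W M (BTensor A₂ C₂ N) (assoc A₂ A₂ (BTensor A₁ W M) C₂ N
      (tmul A₂ ((assoc A₁ A₂ W M C₂).symm (tmul A₁ w (P.rcoact m))) n)) =
      tmul A₁ w (assoc A₂ A₂ M C₂ N (tmul A₂ (P.rcoact m) n))
    generalize P.rcoact m = z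
    induction z using BTensor.induction_on with
    | h0 => simp only [tmul_zero, zero_tmul, map_zero]
    | ha x y hx hy => simp only [tmul_add, add_tmul, map_add, hx, hy]
    | ht m c => rfl
  have h2 : assoc A₁ A₂ W M (BTensor A₂ C₂ N) (lT (BTensor A₁ W M) Q.lcoact.left t) =
      lT W g.left (assoc A₁ A₂ W M N t) := assoc_lTBi _ t
  have h3 : lT W (cotensorDiff P.rcoact Q.lcoact).left (assoc A₁ A₂ W M N t) =
      lT W f.left (assoc A₁ A₂ W M N t) - lT W g.left (assoc A₁ A₂ W M N t) :=
    lT_sub f.left g.left _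
  rw [h3, ← h1, ← h2]

theorem LinearMap.exists_lift {R K Y T : Type*} [Ring R] [AddCommGroup K] [Module R K]
    [AddCommGroup Y] [Module R Y] [AddCommGroup T] [Module R T] {j : K →ₗ[R] Y}
    (hj : Function.Injective j) (f : T →ₗ[R] Y) (h : ∀ t, ∃ x, j x = f t) :
    ∃ g : T →ₗ[R] K, ∀ t, j (g t) = f t := by
  choose g hg using h
  exact ⟨{ toFun := g
           map_add' := fun x y => hj (by rw [map_add, hg, hg, hg, map_add])
           map_smul' := fun a x => hj (by rw [RingHom.id_apply, map_smul, hg, hg, map_smul]) }, hg⟩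

/-- If the coring is left flat, kernels of right colinear maps are right comodules. -/
theorem exists_kernel_comod (hC : LeftFlat A₂ C₂) {M M' : Type u}
    [AddCommGroup M] [Module A₂ᵐᵒᵖ M] [AddCommGroup M'] [Module A₂ᵐᵒᵖ M']
    (P : RightComod 𝓒₂ M) (P' : RightComod 𝓒₂ M') (g : M →ₗ[A₂ᵐᵒᵖ] M')
    (hg : IsRightColinear P.coact P'.coact g) :
    ∃ S : RightComod 𝓒₂ (LinearMap.ker g),
      IsRightColinear S.coact P.coact (LinearMap.ker g).subtype := by
  set j := (LinearMap.ker g).subtype with hj_def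
  have hj : Function.Injective j := (LinearMap.ker g).injective_subtype
  have hex := RExact.of_leftFlat hC hj (LinearMap.exact_subtype_ker_map g)
  obtain ⟨κ, hκ⟩ := LinearMap.exists_lift (j := rTBi (B := A₂) (N := C₂) j) hex.1 (P.coact ∘ₗ j)
    fun x => (hex.2 _).1 (by
      rw [LinearMap.comp_apply, hg]
      have : g (j x) = 0 := x.2
      rw [this, map_zero])
  have hκ' : rTBi j ∘ₗ κ = P.coact ∘ₗ j := LinearMap.ext hκ
  refine ⟨⟨κ, fun x => ?_, fun x => ?_⟩, hκ⟩
  · apply hC.bTensor hC _ _ j hj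
    rw [← assoc_rTBi, rT_rT, hκ']
    have h1 : rT C₂ (P.coact ∘ₗ j) (κ x) = rT C₂ P.coact (rT C₂ j (κ x)) := (rT_rT _ _ _).symm
    have h2 : rT C₂ j (κ x) = P.coact (j x) := hκ x
    have h3 : rT (BTensor A₂ C₂ C₂) j (lT _ 𝓒₂.comul.left (κ x)) =
        lT M 𝓒₂.comul.left (rT C₂ j (κ x)) :=
      DFunLike.congr_fun (f := (rT (BTensor A₂ C₂ C₂) j).comp (lT _ 𝓒₂.comul.left))
        (g := (lT M 𝓒₂.comul.left).comp (rT C₂ j)) (hom_ext fun _ _ => rfl) (κ x)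
    rw [h3, h1, h2]
    exact P.coassoc (j x)
  · apply hj
    have h2 : rT C₂ j (κ x) = P.coact (j x) := hκ x
    have h3 : j (rid A₂ _ (lT _ 𝓒₂.counit.left (κ x))) =
        rid A₂ M (lT M 𝓒₂.counit.left (rT C₂ j (κ x))) :=
      DFunLike.congr_fun (f := j.toAddMonoidHom.comp ((rid A₂ _).comp (lT _ 𝓒₂.counit.left)))
        (g := (rid A₂ M).comp ((lT M 𝓒₂.counit.left).comp (rT C₂ j)))
        (hom_ext fun _ _ => rfl) (κ x)
    rw [h3, h2]
    exact P.counit (j x)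

/-- Coflatness in terms of elements: if `N` is coflat over a left flat coring and `g` is a
surjective colinear map, then `g □ N` is surjective, and its kernel is the image of
`ker g □ N`. -/
theorem IsCoflat.exact_of_surjective {l : N →ₗ[A₂] BTensor A₂ C₂ N} (hl : IsCoflat 𝓒₂ l)
    (hC : LeftFlat A₂ C₂) {M M' : Type u}
    [AddCommGroup M] [Module A₂ᵐᵒᵖ M] [AddCommGroup M'] [Module A₂ᵐᵒᵖ M']
    (P : RightComod 𝓒₂ M) (P' : RightComod 𝓒₂ M') (g : M →ₗ[A₂ᵐᵒᵖ] M')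
    (hg : IsRightColinear P.coact P'.coact g) (hs : Function.Surjective g) :
    (∀ z ∈ cotensorSubgroup P'.coact l, ∃ y ∈ cotensorSubgroup P.coact l, rT N g y = z) ∧
    ∃ S : RightComod 𝓒₂ (LinearMap.ker g),
      IsRightColinear S.coact P.coact (LinearMap.ker g).subtype ∧
      ∀ y ∈ cotensorSubgroup P.coact l, rT N g y = 0 →
        ∃ x ∈ cotensorSubgroup S.coact l, rT N (LinearMap.ker g).subtype x = y := by
  obtain ⟨S, hS⟩ := exists_kernel_comod hC P P' g hg
  obtain ⟨-, h2, h3⟩ := hl _ _ _ S P P' _ g hS hg (LinearMap.ker g).injective_subtype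
    (LinearMap.exact_subtype_ker_map g) hs
  refine ⟨fun z hz => ?_, S, hS, fun y hy h0 => ?_⟩
  · obtain ⟨y, hy⟩ := h3 ⟨z, hz⟩
    exact ⟨y, y.2, congrArg Subtype.val hy⟩
  · obtain ⟨x, hx⟩ := (h2 ⟨y, hy⟩).1 (Subtype.ext h0)
    exact ⟨x, x.2, congrArg Subtype.val hx⟩

/-- Over a left flat coring, coflat left comodules are flat: `W ⊗ N` is a natural direct summand,
via the coaction, of `(W ⊗ C) □ N`. -/
theorem IsCoflat.leftFlat (Q : Bicomod 𝓒₂ 𝓒₃ N) (hl : IsCoflat 𝓒₂ Q.lcoact.left)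
    (hC : LeftFlat A₂ C₂) : LeftFlat A₂ N := by
  intro W W' _ _ _ _ f hf
  have h1 := (hl _ _ _ (tensorRightComod W 𝓒₂.self) (tensorRightComod W' 𝓒₂.self)
    (tensorRightComod (W' ⧸ LinearMap.range f) 𝓒₂.self) (rTBi f)
    (rTBi (LinearMap.range f).mkQ) (isRightColinear_rTBi f _) (isRightColinear_rTBi _ _)
    (hC _ _ f hf)
    (rT_exact (LinearMap.exact_map_mkQ_range f) (Submodule.mkQ_surjective _))
    (map_surjective (Submodule.mkQ_surjective _) Function.surjective_id)).1
  have hmem : ∀ t : BTensor A₂ W N, (assoc A₂ A₂ W C₂ N).symm (lT W Q.lcoact.left t) ∈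
      cotensorSubgroup (tensorRightComod W 𝓒₂.self).coact Q.lcoact.left := by
    intro t
    rw [mem_cotensorSubgroup_tensorRightComod, AddEquiv.apply_symm_apply, lT_lT]
    have : (cotensorDiff 𝓒₂.self.rcoact Q.lcoact).left ∘ₗ Q.lcoact.left = 0 :=
      LinearMap.ext fun n => cotensorDiff_eq_zero.2 (Q.lcoassoc n)
    rw [this]
    exact DFunLike.congr_fun (f := lT W (0 : N →ₗ[A₂] _)) (g := 0)
      (hom_ext fun w n => tmul_zero w) t
  have hret : ∀ t : BTensor A₂ W N, lT W (((lidBi A₂ A₃ N).comp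
      (mapBi 𝓒₂.counit (BimodHom.id A₂ A₃ N))).left) (lT W Q.lcoact.left t) = t := fun t => by
    rw [lT_lT]
    rw [show _ ∘ₗ Q.lcoact.left = LinearMap.id from LinearMap.ext Q.lcounit]
    exact lT_id t
  rw [injective_iff_map_eq_zero]
  intro t ht
  have h2 : rT N (rTBi (B := A₂) (N := C₂) f)
      ((assoc A₂ A₂ W C₂ N).symm (lT W Q.lcoact.left t)) = 0 := by
    apply (assoc A₂ A₂ W' C₂ N).injective
    rw [assoc_rTBi, AddEquiv.apply_symm_apply, map_zero]
    have : rT (BTensor A₂ C₂ N) f (lT W Q.lcoact.left t) = lT W' Q.lcoact.left (rT N f t) :=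
      DFunLike.congr_fun (f := (rT (BTensor A₂ C₂ N) f).comp (lT W Q.lcoact.left))
        (g := (lT W' Q.lcoact.left).comp (rT N f)) (hom_ext fun _ _ => rfl) t
    rw [this, ht, map_zero]
  have h3 : (⟨_, hmem t⟩ : cotensorSubgroup (tensorRightComod W 𝓒₂.self).coact Q.lcoact.left) = 0 :=
    h1 (Subtype.ext h2)
  have h4 : (assoc A₂ A₂ W C₂ N).symm (lT W Q.lcoact.left t) = 0 := congrArg Subtype.val h3
  rw [AddEquiv.map_eq_zero_iff] at h4
  rw [← hret t, h4, map_zero]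

section Comm

variable {A Y Z : Type*} [Ring A] {W W' : Type*} [AddCommGroup W] [Module Aᵐᵒᵖ W]
  [AddCommGroup W'] [Module Aᵐᵒᵖ W'] [AddCommGroup Y] [Module A Y] [AddCommGroup Z] [Module A Z]

theorem BTensor.rT_lT (f : W →ₗ[Aᵐᵒᵖ] W') (g : Y →ₗ[A] Z) (t : BTensor A W Y) :
    rT Z f (lT W g t) = lT W' g (rT Y f t) :=
  DFunLike.congr_fun (f := (rT Z f).comp (lT W g)) (g := (lT W' g).comp (rT Y f))
    (hom_ext fun _ _ => rfl) t

end Comm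

/-- Every right module is a quotient of a flat one. -/
theorem exists_rightFlat_cover {A : Type u} [Ring A] (W : Type u) [AddCommGroup W]
    [Module Aᵐᵒᵖ W] : ∃ (F : Type u) (_ : AddCommGroup F) (_ : Module Aᵐᵒᵖ F),
      RightFlat A F ∧ ∃ g : F →ₗ[Aᵐᵒᵖ] W, Function.Surjective g :=
  ⟨W →₀ Aᵐᵒᵖ, inferInstance, inferInstance, rightFlat_finsupp A W,
    Finsupp.linearCombination Aᵐᵒᵖ id, Finsupp.linearCombination_id_surjective _ _⟩

/-- If `N` is a coflat comodule over a left flat coring, then `W ⊗ (M □ N) ≃ (W ⊗ M) □ N` for every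
right module `W`: both sides are right exact in `W` and they agree for free `W`. -/
theorem IsCoflat.lPres (P : Bicomod 𝓒₁ 𝓒₂ M) (Q : Bicomod 𝓒₂ 𝓒₃ N)
    (hl : IsCoflat 𝓒₂ Q.lcoact.left) (hC : LeftFlat A₂ C₂) (W : Type u) [AddCommGroup W]
    [Module A₁ᵐᵒᵖ W] : Cotensor.LPres W P Q := by
  set i := (Cotensor.incl P Q).left
  set d := (cotensorDiff P.rcoact Q.lcoact).left
  have hF' : ∀ (F : Type u) [AddCommGroup F] [Module A₁ᵐᵒᵖ F], RightFlat A₁ F → LExact F i d :=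
    fun F _ _ hF => Cotensor.lPres_of_rightFlat hF P Q
  have hsurj : ∀ (W : Type u) [AddCommGroup W] [Module A₁ᵐᵒᵖ W] (s : BTensor A₁ W _),
      lT W d s = 0 → ∃ r, lT W i r = s := by
    intro W _ _ s hs
    obtain ⟨F, _, _, hF, g, hg⟩ := exists_rightFlat_cover (A := A₁) W
    obtain ⟨t, rfl⟩ := (assoc A₁ A₂ W M N).surjective s
    obtain ⟨t', ht', rfl⟩ := (hl.exact_of_surjective hC (tensorRightComod _ P)
      (tensorRightComod W P) (rTBi g) (isRightColinear_rTBi g P)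
      (map_surjective hg Function.surjective_id)).1 t
      ((mem_cotensorSubgroup_tensorRightComod P Q t).2 hs)
    obtain ⟨r, hr⟩ := ((hF' F hF).2 _).1 ((mem_cotensorSubgroup_tensorRightComod P Q t').1 ht')
    refine ⟨rT _ g r, ?_⟩
    rw [← rT_lT, hr, assoc_rTBi]
  have hd0 : ∀ x, d (i x) = 0 := fun x => ((Cotensor.exact_incl P Q) _).2 ⟨x, rfl⟩
  refine ⟨?_, fun s => ⟨hsurj W s, ?_⟩⟩
  · rw [injective_iff_map_eq_zero]
    intro r hr
    obtain ⟨F, _, _, hF, g, hg⟩ := exists_rightFlat_cover (A := A₁) W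
    obtain ⟨r', rfl⟩ := map_surjective (g := (LinearMap.id : Cotensor P Q →ₗ[A₁] _)) hg
      Function.surjective_id r
    obtain ⟨t', ht'⟩ := (assoc A₁ A₂ F M N).surjective (lT _ i r')
    have hmem : t' ∈ cotensorSubgroup (tensorRightComod F P).coact Q.lcoact.left := by
      rw [mem_cotensorSubgroup_tensorRightComod, ht']
      exact ((hF' F hF).2 _).2 ⟨_, rfl⟩
    have h0 : rT N (rTBi (B := A₂) (N := M) g) t' = 0 := by
      apply (assoc A₁ A₂ W M N).injective
      rw [assoc_rTBi, ht', rT_lT, hr, map_zero]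
    have hgM : Function.Surjective (rTBi (B := A₂) (N := M) g) :=
      map_surjective hg Function.surjective_id
    obtain ⟨-, S, hS, hSex⟩ := hl.exact_of_surjective hC (tensorRightComod _ P)
      (tensorRightComod W P) (rTBi g) (isRightColinear_rTBi g P) hgM
    obtain ⟨x, hx, hxt⟩ := hSex t' hmem h0
    -- `R ⊗ M → ker (F ⊗ M → W ⊗ M)` is surjective and colinear, where `R = ker (F → W)`
    set R := LinearMap.ker g
    have hexR : Function.Exact R.subtype g := LinearMap.exact_subtype_ker_map g
    have hex := rT_exact (V := M) hexR hg
    let c : BTensor A₁ R M →ₗ[A₂ᵐᵒᵖ] LinearMap.ker (rTBi (B := A₂) (N := M) g) :=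
      (rTBi (B := A₂) (N := M) R.subtype).codRestrict _ fun y => (hex _).2 ⟨y, rfl⟩
    have hc : Function.Surjective c := fun y => by
      obtain ⟨z, hz⟩ := (hex _).1 y.2
      exact ⟨z, Subtype.ext hz⟩
    have hcs : (LinearMap.ker (rTBi (B := A₂) (N := M) g)).subtype ∘ₗ c = rTBi R.subtype := rfl
    have hcol : IsRightColinear (tensorRightComod R P).coact S.coact c := fun y => by
      apply hC _ _ _ (LinearMap.ker (rTBi (B := A₂) (N := M) g)).injective_subtype
      rw [rT_rT, hcs, isRightColinear_rTBi, hS]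
      rfl
    obtain ⟨y, hy, rfl⟩ := (hl.exact_of_surjective hC (tensorRightComod R P) S c hcol hc).1 x hx
    obtain ⟨r₀, hr₀⟩ := hsurj R _ ((mem_cotensorSubgroup_tensorRightComod P Q y).1 hy)
    have h1 : rT _ R.subtype r₀ = r' := by
      apply (hF' F hF).1
      rw [← rT_lT, hr₀, ← assoc_rTBi, ← ht', ← hxt, rT_rT, hcs]
    change rT _ g r' = 0
    rw [← h1, rT_rT]
    have : g ∘ₗ R.subtype = 0 := LinearMap.ext fun x => x.2
    rw [this]
    exact DFunLike.congr_fun (f := rT _ (0 : R →ₗ[A₁ᵐᵒᵖ] W)) (g := 0)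
      (hom_ext fun w n => zero_tmul n) r₀
  · rintro ⟨r, rfl⟩
    rw [lT_lT]
    have : d ∘ₗ i = 0 := LinearMap.ext hd0
    rw [this]
    exact DFunLike.congr_fun (f := lT W (0 : Cotensor P Q →ₗ[A₁] _)) (g := 0)
      (hom_ext fun w n => tmul_zero w) r

end Coflat

/-! ### Bicomodule structures on tensor and cotensor products -/

namespace BTensor

section

variable {R A B M N M' N' : Type*} [Ring R] [Ring A] [Ring B]
  [AddCommGroup M] [Module R M] [Module Aᵐᵒᵖ M] [SMulCommClass R Aᵐᵒᵖ M]
  [AddCommGroup N] [Module A N] [Module Bᵐᵒᵖ N] [SMulCommClass A Bᵐᵒᵖ N]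
  [AddCommGroup M'] [Module R M'] [Module Aᵐᵒᵖ M'] [SMulCommClass R Aᵐᵒᵖ M']
  [AddCommGroup N'] [Module A N'] [Module Bᵐᵒᵖ N'] [SMulCommClass A Bᵐᵒᵖ N']

theorem mapBi_id_id :
    mapBi (BimodHom.id R A M) (BimodHom.id A B N) = BimodHom.id R B (BTensor A M N) :=
  BimodHom.ext mapBi_id

theorem mapBi_swap (f : BimodHom R A M M') (g : BimodHom A B N N') (t : BTensor A M N) :
    mapBi f (BimodHom.id A B N') (mapBi (BimodHom.id R A M) g t) =
      mapBi (BimodHom.id R A M') g (mapBi f (BimodHom.id A B N) t) :=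
  DFunLike.congr_fun (f := (mapBi f (BimodHom.id A B N')).add.comp
      (mapBi (BimodHom.id R A M) g).add)
    (g := (mapBi (BimodHom.id R A M') g).add.comp (mapBi f (BimodHom.id A B N)).add)
    (hom_ext fun _ _ => rfl) t

theorem mapBi_eq_comp (f : BimodHom R A M M') (g : BimodHom A B N N') (t : BTensor A M N) :
    mapBi f g t = mapBi f (BimodHom.id A B N') (mapBi (BimodHom.id R A M) g t) :=
  DFunLike.congr_fun (f := (mapBi f g).add) (g := (mapBi f (BimodHom.id A B N')).add.comp
      (mapBi (BimodHom.id R A M) g).add) (hom_ext fun _ _ => rfl) t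

theorem mapBi_id_comp {N'' : Type*} [AddCommGroup N''] [Module A N''] [Module Bᵐᵒᵖ N'']
    [SMulCommClass A Bᵐᵒᵖ N''] (g : BimodHom A B N' N'') (f : BimodHom A B N N')
    (t : BTensor A M N) : mapBi (BimodHom.id R A M) g (mapBi (BimodHom.id R A M) f t) =
      mapBi (BimodHom.id R A M) (g.comp f) t :=
  mapBi_mapBi _ _ _ _ t

theorem mapBi_comp_id {M'' : Type*} [AddCommGroup M''] [Module R M''] [Module Aᵐᵒᵖ M'']
    [SMulCommClass R Aᵐᵒᵖ M''] (g : BimodHom R A M' M'') (f : BimodHom R A M M')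
    (t : BTensor A M N) : mapBi g (BimodHom.id A B N) (mapBi f (BimodHom.id A B N) t) =
      mapBi (g.comp f) (BimodHom.id A B N) t :=
  mapBi_mapBi _ _ _ _ t

end

section

variable {R A B E M N P P' : Type*} [Ring R] [Ring A] [Ring B] [Ring E]
  [AddCommGroup M] [Module R M] [Module Aᵐᵒᵖ M] [SMulCommClass R Aᵐᵒᵖ M]
  [AddCommGroup N] [Module A N] [Module Bᵐᵒᵖ N] [SMulCommClass A Bᵐᵒᵖ N]
  [AddCommGroup P] [Module B P] [Module Eᵐᵒᵖ P] [SMulCommClass B Eᵐᵒᵖ P]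
  [AddCommGroup P'] [Module B P'] [Module Eᵐᵒᵖ P'] [SMulCommClass B Eᵐᵒᵖ P']

theorem injective_mapBi_id_mapBi_id {i : BimodHom B E P P'}
    (h : Function.Injective (mapBi (BimodHom.id R B (BTensor A M N)) i)) :
    Function.Injective (mapBi (BimodHom.id R A M) (mapBi (BimodHom.id A B N) i)) := by
  intro s t hst
  obtain ⟨s, rfl⟩ := (assoc A B M N P).surjective s
  obtain ⟨t, rfl⟩ := (assoc A B M N P).surjective t
  rw [← assoc_mapBi, ← assoc_mapBi, mapBi_id_id] at hst
  exact congrArg _ (h ((assoc A B M N P').injective hst))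

theorem injective_mapBi_id_mapBi {N' : Type*} [AddCommGroup N'] [Module A N'] [Module Bᵐᵒᵖ N']
    [SMulCommClass A Bᵐᵒᵖ N'] {i : BimodHom A B N N'}
    (h : Function.Injective (mapBi (mapBi (BimodHom.id R A M) i) (BimodHom.id B E P))) :
    Function.Injective (mapBi (BimodHom.id R A M) (mapBi i (BimodHom.id B E P))) := by
  intro s t hst
  obtain ⟨s, rfl⟩ := (assoc A B M N P).surjective s
  obtain ⟨t, rfl⟩ := (assoc A B M N P).surjective t
  rw [← assoc_mapBi, ← assoc_mapBi] at hst
  exact congrArg _ (h ((assoc A B M N' P).injective hst))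

theorem pentagon {F Q : Type*} [Ring F] [AddCommGroup Q] [Module E Q] [Module Fᵐᵒᵖ Q]
    [SMulCommClass E Fᵐᵒᵖ Q] (t : BTensor E (BTensor B (BTensor A M N) P) Q) :
    assoc A B M N (BTensor E P Q) (assoc B E (BTensor A M N) P Q t) =
      mapBi (BimodHom.id R A M) (assocBi B E A F N P Q)
        (assoc A E M (BTensor B N P) Q
          (mapBi (assocBi A B R E M N P) (BimodHom.id E F Q) t)) := by
  refine DFunLike.congr_fun
    (f := (assoc A B M N (BTensor E P Q)).toAddMonoidHom.comp
      (assoc B E (BTensor A M N) P Q).toAddMonoidHom)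
    (g := (mapBi (BimodHom.id R A M) (assocBi B E A F N P Q)).add.comp
      ((assoc A E M (BTensor B N P) Q).toAddMonoidHom.comp
          (mapBi (assocBi A B R E M N P) (BimodHom.id E F Q)).add))
    (hom_ext₂ fun x p q => ?_) t
  induction x using BTensor.induction_on with
  | h0 => simp only [zero_tmul, map_zero]
  | ha x y hx hy => simp only [add_tmul, map_add, hx, hy]
  | ht m n => rfl

end

end BTensor

section

variable {A₁ A₂ A₃ C₁ C₃ M N : Type*} [Ring A₁] [Ring A₂] [Ring A₃]
  [AddCommGroup C₁] [Module A₁ C₁] [Module A₁ᵐᵒᵖ C₁] [SMulCommClass A₁ A₁ᵐᵒᵖ C₁]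
  [AddCommGroup C₃] [Module A₃ C₃] [Module A₃ᵐᵒᵖ C₃] [SMulCommClass A₃ A₃ᵐᵒᵖ C₃]
  [AddCommGroup M] [Module A₁ M] [Module A₂ᵐᵒᵖ M] [SMulCommClass A₁ A₂ᵐᵒᵖ M]
  [AddCommGroup N] [Module A₂ N] [Module A₃ᵐᵒᵖ N] [SMulCommClass A₂ A₃ᵐᵒᵖ N]

/-- The coactions `l ⊗ N` and `M ⊗ r` on `M ⊗ N` commute, whatever `l` and `r` are. -/
theorem tensorLeftCoact_tensorRightCoact (l : BimodHom A₁ A₂ M (BTensor A₁ C₁ M))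
    (r : BimodHom A₂ A₃ N (BTensor A₃ N C₃)) (t : BTensor A₂ M N) :
    assoc A₁ A₃ C₁ (BTensor A₂ M N) C₃
        (mapBi (tensorLeftCoact (B' := A₃) N l) (BimodHom.id A₃ A₃ C₃)
          (tensorRightCoact (A := A₁) M r t)) =
      mapBi (BimodHom.id A₁ A₁ C₁) (tensorRightCoact (A := A₁) M r)
        (tensorLeftCoact (B' := A₃) N l t) := by
  have e1 : ∀ (m : M) (y : BTensor A₃ N C₃), assoc A₁ A₃ C₁ (BTensor A₂ M N) C₃
      (mapBi (tensorLeftCoact (B' := A₃) N l) (BimodHom.id A₃ A₃ C₃)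
        ((assoc A₂ A₃ M N C₃).symm (tmul A₂ m y))) =
      mapBi (BimodHom.id A₁ A₁ C₁) (assocBiSymm A₂ A₃ A₁ A₃ M N C₃)
        (assoc A₁ A₂ C₁ M (BTensor A₃ N C₃) (tmul A₂ (l m) y)) := by
    intro m y
    induction y using BTensor.induction_on with
    | h0 => simp only [tmul_zero, map_zero]
    | ha x y hx hy => simp only [tmul_add, map_add, hx, hy]
    | ht n c =>
      change assoc A₁ A₃ C₁ (BTensor A₂ M N) C₃
        (tmul A₃ (assoc A₁ A₂ C₁ M N (tmul A₂ (l m) n)) c) = _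
      generalize l m = z
      induction z using BTensor.induction_on with
      | h0 => simp only [zero_tmul, map_zero]
      | ha x y hx hy => simp only [add_tmul, map_add, hx, hy]
      | ht c' m => rfl
  have e2 : ∀ (z : BTensor A₁ C₁ M) (n : N), mapBi (BimodHom.id A₁ A₁ C₁)
      (tensorRightCoact (A := A₁) M r) (assoc A₁ A₂ C₁ M N (tmul A₂ z n)) =
      mapBi (BimodHom.id A₁ A₁ C₁) (assocBiSymm A₂ A₃ A₁ A₃ M N C₃)
        (assoc A₁ A₂ C₁ M (BTensor A₃ N C₃) (tmul A₂ z (r n))) := by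
    intro z n
    induction z using BTensor.induction_on with
    | h0 => simp only [zero_tmul, map_zero]
    | ha x y hx hy => simp only [add_tmul, map_add, hx, hy]
    | ht c m => rfl
  induction t using BTensor.induction_on with
  | h0 => simp only [map_zero]
  | ha x y hx hy => simp only [map_add, hx, hy]
  | ht m n => exact (e1 m (r n)).trans (e2 (l m) n).symm

end

section TensorBicomod

variable {k : Type v} [CommRing k] {A₁ A₂ A₃ C₁ C₂ C₃ M N : Type u}
  [Ring A₁] [Algebra k A₁] [Ring A₂] [Algebra k A₂] [Ring A₃] [Algebra k A₃]
  [AddCommGroup C₁] [Module A₁ C₁] [Module A₁ᵐᵒᵖ C₁] [SMulCommClass A₁ A₁ᵐᵒᵖ C₁]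
  [AddCommGroup C₂] [Module A₂ C₂] [Module A₂ᵐᵒᵖ C₂] [SMulCommClass A₂ A₂ᵐᵒᵖ C₂]
  [AddCommGroup C₃] [Module A₃ C₃] [Module A₃ᵐᵒᵖ C₃] [SMulCommClass A₃ A₃ᵐᵒᵖ C₃]
  {𝓒₁ : Coring k A₁ C₁} {𝓒₂ : Coring k A₂ C₂} {𝓒₃ : Coring k A₃ C₃}
  [AddCommGroup M] [Module A₁ M] [Module A₂ᵐᵒᵖ M] [SMulCommClass A₁ A₂ᵐᵒᵖ M]
  [AddCommGroup N] [Module A₂ N] [Module A₃ᵐᵒᵖ N] [SMulCommClass A₂ A₃ᵐᵒᵖ N]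

/-- The bicomodule `M ⊗ N`; only the left coaction of `M` and the right coaction of `N` enter. -/
def tensorBicomod (P : Bicomod 𝓒₁ 𝓒₂ M) (Q : Bicomod 𝓒₂ 𝓒₃ N) :
    Bicomod 𝓒₁ 𝓒₃ (BTensor A₂ M N) where
  central r t := by
    induction t using BTensor.induction_on with
    | h0 => simp only [smul_zero]
    | ha x y hx hy => simp only [smul_add, hx, hy]
    | ht m n =>
      rw [lsmul_tmul, P.central, rsmul_tmul, ← Q.central, smul_tmul]
  lcoact := tensorLeftCoact N P.lcoact
  rcoact := tensorRightCoact M Q.rcoact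
  lcoassoc t := by
    have e1 : ∀ (z : BTensor A₁ C₁ M) (n : N), assoc A₁ A₁ C₁ C₁ (BTensor A₂ M N)
        (mapBi 𝓒₁.comul (BimodHom.id A₁ A₃ _) (assoc A₁ A₂ C₁ M N (tmul A₂ z n))) =
        mapBi (BimodHom.id A₁ A₁ C₁) (assocBi A₁ A₂ A₁ A₃ C₁ M N)
          (assoc A₁ A₂ C₁ (BTensor A₁ C₁ M) N (tmul A₂ (assoc A₁ A₁ C₁ C₁ M
            (mapBi 𝓒₁.comul (BimodHom.id A₁ A₂ M) z)) n)) := by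
      intro z n
      induction z using BTensor.induction_on with
      | h0 => simp only [zero_tmul, map_zero]
      | ha x y hx hy => simp only [add_tmul, map_add, hx, hy]
      | ht c m =>
        change assoc A₁ A₁ C₁ C₁ (BTensor A₂ M N) (tmul A₁ (𝓒₁.comul c) (tmul A₂ m n)) =
          mapBi _ _ (assoc A₁ A₂ C₁ (BTensor A₁ C₁ M) N (tmul A₂ (assoc A₁ A₁ C₁ C₁ M
            (tmul A₁ (𝓒₁.comul c) m)) n))
        generalize 𝓒₁.comul c = y
        induction y using BTensor.induction_on with
        | h0 => simp only [zero_tmul, map_zero]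
        | ha x y hx hy => simp only [add_tmul, map_add, hx, hy]
        | ht c c' => rfl
    have e2 : ∀ (z : BTensor A₁ C₁ M) (n : N), mapBi (BimodHom.id A₁ A₁ C₁)
        (tensorLeftCoact (B' := A₃) N P.lcoact) (assoc A₁ A₂ C₁ M N (tmul A₂ z n)) =
        mapBi (BimodHom.id A₁ A₁ C₁) (assocBi A₁ A₂ A₁ A₃ C₁ M N)
          (assoc A₁ A₂ C₁ (BTensor A₁ C₁ M) N (tmul A₂
            (mapBi (BimodHom.id A₁ A₁ C₁) P.lcoact z) n)) := by
      intro z n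
      induction z using BTensor.induction_on with
      | h0 => simp only [zero_tmul, map_zero]
      | ha x y hx hy => simp only [add_tmul, map_add, hx, hy]
      | ht c m => rfl
    induction t using BTensor.induction_on with
    | h0 => simp only [map_zero]
    | ha x y hx hy => simp only [map_add, hx, hy]
    | ht m n =>
      refine (e1 (P.lcoact m) n).trans (Eq.trans ?_ (e2 (P.lcoact m) n).symm)
      rw [P.lcoassoc]
  lcounit t := by
    have e : ∀ (z : BTensor A₁ C₁ M) (n : N), lid A₁ (BTensor A₂ M N)
        (mapBi 𝓒₁.counit (BimodHom.id A₁ A₃ _) (assoc A₁ A₂ C₁ M N (tmul A₂ z n))) =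
        tmul A₂ (lid A₁ M (mapBi 𝓒₁.counit (BimodHom.id A₁ A₂ M) z)) n := by
      intro z n
      induction z using BTensor.induction_on with
      | h0 => simp only [zero_tmul, map_zero]
      | ha x y hx hy => simp only [add_tmul, map_add, hx, hy]
      | ht c m => rfl
    induction t using BTensor.induction_on with
    | h0 => simp only [map_zero]
    | ha x y hx hy => simp only [map_add, hx, hy]
    | ht m n =>
      refine (e (P.lcoact m) n).trans ?_
      rw [P.lcounit]
  rcoassoc t := by
    have e1 : ∀ (m : M) (z : BTensor A₃ N C₃), assoc A₃ A₃ (BTensor A₂ M N) C₃ C₃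
        (mapBi (tensorRightCoact (A := A₁) M Q.rcoact) (BimodHom.id A₃ A₃ C₃)
          ((assoc A₂ A₃ M N C₃).symm (tmul A₂ m z))) =
        (assoc A₂ A₃ M N (BTensor A₃ C₃ C₃)).symm (tmul A₂ m (assoc A₃ A₃ N C₃ C₃
          (mapBi Q.rcoact (BimodHom.id A₃ A₃ C₃) z))) := by
      intro m z
      induction z using BTensor.induction_on with
      | h0 => simp only [tmul_zero, map_zero]
      | ha x y hx hy => simp only [tmul_add, map_add, hx, hy]
      | ht n c =>
        change assoc A₃ A₃ (BTensor A₂ M N) C₃ C₃ (tmul A₃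
          ((assoc A₂ A₃ M N C₃).symm (tmul A₂ m (Q.rcoact n))) c) =
          (assoc A₂ A₃ M N (BTensor A₃ C₃ C₃)).symm (tmul A₂ m (assoc A₃ A₃ N C₃ C₃
            (tmul A₃ (Q.rcoact n) c)))
        generalize Q.rcoact n = y
        induction y using BTensor.induction_on with
        | h0 => simp only [tmul_zero, zero_tmul, map_zero]
        | ha x y hx hy => simp only [tmul_add, add_tmul, map_add, hx, hy]
        | ht c c' => rfl
    have e2 : ∀ (m : M) (z : BTensor A₃ N C₃), mapBi (BimodHom.id A₁ A₃ (BTensor A₂ M N))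
        𝓒₃.comul ((assoc A₂ A₃ M N C₃).symm (tmul A₂ m z)) =
        (assoc A₂ A₃ M N (BTensor A₃ C₃ C₃)).symm (tmul A₂ m
          (mapBi (BimodHom.id A₂ A₃ N) 𝓒₃.comul z)) := by
      intro m z
      induction z using BTensor.induction_on with
      | h0 => simp only [tmul_zero, map_zero]
      | ha x y hx hy => simp only [tmul_add, map_add, hx, hy]
      | ht n c => rfl
    induction t using BTensor.induction_on with
    | h0 => simp only [map_zero]
    | ha x y hx hy => simp only [map_add, hx, hy]
    | ht m n =>
      refine (e1 m (Q.rcoact n)).trans (Eq.trans ?_ (e2 m (Q.rcoact n)).symm)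
      rw [Q.rcoassoc]
  rcounit t := by
    have e : ∀ (m : M) (z : BTensor A₃ N C₃), rid A₃ (BTensor A₂ M N)
        (mapBi (BimodHom.id A₁ A₃ _) 𝓒₃.counit ((assoc A₂ A₃ M N C₃).symm (tmul A₂ m z))) =
        tmul A₂ m (rid A₃ N (mapBi (BimodHom.id A₂ A₃ N) 𝓒₃.counit z)) := by
      intro m z
      induction z using BTensor.induction_on with
      | h0 => simp only [tmul_zero, map_zero]
      | ha x y hx hy => simp only [tmul_add, map_add, hx, hy]
      | ht c m => rfl
    induction t using BTensor.induction_on with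
    | h0 => simp only [map_zero]
    | ha x y hx hy => simp only [map_add, hx, hy]
    | ht m n =>
      refine (e m (Q.rcoact n)).trans ?_
      rw [Q.rcounit]
  compat := tensorLeftCoact_tensorRightCoact P.lcoact Q.rcoact

/-- The two maps whose difference is `cotensorDiff` are left colinear, so their equalizer is stable
under the left coaction. -/
theorem mapBi_cotensorDiff_lcoact (P : Bicomod 𝓒₁ 𝓒₂ M) (Q : Bicomod 𝓒₂ 𝓒₃ N)
    (t : BTensor A₂ M N) :
    mapBi (BimodHom.id A₁ A₁ C₁) (cotensorDiff P.rcoact Q.lcoact)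
        (tensorLeftCoact (B' := A₃) N P.lcoact t) =
      tensorLeftCoact (B' := A₃) (BTensor A₂ C₂ N) P.lcoact
        (cotensorDiff P.rcoact Q.lcoact t) := by
  let f := (assocBi A₂ A₂ A₁ A₃ M C₂ N).comp (mapBi P.rcoact (BimodHom.id A₂ A₃ N))
  let g := mapBi (BimodHom.id A₁ A₂ M) Q.lcoact
  have hs : ∀ s, mapBi (BimodHom.id A₁ A₁ C₁) (cotensorDiff P.rcoact Q.lcoact) s =
      mapBi (BimodHom.id A₁ A₁ C₁) f s - mapBi (BimodHom.id A₁ A₁ C₁) g s := fun s =>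
    lT_sub f.left g.left s
  have e1 : ∀ (z : BTensor A₁ C₁ M) (n : N), mapBi (BimodHom.id A₁ A₁ C₁) f
      (assoc A₁ A₂ C₁ M N (tmul A₂ z n)) = mapBi (BimodHom.id A₁ A₁ C₁)
        (assocBi A₂ A₂ A₁ A₃ M C₂ N) (assoc A₁ A₂ C₁ (BTensor A₂ M C₂) N
          (tmul A₂ (mapBi (BimodHom.id A₁ A₁ C₁) P.rcoact z) n)) := by
    intro z n
    induction z using BTensor.induction_on with
    | h0 => simp only [zero_tmul, map_zero]
    | ha x y hx hy => simp only [add_tmul, map_add, hx, hy]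
    | ht c m => rfl
  have e2 : ∀ (y : BTensor A₂ M C₂) (n : N), tensorLeftCoact (B' := A₃) (BTensor A₂ C₂ N) P.lcoact
      (assoc A₂ A₂ M C₂ N (tmul A₂ y n)) = mapBi (BimodHom.id A₁ A₁ C₁)
        (assocBi A₂ A₂ A₁ A₃ M C₂ N) (assoc A₁ A₂ C₁ (BTensor A₂ M C₂) N
          (tmul A₂ (assoc A₁ A₂ C₁ M C₂ (mapBi P.lcoact (BimodHom.id A₂ A₂ C₂) y)) n)) := by
    intro y n
    induction y using BTensor.induction_on with
    | h0 => simp only [zero_tmul, map_zero]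
    | ha x y hx hy => simp only [add_tmul, map_add, hx, hy]
    | ht m c =>
      change assoc A₁ A₂ C₁ M (BTensor A₂ C₂ N) (tmul A₂ (P.lcoact m) (tmul A₂ c n)) =
        mapBi _ _ (assoc A₁ A₂ C₁ (BTensor A₂ M C₂) N
          (tmul A₂ (assoc A₁ A₂ C₁ M C₂ (tmul A₂ (P.lcoact m) c)) n))
      generalize P.lcoact m = z
      induction z using BTensor.induction_on with
      | h0 => simp only [zero_tmul, map_zero]
      | ha x y hx hy => simp only [add_tmul, map_add, hx, hy]
      | ht c' m => rfl
  have e3 : ∀ (z : BTensor A₁ C₁ M) (n : N), mapBi (BimodHom.id A₁ A₁ C₁) g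
      (assoc A₁ A₂ C₁ M N (tmul A₂ z n)) = assoc A₁ A₂ C₁ M _ (tmul A₂ z (Q.lcoact n)) := by
    intro z n
    induction z using BTensor.induction_on with
    | h0 => simp only [zero_tmul, map_zero]
    | ha x y hx hy => simp only [add_tmul, map_add, hx, hy]
    | ht c m => rfl
  have hfg : ∀ s, cotensorDiff P.rcoact Q.lcoact s = f s - g s := fun s => rfl
  rw [hs, hfg, map_sub]
  congr 1
  · induction t using BTensor.induction_on with
    | h0 => simp only [map_zero]
    | ha x y hx hy => simp only [map_add, hx, hy]
    | ht m n =>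
      refine (e1 (P.lcoact m) n).trans (Eq.trans ?_ (e2 (P.rcoact m) n).symm)
      rw [P.compat]
  · induction t using BTensor.induction_on with
    | h0 => simp only [map_zero]
    | ha x y hx hy => simp only [map_add, hx, hy]
    | ht m n => exact e3 (P.lcoact m) n

theorem mapBi_cotensorDiff_rcoact (P : Bicomod 𝓒₁ 𝓒₂ M) (Q : Bicomod 𝓒₂ 𝓒₃ N)
    (t : BTensor A₂ M N) :
    mapBi (cotensorDiff P.rcoact Q.lcoact) (BimodHom.id A₃ A₃ C₃)
        (tensorRightCoact (A := A₁) M Q.rcoact t) =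
      tensorRightCoact (A := A₁) M (tensorRightCoact (A := A₂) C₂ Q.rcoact)
        (cotensorDiff P.rcoact Q.lcoact t) := by
  let f := (assocBi A₂ A₂ A₁ A₃ M C₂ N).comp (mapBi P.rcoact (BimodHom.id A₂ A₃ N))
  let g := mapBi (BimodHom.id A₁ A₂ M) Q.lcoact
  have hs : ∀ s, mapBi (cotensorDiff P.rcoact Q.lcoact) (BimodHom.id A₃ A₃ C₃) s =
      mapBi f (BimodHom.id A₃ A₃ C₃) s - mapBi g (BimodHom.id A₃ A₃ C₃) s := fun s =>
    rT_sub f.right g.right s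
  have e1 : ∀ (m : M) (z : BTensor A₃ N C₃), mapBi f (BimodHom.id A₃ A₃ C₃)
      ((assoc A₂ A₃ M N C₃).symm (tmul A₂ m z)) = mapBi (assocBi A₂ A₂ A₁ A₃ M C₂ N)
        (BimodHom.id A₃ A₃ C₃) ((assoc A₂ A₃ (BTensor A₂ M C₂) N C₃).symm
          (tmul A₂ (P.rcoact m) z)) := by
    intro m z
    induction z using BTensor.induction_on with
    | h0 => simp only [tmul_zero, map_zero]
    | ha x y hx hy => simp only [tmul_add, map_add, hx, hy]
    | ht n c => rfl
  have e2 : ∀ (y : BTensor A₂ M C₂) (n : N),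
      tensorRightCoact (A := A₁) M (tensorRightCoact (A := A₂) C₂ Q.rcoact)
        (assoc A₂ A₂ M C₂ N (tmul A₂ y n)) = mapBi (assocBi A₂ A₂ A₁ A₃ M C₂ N)
        (BimodHom.id A₃ A₃ C₃) ((assoc A₂ A₃ (BTensor A₂ M C₂) N C₃).symm
          (tmul A₂ y (Q.rcoact n))) := by
    intro y n
    induction y using BTensor.induction_on with
    | h0 => simp only [zero_tmul, map_zero]
    | ha x y hx hy => simp only [add_tmul, map_add, hx, hy]
    | ht m c =>
      change (assoc A₂ A₃ M (BTensor A₂ C₂ N) C₃).symm (tmul A₂ m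
        ((assoc A₂ A₃ C₂ N C₃).symm (tmul A₂ c (Q.rcoact n)))) = _
      generalize Q.rcoact n = z
      induction z using BTensor.induction_on with
      | h0 => simp only [tmul_zero, map_zero]
      | ha x y hx hy => simp only [tmul_add, map_add, hx, hy]
      | ht c' m => rfl
  have e3 : ∀ (m : M) (z : BTensor A₃ N C₃), mapBi g (BimodHom.id A₃ A₃ C₃)
      ((assoc A₂ A₃ M N C₃).symm (tmul A₂ m z)) = (assoc A₂ A₃ M (BTensor A₂ C₂ N) C₃).symm
        (tmul A₂ m (mapBi Q.lcoact (BimodHom.id A₃ A₃ C₃) z)) := by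
    intro m z
    induction z using BTensor.induction_on with
    | h0 => simp only [tmul_zero, map_zero]
    | ha x y hx hy => simp only [tmul_add, map_add, hx, hy]
    | ht c m => rfl
  have hfg : ∀ s, cotensorDiff P.rcoact Q.lcoact s = f s - g s := fun s => rfl
  rw [hs, hfg, map_sub]
  congr 1
  · induction t using BTensor.induction_on with
    | h0 => simp only [map_zero]
    | ha x y hx hy => simp only [map_add, hx, hy]
    | ht m n => exact (e1 m (Q.rcoact n)).trans (e2 (P.rcoact m) n).symm
  · induction t using BTensor.induction_on with
    | h0 => simp only [map_zero]
    | ha x y hx hy => simp only [map_add, hx, hy]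
    | ht m n =>
      refine (e3 m (Q.rcoact n)).trans ?_
      change _ = (assoc A₂ A₃ M (BTensor A₂ C₂ N) C₃).symm (tmul A₂ m
        ((assoc A₂ A₃ C₂ N C₃).symm (mapBi (BimodHom.id A₂ A₂ C₂) Q.rcoact (Q.lcoact n))))
      rw [← Q.compat, AddEquiv.symm_apply_apply]

/-- A bimodule inside a bicomodule that both coactions respect is a bicomodule, provided that the
tensor products of the inclusion that occur in the axioms are still injective. -/
theorem exists_bicomod_of_injective {K Y : Type u}
    [AddCommGroup K] [Module A₁ K] [Module A₂ᵐᵒᵖ K] [SMulCommClass A₁ A₂ᵐᵒᵖ K]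
    [AddCommGroup Y] [Module A₁ Y] [Module A₂ᵐᵒᵖ Y] [SMulCommClass A₁ A₂ᵐᵒᵖ Y]
    (P : Bicomod 𝓒₁ 𝓒₂ Y) (i : BimodHom A₁ A₂ K Y) (hi : Function.Injective i)
    (hl : Function.Injective (mapBi (BimodHom.id A₁ A₁ C₁) i))
    (hll : Function.Injective (mapBi (BimodHom.id A₁ A₁ C₁) (mapBi (BimodHom.id A₁ A₁ C₁) i)))
    (hr : Function.Injective (mapBi i (BimodHom.id A₂ A₂ C₂)))
    (hrr : Function.Injective (mapBi i (BimodHom.id A₂ A₂ (BTensor A₂ C₂ C₂))))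
    (hlr : Function.Injective (mapBi (BimodHom.id A₁ A₁ C₁) (mapBi i (BimodHom.id A₂ A₂ C₂))))
    (hlc : ∀ x, ∃ z, mapBi (BimodHom.id A₁ A₁ C₁) i z = P.lcoact (i x))
    (hrc : ∀ x, ∃ z, mapBi i (BimodHom.id A₂ A₂ C₂) z = P.rcoact (i x)) :
    ∃ S : Bicomod 𝓒₁ 𝓒₂ K, IsBicolinear S.lcoact S.rcoact P.lcoact P.rcoact i := by
  obtain ⟨l, hl'⟩ := BimodHom.exists_lift hl (P.lcoact.comp i) hlc
  obtain ⟨r, hr'⟩ := BimodHom.exists_lift hr (P.rcoact.comp i) hrc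
  have hlE : (mapBi (BimodHom.id A₁ A₁ C₁) i).comp l = P.lcoact.comp i := BimodHom.ext hl'
  have hrE : (mapBi i (BimodHom.id A₂ A₂ C₂)).comp r = P.rcoact.comp i := BimodHom.ext hr'
  have hl2 : ∀ x, mapBi (BimodHom.id A₁ A₁ C₁) i (l x) = P.lcoact (i x) := hl'
  have hr2 : ∀ x, mapBi i (BimodHom.id A₂ A₂ C₂) (r x) = P.rcoact (i x) := hr'
  refine ⟨⟨fun c x => hi ?_, l, r, fun x => hll ?_, fun x => hi ?_, fun x => hrr ?_,
    fun x => hi ?_, fun x => hlr ?_⟩, hl', hr'⟩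
  · rw [i.map_lsmul, i.map_rsmul, P.central]
  · rw [← assoc_mapBi, mapBi_id_id, ← mapBi_swap, hl2, P.lcoassoc, mapBi_id_comp, hlE,
      ← mapBi_id_comp, hl2]
  · have h : i (lid A₁ K (mapBi 𝓒₁.counit (BimodHom.id A₁ A₂ K) (l x))) =
        lid A₁ Y (mapBi 𝓒₁.counit (BimodHom.id A₁ A₂ Y) (mapBi (BimodHom.id A₁ A₁ C₁) i (l x))) :=
      DFunLike.congr_fun
        (f := i.add.comp ((lid A₁ K).comp (mapBi 𝓒₁.counit (BimodHom.id A₁ A₂ K)).add))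
        (g := (lid A₁ Y).comp ((mapBi 𝓒₁.counit (BimodHom.id A₁ A₂ Y)).add.comp
          (mapBi (BimodHom.id A₁ A₁ C₁) i).add))
        (hom_ext fun c y => i.map_lsmul (𝓒₁.counit c) y) (l x)
    rw [h, hl2, P.lcounit]
  · rw [mapBi_swap, ← mapBi_id_id, ← assoc_mapBi, mapBi_comp_id, hrE, ← mapBi_comp_id, hr2,
      P.rcoassoc]
  · have h : i (rid A₂ K (mapBi (BimodHom.id A₁ A₂ K) 𝓒₂.counit (r x))) =
        rid A₂ Y (mapBi (BimodHom.id A₁ A₂ Y) 𝓒₂.counit (mapBi i (BimodHom.id A₂ A₂ C₂) (r x))) :=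
      DFunLike.congr_fun
        (f := i.add.comp ((rid A₂ K).comp (mapBi (BimodHom.id A₁ A₂ K) 𝓒₂.counit).add))
        (g := (rid A₂ Y).comp ((mapBi (BimodHom.id A₁ A₂ Y) 𝓒₂.counit).add.comp
          (mapBi i (BimodHom.id A₂ A₂ C₂)).add))
        (hom_ext fun y c => i.map_rsmul (op (𝓒₂.counit c)) y) (r x)
    rw [h, hr2, P.rcounit]
  · rw [← assoc_mapBi, mapBi_comp_id, hlE, ← mapBi_comp_id, hr2, P.compat, mapBi_id_comp, hrE,
      ← mapBi_id_comp, hl2]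

theorem Bicomod.ext' {K : Type u}
    [AddCommGroup K] [Module A₁ K] [Module A₂ᵐᵒᵖ K] [SMulCommClass A₁ A₂ᵐᵒᵖ K]
    {S T : Bicomod 𝓒₁ 𝓒₂ K} (hl : S.lcoact = T.lcoact) (hr : S.rcoact = T.rcoact) : S = T := by
  cases S; cases T; cases hl; cases hr; rfl

namespace Cotensor

/-- The induced bicomodule structure on `M □ N` exists and is unique. -/
theorem exists_induced (hC : LeftFlat A₃ C₃) (P : Bicomod 𝓒₁ 𝓒₂ M) (Q : Bicomod 𝓒₂ 𝓒₃ N)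
    (h : ∀ (W : Type u) [AddCommGroup W] [Module A₁ᵐᵒᵖ W], LPres W P Q) :
    ∃ S, IsInduced P Q S ∧ ∀ S', IsInduced P Q S' ↔ S' = S := by
  have hl : Function.Injective (mapBi (BimodHom.id A₁ A₁ C₁) (incl P Q)) := (h C₁).1
  have hR := rPres_of_leftFlat hC P Q
  have hr : Function.Injective (mapBi (incl P Q) (BimodHom.id A₃ A₃ C₃)) := hR.1
  have hll := injective_mapBi_id_mapBi_id (R := A₁) (A := A₁) (B := A₁) (E := A₃) (M := C₁)
    (N := C₁) (i := incl P Q) (h (BTensor A₁ C₁ C₁)).1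
  have hlr := injective_mapBi_id_mapBi (R := A₁) (A := A₁) (B := A₃) (E := A₃) (M := C₁)
    (P := C₃) (i := incl P Q) (hC _ _ (mapBi (BimodHom.id A₁ A₁ C₁) (incl P Q)).right hl)
  obtain ⟨S, hS⟩ := exists_bicomod_of_injective (tensorBicomod P Q) (incl P Q)
    (incl_injective P Q) hl hll hr (hC.bTensor hC _ _ _ (incl_injective P Q)) hlr
    (fun x => ((h C₁).2 _).1 (by
      refine (mapBi_cotensorDiff_lcoact P Q (incl P Q x)).trans ?_
      rw [((exact_incl P Q) _).2 ⟨x, rfl⟩, map_zero]))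
    (fun x => (hR.2 _).1 (by
      refine (mapBi_cotensorDiff_rcoact P Q (incl P Q x)).trans ?_
      rw [((exact_incl P Q) _).2 ⟨x, rfl⟩, map_zero]))
  refine ⟨S, hS, fun S' => ⟨fun h' => ?_, fun h' => h' ▸ hS⟩⟩
  exact Bicomod.ext' (BimodHom.ext fun x => hl ((h'.1 x).trans (hS.1 x).symm))
    (BimodHom.ext fun x => hr ((h'.2 x).trans (hS.2 x).symm))

end Cotensor

end TensorBicomod

/-! ### Associativity of the cotensor product -/

section Assoc

variable {A₁ A₂ A₃ A₄ C₂ C₃ L M N : Type*} [Ring A₁] [Ring A₂] [Ring A₃] [Ring A₄]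
  [AddCommGroup C₂] [Module A₂ C₂] [Module A₂ᵐᵒᵖ C₂] [SMulCommClass A₂ A₂ᵐᵒᵖ C₂]
  [AddCommGroup C₃] [Module A₃ C₃] [Module A₃ᵐᵒᵖ C₃] [SMulCommClass A₃ A₃ᵐᵒᵖ C₃]
  [AddCommGroup L] [Module A₁ L] [Module A₂ᵐᵒᵖ L] [SMulCommClass A₁ A₂ᵐᵒᵖ L]
  [AddCommGroup M] [Module A₂ M] [Module A₃ᵐᵒᵖ M] [SMulCommClass A₂ A₃ᵐᵒᵖ M]
  [AddCommGroup N] [Module A₃ N] [Module A₄ᵐᵒᵖ N] [SMulCommClass A₃ A₄ᵐᵒᵖ N]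

/-- The cotensor product of `L` with `M ⊗ N`, inside `(L ⊗ M) ⊗ N`. -/
theorem mapBi_cotensorDiff_eq_zero_iff (ρ : BimodHom A₁ A₂ L (BTensor A₂ L C₂))
    (l : BimodHom A₂ A₃ M (BTensor A₂ C₂ M)) (t : BTensor A₃ (BTensor A₂ L M) N) :
    mapBi (cotensorDiff ρ l) (BimodHom.id A₃ A₄ N) t = 0 ↔
      assoc A₂ A₂ L C₂ (BTensor A₃ M N)
        (mapBi ρ (BimodHom.id A₂ A₄ _) (assoc A₂ A₃ L M N t)) =
      mapBi (BimodHom.id A₁ A₂ L) (tensorLeftCoact (B' := A₄) N l) (assoc A₂ A₃ L M N t) := by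
  let f := (assocBi A₂ A₂ A₁ A₃ L C₂ M).comp (mapBi ρ (BimodHom.id A₂ A₃ M))
  let g := mapBi (BimodHom.id A₁ A₂ L) l
  let E := (mapBi (BimodHom.id A₁ A₂ L) (assocBi A₂ A₃ A₂ A₄ C₂ M N)).comp
    (assocBi A₂ A₃ A₁ A₄ L (BTensor A₂ C₂ M) N)
  have hE : Function.Injective E := by
    have h1 : Function.LeftInverse
        (mapBi (BimodHom.id A₁ A₂ L) (assocBiSymm A₂ A₃ A₂ A₄ C₂ M N))
        (mapBi (BimodHom.id A₁ A₂ L) (assocBi A₂ A₃ A₂ A₄ C₂ M N)) := fun t => by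
      rw [mapBi_id_comp, show (assocBiSymm A₂ A₃ A₂ A₄ C₂ M N).comp (assocBi A₂ A₃ A₂ A₄ C₂ M N) =
        BimodHom.id _ _ _ from BimodHom.ext fun x => (assoc A₂ A₃ C₂ M N).symm_apply_apply x]
      exact mapBi_id t
    exact h1.injective.comp (assoc A₂ A₃ L (BTensor A₂ C₂ M) N).injective
  have h1 : E (mapBi f (BimodHom.id A₃ A₄ N) t) = assoc A₂ A₂ L C₂ (BTensor A₃ M N)
      (mapBi ρ (BimodHom.id A₂ A₄ _) (assoc A₂ A₃ L M N t)) := by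
    refine DFunLike.congr_fun (f := E.add.comp (mapBi f (BimodHom.id A₃ A₄ N)).add)
      (g := (assoc A₂ A₂ L C₂ (BTensor A₃ M N)).toAddMonoidHom.comp
        ((mapBi ρ (BimodHom.id A₂ A₄ _)).add.comp (assoc A₂ A₃ L M N).toAddMonoidHom))
      (hom_ext₂ fun l m n => ?_) t
    change E (tmul A₃ (assoc A₂ A₂ L C₂ M (tmul A₂ (ρ l) m)) n) =
      assoc A₂ A₂ L C₂ (BTensor A₃ M N) (tmul A₂ (ρ l) (tmul A₃ m n))
    generalize ρ l = y
    induction y using BTensor.induction_on with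
    | h0 => simp only [zero_tmul, map_zero]
    | ha x y hx hy => simp only [add_tmul, map_add, hx, hy]
    | ht m c => rfl
  have h2 : E (mapBi g (BimodHom.id A₃ A₄ N) t) =
      mapBi (BimodHom.id A₁ A₂ L) (tensorLeftCoact (B' := A₄) N l) (assoc A₂ A₃ L M N t) :=
    DFunLike.congr_fun (f := E.add.comp (mapBi g (BimodHom.id A₃ A₄ N)).add)
      (g := (mapBi (BimodHom.id A₁ A₂ L) (tensorLeftCoact (B' := A₄) N l)).add.comp
        (assoc A₂ A₃ L M N).toAddMonoidHom)
      (hom_ext₂ fun l m n => rfl) t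
  have h3 : mapBi (cotensorDiff ρ l) (BimodHom.id A₃ A₄ N) t =
      mapBi f (BimodHom.id A₃ A₄ N) t - mapBi g (BimodHom.id A₃ A₄ N) t :=
    rT_sub f.right g.right t
  rw [h3, sub_eq_zero, ← hE.eq_iff, h1, h2]

theorem mapBi_tensorRightCoact {L' : Type*} [AddCommGroup L'] [Module A₁ L'] [Module A₂ᵐᵒᵖ L']
    [SMulCommClass A₁ A₂ᵐᵒᵖ L'] (g : BimodHom A₁ A₂ L L') (r : BimodHom A₂ A₃ M (BTensor A₃ M C₃))
    (t : BTensor A₂ L M) :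
    mapBi (mapBi g (BimodHom.id A₂ A₃ M)) (BimodHom.id A₃ A₃ C₃)
      (tensorRightCoact (A := A₁) L r t) =
    tensorRightCoact (A := A₁) L' r (mapBi g (BimodHom.id A₂ A₃ M) t) := by
  change mapBi _ _ ((assoc A₂ A₃ L M C₃).symm (mapBi _ _ t)) =
    (assoc A₂ A₃ L' M C₃).symm (mapBi _ _ (mapBi _ _ t))
  rw [← assoc_symm_mapBi, mapBi_id_id, mapBi_swap]

theorem mapBi_tensorRightCoact_right {M' : Type*} [AddCommGroup M'] [Module A₂ M']
    [Module A₃ᵐᵒᵖ M'] [SMulCommClass A₂ A₃ᵐᵒᵖ M'] (g : BimodHom A₂ A₃ M M')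
    (r : BimodHom A₂ A₃ M (BTensor A₃ M C₃)) (r' : BimodHom A₂ A₃ M' (BTensor A₃ M' C₃))
    (hg : IsRightColinear r.right r'.right g.right) (t : BTensor A₂ L M) :
    mapBi (mapBi (BimodHom.id A₁ A₂ L) g) (BimodHom.id A₃ A₃ C₃)
      (tensorRightCoact (A := A₁) L r t) =
    tensorRightCoact (A := A₁) L r' (mapBi (BimodHom.id A₁ A₂ L) g t) := by
  change mapBi _ _ ((assoc A₂ A₃ L M C₃).symm (mapBi _ _ t)) =
    (assoc A₂ A₃ L M' C₃).symm (mapBi _ _ (mapBi _ _ t))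
  rw [← assoc_symm_mapBi, mapBi_id_comp, mapBi_id_comp,
    show (mapBi g (BimodHom.id A₃ A₃ C₃)).comp r = r'.comp g from BimodHom.ext hg]

theorem mapBi_assocBi_tensorRightCoact {C₄ : Type*} [AddCommGroup C₄] [Module A₄ C₄]
    [Module A₄ᵐᵒᵖ C₄] [SMulCommClass A₄ A₄ᵐᵒᵖ C₄] (r : BimodHom A₃ A₄ N (BTensor A₄ N C₄))
    (t : BTensor A₃ (BTensor A₂ L M) N) :
    mapBi (assocBi A₂ A₃ A₁ A₄ L M N) (BimodHom.id A₄ A₄ C₄)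
      (tensorRightCoact (A := A₁) (BTensor A₂ L M) r t) =
    tensorRightCoact (A := A₁) L (tensorRightCoact (A := A₂) M r) (assoc A₂ A₃ L M N t) := by
  refine DFunLike.congr_fun
    (f := (mapBi (assocBi A₂ A₃ A₁ A₄ L M N) (BimodHom.id A₄ A₄ C₄)).add.comp
      (tensorRightCoact (A := A₁) (BTensor A₂ L M) r).add)
    (g := (tensorRightCoact (A := A₁) L (tensorRightCoact (A := A₂) M r)).add.comp
      (assoc A₂ A₃ L M N).toAddMonoidHom) (hom_ext₂ fun l m n => ?_) t
  change mapBi _ _ ((assoc A₃ A₄ (BTensor A₂ L M) N C₄).symm (tmul A₃ (tmul A₂ l m) (r n))) =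
    (assoc A₂ A₄ L (BTensor A₃ M N) C₄).symm (tmul A₂ l
      ((assoc A₃ A₄ M N C₄).symm (tmul A₃ m (r n))))
  generalize r n = y
  induction y using BTensor.induction_on with
  | h0 => simp only [tmul_zero, map_zero]
  | ha x y hx hy => simp only [tmul_add, map_add, hx, hy]
  | ht m c => rfl

theorem BTensor.RExact.comp_bijective {A K K' Y Z V : Type*} [Ring A]
    [AddCommGroup V] [Module A V] [AddCommGroup K] [Module Aᵐᵒᵖ K]
    [AddCommGroup K'] [Module Aᵐᵒᵖ K'] [AddCommGroup Y] [Module Aᵐᵒᵖ Y]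
    [AddCommGroup Z] [Module Aᵐᵒᵖ Z] {i : K →ₗ[Aᵐᵒᵖ] Y} {d : Y →ₗ[Aᵐᵒᵖ] Z}
    (h : RExact V i d) (e : K' →ₗ[Aᵐᵒᵖ] K) (he : Function.Bijective e) :
    RExact V (i ∘ₗ e) d := by
  let e' := LinearEquiv.ofBijective e he
  have h1 : ∀ t, rT V e'.symm.toLinearMap (rT V e t) = t := fun t => by
    rw [rT_rT, show e'.symm.toLinearMap ∘ₗ e = LinearMap.id from
      LinearMap.ext fun x => e'.symm_apply_apply x]
    exact rT_id t
  have h2 : ∀ t, rT V (i ∘ₗ e) t = rT V i (rT V e t) := fun t => (rT_rT _ _ _).symm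
  refine ⟨fun s t hst => ?_, fun t => ?_⟩
  · rw [h2, h2] at hst
    have := h.1 hst
    rw [← h1 s, this, h1]
  · rw [h.2 t]
    constructor
    · rintro ⟨s, rfl⟩
      obtain ⟨r, rfl⟩ := map_surjective (g := (LinearMap.id : V →ₗ[A] V)) he.2
        Function.surjective_id s
      exact ⟨r, h2 r⟩
    · rintro ⟨s, rfl⟩
      exact ⟨_, (h2 s).symm⟩

end Assoc

section Pair

variable {k : Type v} [CommRing k] {A₁ A₂ A₃ A₄ C₁ C₂ C₃ C₄ L M N : Type u}
  [Ring A₁] [Algebra k A₁] [Ring A₂] [Algebra k A₂] [Ring A₃] [Algebra k A₃]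
  [Ring A₄] [Algebra k A₄]
  [AddCommGroup C₁] [Module A₁ C₁] [Module A₁ᵐᵒᵖ C₁] [SMulCommClass A₁ A₁ᵐᵒᵖ C₁]
  [AddCommGroup C₂] [Module A₂ C₂] [Module A₂ᵐᵒᵖ C₂] [SMulCommClass A₂ A₂ᵐᵒᵖ C₂]
  [AddCommGroup C₃] [Module A₃ C₃] [Module A₃ᵐᵒᵖ C₃] [SMulCommClass A₃ A₃ᵐᵒᵖ C₃]
  [AddCommGroup C₄] [Module A₄ C₄] [Module A₄ᵐᵒᵖ C₄] [SMulCommClass A₄ A₄ᵐᵒᵖ C₄]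
  {𝓒₁ : Coring k A₁ C₁} {𝓒₂ : Coring k A₂ C₂} {𝓒₃ : Coring k A₃ C₃} {𝓒₄ : Coring k A₄ C₄}
  [AddCommGroup L] [Module A₁ L] [Module A₂ᵐᵒᵖ L] [SMulCommClass A₁ A₂ᵐᵒᵖ L]
  [AddCommGroup M] [Module A₂ M] [Module A₃ᵐᵒᵖ M] [SMulCommClass A₂ A₃ᵐᵒᵖ M]
  [AddCommGroup N] [Module A₃ N] [Module A₄ᵐᵒᵖ N] [SMulCommClass A₃ A₄ᵐᵒᵖ N]

namespace Cotensor

/-- The associativity isomorphism `L □ K₂ ≃ K₁ □ N`, where `K₁` and `K₂` are copies of the cotensor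
products `L □ M` and `M □ N`. If enough tensor functors preserve these kernels, then both sides are
the intersection, inside `L ⊗ (M ⊗ N)`, of the two kernels. -/
theorem exists_addEquiv (P : Bicomod 𝓒₁ 𝓒₂ L) (Q : Bicomod 𝓒₂ 𝓒₃ M) (R : Bicomod 𝓒₃ 𝓒₄ N)
    {K₁ K₂ : Type u}
    [AddCommGroup K₁] [Module A₁ K₁] [Module A₃ᵐᵒᵖ K₁] [SMulCommClass A₁ A₃ᵐᵒᵖ K₁]
    [AddCommGroup K₂] [Module A₂ K₂] [Module A₄ᵐᵒᵖ K₂] [SMulCommClass A₂ A₄ᵐᵒᵖ K₂]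
    (i₁ : BimodHom A₁ A₃ K₁ (BTensor A₂ L M)) (ρ₁ : BimodHom A₁ A₃ K₁ (BTensor A₃ K₁ C₃))
    (hρ : IsRightColinear ρ₁.right (tensorRightCoact (A := A₁) L Q.rcoact).right i₁.right)
    (i₂ : BimodHom A₂ A₄ K₂ (BTensor A₃ M N)) (l₂ : BimodHom A₂ A₄ K₂ (BTensor A₂ C₂ K₂))
    (hl : IsLeftColinear l₂.left (tensorLeftCoact (B' := A₄) N Q.lcoact).left i₂.left)
    (h₁ : RExact N i₁.right (cotensorDiff P.rcoact Q.lcoact).right)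
    (h₁' : Function.Injective (rT (BTensor A₃ C₃ N) i₁.right))
    (h₂ : LExact L i₂.left (cotensorDiff Q.rcoact R.lcoact).left)
    (h₂' : Function.Injective (lT (BTensor A₂ L C₂) i₂.left)) :
    ∃ α : cotensorSubgroup P.rcoact.right l₂.left ≃+ cotensorSubgroup ρ₁.right R.lcoact.left,
      ∀ t, assoc A₂ A₃ L M N (mapBi i₁ (BimodHom.id A₃ A₄ N) (α t : BTensor A₃ K₁ N)) =
        mapBi (BimodHom.id A₁ A₂ L) i₂ (t : BTensor A₂ L K₂) := by
  have hρE : (mapBi i₁ (BimodHom.id A₃ A₃ C₃)).comp ρ₁ =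
    (tensorRightCoact (A := A₁) L Q.rcoact).comp i₁ := BimodHom.ext hρ
  have hlE : (mapBi (BimodHom.id A₂ A₂ C₂) i₂).comp l₂ =
    (tensorLeftCoact (B' := A₄) N Q.lcoact).comp i₂ := BimodHom.ext hl
  -- the two cotensor products, in terms of conditions in `L ⊗ (M ⊗ N)`
  have c₂ : ∀ t, t ∈ cotensorSubgroup P.rcoact.right l₂.left ↔
      mapBi (cotensorDiff P.rcoact Q.lcoact) (BimodHom.id A₃ A₄ N)
        ((assoc A₂ A₃ L M N).symm (mapBi (BimodHom.id A₁ A₂ L) i₂ t)) = 0 := fun t => by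
    have hinj := injective_mapBi_id_mapBi_id (R := A₁) (M := L) (N := C₂) (i := i₂) h₂'
    rw [mapBi_cotensorDiff_eq_zero_iff, AddEquiv.apply_symm_apply, mapBi_swap, mapBi_id_comp,
      ← hlE, ← mapBi_id_comp, ← mapBi_id_id, assoc_mapBi, hinj.eq_iff]
    exact mem_cotensorSubgroup
  have c₁ : ∀ s, s ∈ cotensorSubgroup ρ₁.right R.lcoact.left ↔
      mapBi (BimodHom.id A₁ A₂ L) (cotensorDiff Q.rcoact R.lcoact)
        (assoc A₂ A₃ L M N (mapBi i₁ (BimodHom.id A₃ A₄ N) s)) = 0 := fun s => by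
    have hinj : Function.Injective (mapBi i₁ (BimodHom.id A₃ A₄ (BTensor A₃ C₃ N))) := h₁'
    refine Iff.trans ?_ (mem_cotensorSubgroup_tensorRightComod (W := L) Q R _)
    rw [mem_cotensorSubgroup, mem_cotensorSubgroup]
    change assoc A₃ A₃ K₁ C₃ N (mapBi ρ₁ (BimodHom.id A₃ A₄ N) s) =
      mapBi (BimodHom.id A₁ A₃ K₁) R.lcoact s ↔
      assoc A₃ A₃ (BTensor A₂ L M) C₃ N (mapBi (tensorRightCoact (A := A₁) L Q.rcoact)
        (BimodHom.id A₃ A₄ N) (mapBi i₁ (BimodHom.id A₃ A₄ N) s)) =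
      mapBi (BimodHom.id A₁ A₃ _) R.lcoact (mapBi i₁ (BimodHom.id A₃ A₄ N) s)
    rw [mapBi_comp_id, ← hρE, ← mapBi_comp_id, assoc_mapBi, mapBi_id_id, ← mapBi_swap,
      hinj.eq_iff]
  let E₁ : cotensorSubgroup ρ₁.right R.lcoact.left →+ BTensor A₂ L (BTensor A₃ M N) :=
    (assoc A₂ A₃ L M N).toAddMonoidHom.comp
      ((mapBi i₁ (BimodHom.id A₃ A₄ N)).add.comp (AddSubgroup.subtype _))
  let E₂ : cotensorSubgroup P.rcoact.right l₂.left →+ BTensor A₂ L (BTensor A₃ M N) :=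
    (mapBi (BimodHom.id A₁ A₂ L) i₂).add.comp (AddSubgroup.subtype _)
  have hE₁ : Function.Injective E₁ :=
    (assoc A₂ A₃ L M N).injective.comp (h₁.1.comp Subtype.val_injective)
  have hE₂ : Function.Injective E₂ := h₂.1.comp Subtype.val_injective
  have hrange : E₂.range = E₁.range := by
    ext u
    constructor
    · rintro ⟨t, rfl⟩
      obtain ⟨s, hs⟩ := (h₁.2 _).1 ((c₂ t).1 t.2)
      have hs' : assoc A₂ A₃ L M N (mapBi i₁ (BimodHom.id A₃ A₄ N) s) = E₂ t :=
        (AddEquiv.eq_symm_apply _).1 hs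
      exact ⟨⟨s, (c₁ s).2 (by rw [hs']; exact (h₂.2 _).2 ⟨t, rfl⟩)⟩, hs'⟩
    · rintro ⟨s, rfl⟩
      obtain ⟨t, ht⟩ := (h₂.2 _).1 ((c₁ s).1 s.2)
      have ht' : mapBi (BimodHom.id A₁ A₂ L) i₂ t = E₁ s := ht
      refine ⟨⟨t, (c₂ t).2 ?_⟩, ht'⟩
      rw [ht']
      change mapBi _ _ ((assoc A₂ A₃ L M N).symm (assoc A₂ A₃ L M N _)) = 0
      rw [AddEquiv.symm_apply_apply]
      exact (h₁.2 _).2 ⟨s, rfl⟩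
  refine ⟨(AddMonoidHom.ofInjective hE₂).trans ((AddEquiv.addSubgroupCongr hrange).trans
    (AddMonoidHom.ofInjective hE₁).symm), fun t => ?_⟩
  exact congrArg Subtype.val ((AddMonoidHom.ofInjective hE₁).apply_symm_apply
    ((AddEquiv.addSubgroupCongr hrange) (AddMonoidHom.ofInjective hE₂ t)))

/-- The associativity isomorphism `L □ (M □ N) ≃ (L □ M) □ N`. -/
theorem exists_isAssoc {P : Bicomod 𝓒₁ 𝓒₂ L} {Q : Bicomod 𝓒₂ 𝓒₃ M} {R : Bicomod 𝓒₃ 𝓒₄ N}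
    {S : Bicomod 𝓒₁ 𝓒₃ (Cotensor P Q)} {T : Bicomod 𝓒₂ 𝓒₄ (Cotensor Q R)}
    (hS : IsInduced P Q S) (hT : IsInduced Q R T) (h₁ : RPres N P Q)
    (h₁' : RPres (BTensor A₃ C₃ N) P Q) (h₂ : LPres L Q R) (h₂' : LPres (BTensor A₂ L C₂) Q R) :
    ∃ α : Cotensor P T ≃+ Cotensor S R, ∀ α', IsAssoc S T α' ↔ α' = α := by
  obtain ⟨α, hα⟩ := exists_addEquiv P Q R (incl P Q) S.rcoact hS.2 (incl Q R) T.lcoact hT.1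
    h₁ h₁'.1 h₂ h₂'.1
  refine ⟨α, fun α' => ⟨fun h => ?_, fun h => h ▸ hα⟩⟩
  ext t
  exact incl_injective S R (h₁.1 ((assoc A₂ A₃ L M N).injective ((h t).trans (hα t).symm)))

/-- `W ⊗ -` preserves the kernel `K □ M ↪ K ⊗ M` that defines the cotensor product, for all
`𝓒₁`-`𝓒₂`-bicomodules `K` and all right modules `W`. -/
def LPreserving (𝓒₁ : Coring k A₁ C₁) (Q : Bicomod 𝓒₂ 𝓒₃ M) : Prop :=
  ∀ (K : Type u) [AddCommGroup K] [Module A₁ K] [Module A₂ᵐᵒᵖ K] [SMulCommClass A₁ A₂ᵐᵒᵖ K]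
    (P : Bicomod 𝓒₁ 𝓒₂ K) (W : Type u) [AddCommGroup W] [Module A₁ᵐᵒᵖ W], LPres W P Q

/-- The isomorphism `L □ ((M □ L) □ M) ≃ (L □ M) □ (L □ M)`. Both sides are identified with
`((L □ M) □ L) □ M`, by `exists_addEquiv`; for the left-hand side, `(L □ M) □ L` plays the role of
`L □ (M □ L)` by means of `α`. -/
theorem exists_isMiddleAssoc {M : Type u} [AddCommGroup M] [Module A₂ M] [Module A₁ᵐᵒᵖ M]
    [SMulCommClass A₂ A₁ᵐᵒᵖ M] {P : Bicomod 𝓒₁ 𝓒₂ L} {Q : Bicomod 𝓒₂ 𝓒₁ M}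
    {S : Bicomod 𝓒₂ 𝓒₂ (Cotensor Q P)} {T : Bicomod 𝓒₁ 𝓒₁ (Cotensor P Q)}
    {U : Bicomod 𝓒₂ 𝓒₁ (Cotensor S Q)}
    (hS : IsInduced Q P S) (hT : IsInduced P Q T) (hU : IsInduced S Q U)
    (α : Cotensor P S ≃+ Cotensor T P) (hα : IsAssoc T S α) (hC : LeftFlat A₂ C₂)
    (hP₁ : LPreserving 𝓒₁ P) (hP₂ : LPreserving 𝓒₂ P) (hQ₁ : LPreserving 𝓒₁ Q)
    (hQ₂ : LPreserving 𝓒₂ Q)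
    (h₁ : RPres M P S) (h₁' : RPres (BTensor A₂ C₂ M) P S)
    (h₂ : RPres M T P) (h₂' : RPres (BTensor A₂ C₂ M) T P) (h₃ : RPres (BTensor A₂ L M) P Q) :
    ∃ γ : Cotensor P U ≃+ Cotensor T T, ∀ γ', IsMiddleAssoc S T U γ' ↔ γ' = γ := by
  obtain ⟨V, hV, -⟩ := exists_induced hC T P (fun W => hP₁ _ T W)
  -- the inclusion `j` of `L ⊗ (M □ L)` in `L ⊗ (M ⊗ L)`
  set j := mapBi (BimodHom.id A₁ A₂ L) (incl Q P) with hj_def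
  have hj : Function.Injective j := (hP₂ _ Q L).1
  obtain ⟨e, he⟩ := BimodHom.exists_lift (j := j.comp (incl P S))
    (hj.comp (incl_injective P S)) ((assocBi A₂ A₁ A₁ A₂ L M L).comp
      ((mapBi (incl P Q) (BimodHom.id A₁ A₂ L)).comp (incl T P)))
    (fun t => ⟨α.symm t, by
      have := hα (α.symm t)
      rw [AddEquiv.apply_symm_apply] at this
      exact this.symm⟩)
  have heα : ∀ t, e (α t) = t := fun t =>
    incl_injective P S (hj ((he (α t)).trans (hα t)))
  have hebij : Function.Bijective e := by
    refine ⟨fun s t hst => ?_, fun t => ⟨α t, heα t⟩⟩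
    rw [← α.apply_symm_apply s, ← α.apply_symm_apply t, heα, heα] at hst
    exact α.symm.injective hst
  set i := (incl P S).comp e with hi_def
  have hji : j.comp i = (assocBi A₂ A₁ A₁ A₂ L M L).comp
      ((mapBi (incl P Q) (BimodHom.id A₁ A₂ L)).comp (incl T P)) := BimodHom.ext he
  have hcol : IsRightColinear V.rcoact.right (tensorRightCoact (A := A₁) L S.rcoact).right
      i.right := by
    intro t
    have hinj : Function.Injective (mapBi j (BimodHom.id A₂ A₂ C₂)) := hC _ _ j.right hj
    apply hinj
    change mapBi j _ (mapBi i (BimodHom.id A₂ A₂ C₂) (V.rcoact t)) =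
      mapBi j _ (tensorRightCoact (A := A₁) L S.rcoact (i t))
    have h1 : mapBi (incl T P) (BimodHom.id A₂ A₂ C₂) (V.rcoact t) =
      tensorRightCoact (A := A₁) _ P.rcoact (incl T P t) := hV.2 t
    have h2 : j (i t) = assoc A₂ A₁ L M L
      (mapBi (incl P Q) (BimodHom.id A₁ A₂ L) (incl T P t)) := he t
    rw [mapBi_tensorRightCoact_right (incl Q P) S.rcoact _ hS.2, mapBi_comp_id, hji,
      ← mapBi_comp_id, ← mapBi_comp_id, h1, mapBi_tensorRightCoact,
      mapBi_assocBi_tensorRightCoact, ← h2]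
  obtain ⟨γ₁, hγ₁⟩ := exists_addEquiv P S Q i V.rcoact hcol (incl S Q) U.lcoact hU.1
    (h₁.comp_bijective e.right hebij) (h₁'.comp_bijective e.right hebij).1
    (hQ₂ _ S L) (hQ₂ _ S _).1
  obtain ⟨γ₂, hγ₂⟩ := exists_addEquiv T P Q (incl T P) V.rcoact hV.2 (incl P Q) T.lcoact hT.1
    h₂ h₂'.1 (hQ₁ _ P _) (hQ₁ _ P _).1
  let γ : Cotensor P U ≃+ Cotensor T T := γ₁.trans γ₂.symm
  have hγ : IsMiddleAssoc S T U γ := by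
    intro w
    have e1 : assoc A₂ A₂ L _ M (mapBi i (BimodHom.id A₂ A₁ M) (γ₁ w : BTensor A₂ _ M)) =
      mapBi (BimodHom.id A₁ A₂ L) (incl S Q) (incl P U w) := hγ₁ w
    have e2 : assoc A₁ A₂ _ L M (mapBi (incl T P) (BimodHom.id A₂ A₁ M)
        (γ₁ w : BTensor A₂ _ M)) =
        mapBi (BimodHom.id A₁ A₁ _) (incl P Q) (incl T T (γ w)) := by
      have := hγ₂ (γ₂.symm (γ₁ w))
      rw [AddEquiv.apply_symm_apply] at this
      exact this
    generalize (γ₁ w : BTensor A₂ (Cotensor T P) M) = u at e1 e2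
    have e4 : mapBi (incl P Q) (BimodHom.id A₁ A₁ (BTensor A₂ L M))
        (assoc A₁ A₂ _ L M (mapBi (incl T P) (BimodHom.id A₂ A₁ M) u)) =
        assoc A₁ A₂ _ L M (mapBi (mapBi (incl P Q) (BimodHom.id A₁ A₂ L)) (BimodHom.id A₂ A₁ M)
          (mapBi (incl T P) (BimodHom.id A₂ A₁ M) u)) := by
      rw [assoc_mapBi, mapBi_id_id]
    have e5 : mapBi (BimodHom.id A₁ A₂ L) (mapBi (incl Q P) (BimodHom.id A₂ A₁ M))
        (assoc A₂ A₂ L _ M (mapBi i (BimodHom.id A₂ A₁ M) u)) =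
        assoc A₂ A₂ L _ M (mapBi (assocBi A₂ A₁ A₁ A₂ L M L) (BimodHom.id A₂ A₁ M)
          (mapBi (mapBi (incl P Q) (BimodHom.id A₁ A₂ L)) (BimodHom.id A₂ A₁ M)
          (mapBi (incl T P) (BimodHom.id A₂ A₁ M) u))) := by
      have hji' : (mapBi (BimodHom.id A₁ A₂ L) (incl Q P)).comp i =
        ((assocBi A₂ A₁ A₁ A₂ L M L).comp (mapBi (incl P Q) (BimodHom.id A₁ A₂ L))).comp
          (incl T P) := hji
      rw [← assoc_mapBi, mapBi_comp_id, mapBi_comp_id, mapBi_comp_id, hji']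
    rw [mapBi_eq_comp, ← e2, e4, pentagon (R := A₁) (F := A₁), ← mapBi_id_comp, ← mapBi_id_comp,
      ← e1, e5]
  refine ⟨γ, fun γ' => ⟨fun h => ?_, fun h => h ▸ hγ⟩⟩
  ext w
  apply incl_injective T T
  have hi₁ : Function.Injective (mapBi (BimodHom.id A₁ A₁ _) (incl P Q)) :=
    (hQ₁ _ P (Cotensor P Q)).1
  have hi₂ : Function.Injective (mapBi (incl P Q) (BimodHom.id A₁ A₁ (BTensor A₂ L M))) := h₃.1
  apply hi₁
  apply hi₂
  rw [mapBi_mapBi, mapBi_mapBi]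
  exact (assoc A₂ A₁ L M (BTensor A₂ L M)).injective ((h w).trans (hγ w).symm)

end Cotensor

end Pair

/-! ### Bicolinear maps into cotensor products -/

section Colinear

variable {A B C D M N Y : Type*} [Ring A] [Ring B]
  [AddCommGroup C] [Module A C] [Module Aᵐᵒᵖ C] [SMulCommClass A Aᵐᵒᵖ C]
  [AddCommGroup D] [Module B D] [Module Bᵐᵒᵖ D] [SMulCommClass B Bᵐᵒᵖ D]
  [AddCommGroup M] [Module A M] [Module Bᵐᵒᵖ M] [SMulCommClass A Bᵐᵒᵖ M]
  [AddCommGroup N] [Module A N] [Module Bᵐᵒᵖ N] [SMulCommClass A Bᵐᵒᵖ N]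
  [AddCommGroup Y] [Module A Y] [Module Bᵐᵒᵖ Y] [SMulCommClass A Bᵐᵒᵖ Y]
  {lM : BimodHom A B M (BTensor A C M)} {rM : BimodHom A B M (BTensor B M D)}
  {lN : BimodHom A B N (BTensor A C N)} {rN : BimodHom A B N (BTensor B N D)}
  {lY : BimodHom A B Y (BTensor A C Y)} {rY : BimodHom A B Y (BTensor B Y D)}

theorem IsBicolinear.comp {j : BimodHom A B N Y} {f : BimodHom A B M N}
    (hj : IsBicolinear lN rN lY rY j) (hf : IsBicolinear lM rM lN rN f) :
    IsBicolinear lM rM lY rY (j.comp f) := by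
  refine ⟨fun m => ?_, fun m => ?_⟩
  · have h1 : mapBi (BimodHom.id A A C) f (lM m) = lN (f m) := hf.1 m
    have h2 : mapBi (BimodHom.id A A C) j (lN (f m)) = lY (j (f m)) := hj.1 (f m)
    rw [← h1, mapBi_id_comp] at h2
    exact h2
  · have h1 : mapBi f (BimodHom.id B B D) (rM m) = rN (f m) := hf.2 m
    have h2 : mapBi j (BimodHom.id B B D) (rN (f m)) = rY (j (f m)) := hj.2 (f m)
    rw [← h1, mapBi_comp_id] at h2
    exact h2

/-- If `j ∘ f` and `j` are bicolinear, then so is `f`, provided that `C ⊗ j` and `j ⊗ D` are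
injective. -/
theorem IsBicolinear.of_comp {j : BimodHom A B N Y} {f : BimodHom A B M N}
    (hj : IsBicolinear lN rN lY rY j)
    (hl : Function.Injective (mapBi (BimodHom.id A A C) j))
    (hr : Function.Injective (mapBi j (BimodHom.id B B D)))
    (hf : IsBicolinear lM rM lY rY (j.comp f)) : IsBicolinear lM rM lN rN f := by
  refine ⟨fun m => hl ?_, fun m => hr ?_⟩
  · change mapBi _ _ (mapBi (BimodHom.id A A C) f (lM m)) = _
    rw [mapBi_id_comp]
    exact (hf.1 m).trans (hj.1 (f m)).symm
  · change mapBi _ _ (mapBi f (BimodHom.id B B D) (rM m)) = _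
    rw [mapBi_comp_id]
    exact (hf.2 m).trans (hj.2 (f m)).symm

end Colinear

section TensorColinear

variable {A B E C D M M' N : Type*} [Ring A] [Ring B] [Ring E]
  [AddCommGroup C] [Module A C] [Module Aᵐᵒᵖ C] [SMulCommClass A Aᵐᵒᵖ C]
  [AddCommGroup D] [Module E D] [Module Eᵐᵒᵖ D] [SMulCommClass E Eᵐᵒᵖ D]
  [AddCommGroup M] [Module A M] [Module Bᵐᵒᵖ M] [SMulCommClass A Bᵐᵒᵖ M]
  [AddCommGroup M'] [Module A M'] [Module Bᵐᵒᵖ M'] [SMulCommClass A Bᵐᵒᵖ M']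
  [AddCommGroup N] [Module B N] [Module Eᵐᵒᵖ N] [SMulCommClass B Eᵐᵒᵖ N]

theorem isBicolinear_mapBi_id {g : BimodHom A B M M'} {l : BimodHom A B M (BTensor A C M)}
    {l' : BimodHom A B M' (BTensor A C M')} (hg : IsLeftColinear l.left l'.left g.left)
    (r : BimodHom B E N (BTensor E N D)) :
    IsBicolinear (tensorLeftCoact (B' := E) N l) (tensorRightCoact (A := A) M r)
      (tensorLeftCoact (B' := E) N l') (tensorRightCoact (A := A) M' r)
      (mapBi g (BimodHom.id B E N)) := by
  refine ⟨fun t => ?_, fun t => mapBi_tensorRightCoact g r t⟩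
  change mapBi (BimodHom.id A A C) (mapBi g (BimodHom.id B E N))
      (assoc A B C M N (mapBi l (BimodHom.id B E N) t)) =
    assoc A B C M' N (mapBi l' (BimodHom.id B E N) (mapBi g (BimodHom.id B E N) t))
  rw [← assoc_mapBi, mapBi_comp_id, mapBi_comp_id,
    show (mapBi (BimodHom.id A A C) g).comp l = l'.comp g from BimodHom.ext hg]

end TensorColinear

section Pair

variable {k : Type v} [CommRing k] {A B C D X : Type u}
  [Ring A] [Algebra k A] [Ring B] [Algebra k B]
  [AddCommGroup C] [Module A C] [Module Aᵐᵒᵖ C] [SMulCommClass A Aᵐᵒᵖ C]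
  [AddCommGroup D] [Module B D] [Module Bᵐᵒᵖ D] [SMulCommClass B Bᵐᵒᵖ D]
  [AddCommGroup X] [Module A X] [Module Bᵐᵒᵖ X] [SMulCommClass A Bᵐᵒᵖ X]
  {𝓒 : Coring k A C} {𝓓 : Coring k B D}

namespace Cotensor

/-- The coaction `X → C □ X` is bijective: its inverse is `ε ⊗ X`. -/
theorem coactLeft_bijective (𝓧 : Bicomod 𝓒 𝓓 X) : Function.Bijective (coactLeft 𝓧) := by
  have hincl : ∀ x, incl 𝓒.self 𝓧 (coactLeft 𝓧 x) = 𝓧.lcoact x := fun _ => rfl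
  refine ⟨fun x y hxy => ?_, fun s => ?_⟩
  · have := congrArg (incl 𝓒.self 𝓧) hxy
    rw [hincl, hincl] at this
    rw [← 𝓧.lcounit x, this, 𝓧.lcounit]
  · let e (t : BTensor A C X) : X := lid A X (mapBi 𝓒.counit (BimodHom.id A B X) t)
    refine ⟨e (incl 𝓒.self 𝓧 s), incl_injective _ _ ?_⟩
    have h1 : ∀ t, 𝓧.lcoact (e t) = lid A (BTensor A C X) (mapBi 𝓒.counit (BimodHom.id A B _)
        (mapBi (BimodHom.id A A C) 𝓧.lcoact t)) := fun t =>
      DFunLike.congr_fun (f := 𝓧.lcoact.add.comp ((lid A X).comp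
          (mapBi 𝓒.counit (BimodHom.id A B X)).add))
        (g := (lid A (BTensor A C X)).comp ((mapBi 𝓒.counit (BimodHom.id A B _)).add.comp
          (mapBi (BimodHom.id A A C) 𝓧.lcoact).add))
        (hom_ext fun c x => 𝓧.lcoact.map_lsmul (𝓒.counit c) x) t
    have h2 : ∀ t, lid A (BTensor A C X) (mapBi 𝓒.counit (BimodHom.id A B _)
        (assoc A A C C X (mapBi 𝓒.comul (BimodHom.id A B X) t))) = t := fun t => by
      induction t using BTensor.induction_on with
      | h0 => simp only [map_zero]
      | ha x y hx hy => simp only [map_add, hx, hy]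
      | ht c x =>
        have h3 : ∀ y : BTensor A C C, lid A (BTensor A C X) (mapBi 𝓒.counit (BimodHom.id A B _)
            (assoc A A C C X (tmul A y x))) =
            tmul A (lid A C (mapBi 𝓒.counit (BimodHom.id A A C) y)) x := fun y => by
          induction y using BTensor.induction_on with
          | h0 => simp only [zero_tmul, map_zero]
          | ha x y hx hy => simp only [add_tmul, map_add, hx, hy]
          | ht c c' => rfl
        refine (h3 (𝓒.comul c)).trans ?_
        rw [𝓒.counit_left]
    rw [hincl, h1, ← incl_balanced]
    exact h2 _

theorem isBicolinear_coactLeft {𝓧 : Bicomod 𝓒 𝓓 X} {V : Bicomod 𝓒 𝓓 (Cotensor 𝓒.self 𝓧)}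
    (hV : IsInduced 𝓒.self 𝓧 V) (hD : LeftFlat B D) (hX : LPres C 𝓒.self 𝓧) :
    IsBicolinear 𝓧.lcoact 𝓧.rcoact V.lcoact V.rcoact (coactLeft 𝓧) := by
  refine IsBicolinear.of_comp hV hX.1 (hD _ _ _ (incl_injective 𝓒.self 𝓧))
    ⟨fun x => ?_, fun x => ?_⟩
  · exact (𝓧.lcoassoc x).symm
  · exact (AddEquiv.eq_symm_apply _).2 (𝓧.compat x)

theorem isBicolinear_mapLeft {M M' : Type u} [AddCommGroup M] [Module A M] [Module Aᵐᵒᵖ M]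
    [SMulCommClass A Aᵐᵒᵖ M] [AddCommGroup M'] [Module A M'] [Module Aᵐᵒᵖ M']
    [SMulCommClass A Aᵐᵒᵖ M'] {P : Bicomod 𝓒 𝓒 M} {P' : Bicomod 𝓒 𝓒 M'} {𝓧 : Bicomod 𝓒 𝓓 X}
    {V : Bicomod 𝓒 𝓓 (Cotensor P 𝓧)} {U : Bicomod 𝓒 𝓓 (Cotensor P' 𝓧)}
    (hV : IsInduced P 𝓧 V) (hU : IsInduced P' 𝓧 U) (f : BicomodHom P P')
    (hD : LeftFlat B D) (hX : LPres C P' 𝓧) :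
    IsBicolinear V.lcoact V.rcoact U.lcoact U.rcoact (mapLeft f 𝓧) := by
  have h := IsBicolinear.comp (isBicolinear_mapBi_id f.bicolinear.1 𝓧.rcoact) hV
  exact IsBicolinear.of_comp hU hX.1 (hD _ _ _ (incl_injective P' 𝓧)) h

end Cotensor

end Pair

/-! ### The comultiplication of `L □ X` -/

section Comul

variable {A B C X L : Type*} [Ring A] [Ring B]
  [AddCommGroup C] [Module A C] [Module Aᵐᵒᵖ C] [SMulCommClass A Aᵐᵒᵖ C]
  [AddCommGroup X] [Module A X] [Module Bᵐᵒᵖ X] [SMulCommClass A Bᵐᵒᵖ X]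
  [AddCommGroup L] [Module B L] [Module Aᵐᵒᵖ L] [SMulCommClass B Aᵐᵒᵖ L]

/-- `L → (L ⊗ X) ⊗ L`, `l ↦ l₀ ⊗ Ψ(l₁)`, for `Ψ : C → X ⊗ L`. -/
def leftInsert (Ψ : BimodHom A A C (BTensor B X L)) (ρ : BimodHom B A L (BTensor A L C)) :
    BimodHom B A L (BTensor B (BTensor A L X) L) :=
  ((assocBiSymm A B B A L X L).comp (mapBi (BimodHom.id B A L) Ψ)).comp ρ

/-- `X → X ⊗ (L ⊗ X)`, `x ↦ Ψ(x₋₁) ⊗ x₀`, for `Ψ : C → X ⊗ L`. -/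
def rightInsert (Ψ : BimodHom A A C (BTensor B X L)) (l : BimodHom A B X (BTensor A C X)) :
    BimodHom A B X (BTensor B X (BTensor A L X)) :=
  ((assocBi B A A B X L X).comp (mapBi Ψ (BimodHom.id A B X))).comp l

/-- On the cotensor product, `l ⊗ x ↦ l₀ ⊗ Ψ(l₁) ⊗ x` and `l ⊗ x ↦ l ⊗ Ψ(x₋₁) ⊗ x₀` agree. -/
theorem tensorLeftCoact_leftInsert (Ψ : BimodHom A A C (BTensor B X L))
    (ρ : BimodHom B A L (BTensor A L C)) (l : BimodHom A B X (BTensor A C X))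
    (t : BTensor A L X) (ht : assoc A A L C X (mapBi ρ (BimodHom.id A B X) t) =
      mapBi (BimodHom.id B A L) l t) :
    tensorLeftCoact (B' := B) X (leftInsert Ψ ρ) t =
      tensorRightCoact (A := B) L (rightInsert Ψ l) t := by
  let F : BTensor A L (BTensor A C X) →+ BTensor B (BTensor A L X) (BTensor A L X) :=
    (assocBiSymm A B B B L X (BTensor A L X)).add.comp
      (mapBi (BimodHom.id B A L) ((assocBi B A A B X L X).comp (mapBi Ψ (BimodHom.id A B X)))).add
  have h1 : ∀ s, assoc B A (BTensor A L X) L X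
      (mapBi ((assocBiSymm A B B A L X L).comp (mapBi (BimodHom.id B A L) Ψ))
        (BimodHom.id A B X) s) = F (assoc A A L C X s) := fun s => by
    refine DFunLike.congr_fun (f := (assoc B A (BTensor A L X) L X).toAddMonoidHom.comp
      (mapBi ((assocBiSymm A B B A L X L).comp (mapBi (BimodHom.id B A L) Ψ))
        (BimodHom.id A B X)).add) (g := F.comp (assoc A A L C X).toAddMonoidHom)
      (hom_ext₂ fun l c x => ?_) s
    change assoc B A (BTensor A L X) L X (tmul A ((assoc A B L X L).symm (tmul A l (Ψ c))) x) =
      (assoc A B L X (BTensor A L X)).symm (tmul A l (assoc B A X L X (tmul A (Ψ c) x)))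
    generalize Ψ c = y
    induction y using BTensor.induction_on with
    | h0 => simp only [zero_tmul, tmul_zero, map_zero]
    | ha x y hx hy => simp only [add_tmul, tmul_add, map_add, hx, hy]
    | ht x l => rfl
  have h2 : tensorLeftCoact (B' := B) X (leftInsert Ψ ρ) t =
      F (assoc A A L C X (mapBi ρ (BimodHom.id A B X) t)) := by
    rw [← h1, mapBi_comp_id]; rfl
  have h3 : tensorRightCoact (A := B) L (rightInsert Ψ l) t =
      F (mapBi (BimodHom.id B A L) l t) := by
    change _ = assocBiSymm A B B B L X (BTensor A L X) (mapBi _ _ (mapBi _ _ t))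
    rw [mapBi_id_comp]; rfl
  rw [h2, h3, ht]

end Comul

section Counit

variable {A B K K' X L : Type*} [Ring A] [Ring B]
  [AddCommGroup K] [Module B K] [Module Bᵐᵒᵖ K] [SMulCommClass B Bᵐᵒᵖ K]
  [AddCommGroup K'] [Module B K'] [Module Bᵐᵒᵖ K'] [SMulCommClass B Bᵐᵒᵖ K']
  [AddCommGroup X] [Module A X] [Module Bᵐᵒᵖ X] [SMulCommClass A Bᵐᵒᵖ X]
  [AddCommGroup L] [Module B L] [Module Aᵐᵒᵖ L] [SMulCommClass B Aᵐᵒᵖ L]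

theorem mapBi_tensorLeftCoact (i : BimodHom B B K K') (θ : BimodHom B A L (BTensor B K L))
    (t : BTensor A L X) :
    mapBi i (BimodHom.id B B (BTensor A L X)) (tensorLeftCoact (B' := B) X θ t) =
      assoc B A K' L X (mapBi ((mapBi i (BimodHom.id B A L)).comp θ) (BimodHom.id A B X) t) := by
  rw [← mapBi_comp_id, assoc_mapBi, mapBi_id_id]; rfl

theorem mapBi_tensorRightCoact_left (i : BimodHom B B K K') (θ : BimodHom A B X (BTensor B X K))
    (t : BTensor A L X) :
    mapBi (BimodHom.id B B (BTensor A L X)) i (tensorRightCoact (A := B) L θ t) =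
      (assoc A B L X K').symm
        (mapBi (BimodHom.id B A L) ((mapBi (BimodHom.id A B X) i).comp θ) t) := by
  rw [← mapBi_id_comp, assoc_symm_mapBi, mapBi_id_id]; rfl

theorem lid_tensorLeftCoact {e : BimodHom B B K B} {θ : BimodHom B A L (BTensor B K L)}
    (h : ∀ l, lid B L (mapBi e (BimodHom.id B A L) (θ l)) = l) (t : BTensor A L X) :
    lid B (BTensor A L X) (mapBi e (BimodHom.id B B _) (tensorLeftCoact (B' := B) X θ t)) = t := by
  induction t using BTensor.induction_on with
  | h0 => simp only [map_zero]
  | ha x y hx hy => simp only [map_add, hx, hy]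
  | ht l x =>
    have h1 : ∀ y : BTensor B K L, lid B (BTensor A L X) (mapBi e (BimodHom.id B B _)
        (assoc B A K L X (tmul A y x))) =
        tmul A (lid B L (mapBi e (BimodHom.id B A L) y)) x := fun y => by
      induction y using BTensor.induction_on with
      | h0 => simp only [zero_tmul, map_zero]
      | ha x y hx hy => simp only [add_tmul, map_add, hx, hy]
      | ht c c' => rfl
    refine (h1 (θ l)).trans ?_
    rw [h]

theorem rid_tensorRightCoact {e : BimodHom B B K B} {θ : BimodHom A B X (BTensor B X K)}
    (h : ∀ x, rid B X (mapBi (BimodHom.id A B X) e (θ x)) = x) (t : BTensor A L X) :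
    rid B (BTensor A L X) (mapBi (BimodHom.id B B _) e (tensorRightCoact (A := B) L θ t)) = t := by
  induction t using BTensor.induction_on with
  | h0 => simp only [map_zero]
  | ha x y hx hy => simp only [map_add, hx, hy]
  | ht l x =>
    have h1 : ∀ y : BTensor B X K, rid B (BTensor A L X) (mapBi (BimodHom.id B B _) e
        ((assoc A B L X K).symm (tmul A l y))) =
        tmul A l (rid B X (mapBi (BimodHom.id A B X) e y)) := fun y => by
      induction y using BTensor.induction_on with
      | h0 => simp only [tmul_zero, map_zero]
      | ha x y hx hy => simp only [tmul_add, map_add, hx, hy]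
      | ht c c' => rfl
    refine (h1 (θ x)).trans ?_
    rw [h]

end Counit

/-! ### The coring axioms -/

section Coring

variable {k : Type*} {A B K X L : Type*} [CommRing k] [Ring A] [Ring B] [Algebra k B]
  [AddCommGroup K] [Module B K] [Module Bᵐᵒᵖ K] [SMulCommClass B Bᵐᵒᵖ K]
  [AddCommGroup X] [Module A X] [Module Bᵐᵒᵖ X] [SMulCommClass A Bᵐᵒᵖ X]
  [AddCommGroup L] [Module B L] [Module Aᵐᵒᵖ L] [SMulCommClass B Aᵐᵒᵖ L]

/-- A coring inside `L ⊗ X`. The comultiplication is the restriction of both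
`Θ ⊗ X : L ⊗ X → (L ⊗ X) ⊗ (L ⊗ X)` and `L ⊗ Θ'`; coassociativity holds because these two maps
commute. The counit axioms follow from those of the lifts `θ` and `θ'` of `Θ` and `Θ'`. -/
theorem exists_coring {i : BimodHom B B K (BTensor A L X)} (hK : IsCentral k B B K)
    (hi : Function.Injective i) (hiii : Function.Injective (mapBi i (mapBi i i)))
    (hl : Function.Injective (mapBi i (BimodHom.id B B (BTensor A L X))))
    (hr : Function.Injective (mapBi (BimodHom.id B B (BTensor A L X)) i))
    {Θ : BimodHom B A L (BTensor B (BTensor A L X) L)}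
    {Θ' : BimodHom A B X (BTensor B X (BTensor A L X))}
    (hΘ : ∀ u, tensorLeftCoact (B' := B) X Θ (i u) = tensorRightCoact (A := B) L Θ' (i u))
    (Δ : BimodHom B B K (BTensor B K K))
    (hΔ : ∀ u, mapBi i i (Δ u) = tensorRightCoact (A := B) L Θ' (i u))
    (e : BimodHom B B K B)
    {θ : BimodHom B A L (BTensor B K L)} (hθ : ∀ l, mapBi i (BimodHom.id B A L) (θ l) = Θ l)
    {θ' : BimodHom A B X (BTensor B X K)} (hθ' : ∀ x, mapBi (BimodHom.id A B X) i (θ' x) = Θ' x)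
    (heθ : ∀ l, lid B L (mapBi e (BimodHom.id B A L) (θ l)) = l)
    (heθ' : ∀ x, rid B X (mapBi (BimodHom.id A B X) e (θ' x)) = x) :
    ∃ E : Coring k B K, E.comul = Δ ∧ E.counit = e := by
  have hθE : (mapBi i (BimodHom.id B A L)).comp θ = Θ := BimodHom.ext hθ
  have hθE' : (mapBi (BimodHom.id A B X) i).comp θ' = Θ' := BimodHom.ext hθ'
  have hΔE : (mapBi i i).comp Δ = (tensorRightCoact (A := B) L Θ').comp i := BimodHom.ext hΔ
  have hΔE' : (mapBi i i).comp Δ = (tensorLeftCoact (B' := B) X Θ).comp i :=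
    BimodHom.ext fun u => (hΔ u).trans (hΘ u).symm
  have e1 : ∀ u, mapBi (BimodHom.id B B K) i (Δ u) = tensorLeftCoact (B' := B) X θ (i u) :=
    fun u => hl (by
      rw [← mapBi_eq_comp, hΔ, ← hΘ, mapBi_tensorLeftCoact, hθE]; rfl)
  have e2 : ∀ u, mapBi i (BimodHom.id B B K) (Δ u) = tensorRightCoact (A := B) L θ' (i u) :=
    fun u => hr (by
      rw [← mapBi_swap, ← mapBi_eq_comp, hΔ, mapBi_tensorRightCoact_left, hθE']; rfl)
  refine ⟨{ central := hK, comul := Δ, counit := e, coassoc := fun u => hiii ?_,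
            counit_left := fun u => hi ?_, counit_right := fun u => hi ?_ }, rfl, rfl⟩
  · rw [← assoc_mapBi, mapBi_mapBi, hΔE', mapBi_mapBi]
    have h1 : mapBi ((tensorLeftCoact (B' := B) X Θ).comp i) (i.comp (BimodHom.id B B K)) (Δ u) =
        mapBi (tensorLeftCoact (B' := B) X Θ) (BimodHom.id B B (BTensor A L X))
          (mapBi i i (Δ u)) :=
      (mapBi_mapBi (tensorLeftCoact (B' := B) X Θ) (BimodHom.id B B (BTensor A L X)) i i
        (Δ u)).symm
    have h2 : mapBi (i.comp (BimodHom.id B B K)) ((mapBi i i).comp Δ) (Δ u) =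
        mapBi (BimodHom.id B B (BTensor A L X)) (tensorRightCoact (A := B) L Θ')
          (mapBi i i (Δ u)) := by
      rw [hΔE]
      exact (mapBi_mapBi (BimodHom.id B B (BTensor A L X)) (tensorRightCoact (A := B) L Θ') i i
        (Δ u)).symm
    rw [h1, h2, hΔ, tensorLeftCoact_tensorRightCoact, hΘ]
  · have h1 : ∀ t, i (lid B K (mapBi e (BimodHom.id B B K) t)) =
        lid B (BTensor A L X) (mapBi e (BimodHom.id B B _) (mapBi (BimodHom.id B B K) i t)) :=
      fun t => DFunLike.congr_fun
        (f := i.add.comp ((lid B K).comp (mapBi e (BimodHom.id B B K)).add))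
        (g := (lid B (BTensor A L X)).comp ((mapBi e (BimodHom.id B B _)).add.comp
          (mapBi (BimodHom.id B B K) i).add)) (hom_ext fun c u => i.map_lsmul (e c) u) t
    rw [h1, e1, lid_tensorLeftCoact heθ]
  · have h1 : ∀ t, i (rid B K (mapBi (BimodHom.id B B K) e t)) =
        rid B (BTensor A L X) (mapBi (BimodHom.id B B _) e (mapBi i (BimodHom.id B B K) t)) :=
      fun t => DFunLike.congr_fun
        (f := i.add.comp ((rid B K).comp (mapBi (BimodHom.id B B K) e).add))
        (g := (rid B (BTensor A L X)).comp ((mapBi (BimodHom.id B B _) e).add.comp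
          (mapBi i (BimodHom.id B B K)).add)) (hom_ext fun u c => i.map_rsmul (op (e c)) u) t
    rw [h1, e2, rid_tensorRightCoact heθ']

end Coring

section Pair

variable {k : Type v} [CommRing k] {A B C D X L : Type u}
  [Ring A] [Algebra k A] [Ring B] [Algebra k B]
  [AddCommGroup C] [Module A C] [Module Aᵐᵒᵖ C] [SMulCommClass A Aᵐᵒᵖ C]
  [AddCommGroup D] [Module B D] [Module Bᵐᵒᵖ D] [SMulCommClass B Bᵐᵒᵖ D]
  [AddCommGroup X] [Module A X] [Module Bᵐᵒᵖ X] [SMulCommClass A Bᵐᵒᵖ X]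
  [AddCommGroup L] [Module B L] [Module Aᵐᵒᵖ L] [SMulCommClass B Aᵐᵒᵖ L]
  {𝓒 : Coring k A C} {𝓓 : Coring k B D} {𝓧 : Bicomod 𝓒 𝓓 X} {𝓛 : Bicomod 𝓓 𝓒 L}

namespace Cotensor

theorem rPres_of_leftFlat_or_isCoseparable {V : Type u} [AddCommGroup V] [Module B V]
    (h : LeftFlat B V ∨ 𝓒.IsCoseparable) {E K M : Type u} [Ring E] [Algebra k E] [AddCommGroup K]
    [Module E K] [Module Eᵐᵒᵖ K] [SMulCommClass E Eᵐᵒᵖ K] {𝓔 : Coring k E K} [AddCommGroup M]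
    [Module E M] [Module Aᵐᵒᵖ M] [SMulCommClass E Aᵐᵒᵖ M] (P : Bicomod 𝓔 𝓒 M)
    (Q : Bicomod 𝓒 𝓓 X) : RPres V P Q :=
  h.elim (fun h => rPres_of_leftFlat h P Q) fun h => rPres_of_isCoseparable h V P Q

/-- `(L □ X) ⊗ ((L □ X) ⊗ (L □ X))` embeds in the same tensor product of `L ⊗ X`. -/
theorem injective_mapBi_incl_mapBi_incl_incl
    (h : LeftFlat B (BTensor A L X) ∨ 𝓒.IsCoseparable)
    (h₁ : LPres (Cotensor 𝓛 𝓧) 𝓛 𝓧)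
    (h₂ : LPres (BTensor B (Cotensor 𝓛 𝓧) (Cotensor 𝓛 𝓧)) 𝓛 𝓧) :
    Function.Injective (mapBi (incl 𝓛 𝓧) (mapBi (incl 𝓛 𝓧) (incl 𝓛 𝓧))) := by
  rcases h with h | h
  · have i₁ : Function.Injective
        (mapBi (BimodHom.id B B (Cotensor 𝓛 𝓧)) (mapBi (BimodHom.id B B _) (incl 𝓛 𝓧))) :=
      injective_mapBi_id_mapBi_id h₂.1
    have i₂ : Function.Injective
        (mapBi (BimodHom.id B B (Cotensor 𝓛 𝓧)) (mapBi (incl 𝓛 𝓧)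
          (BimodHom.id B B (BTensor A L X)))) :=
      injective_mapBi_id_mapBi (h _ _ (mapBi (BimodHom.id B B _) (incl 𝓛 𝓧)).right h₁.1)
    have i₃ : Function.Injective (mapBi (incl 𝓛 𝓧)
        (BimodHom.id B B (BTensor B (BTensor A L X) (BTensor A L X)))) :=
      (h.bTensor h) _ _ (incl 𝓛 𝓧).right (incl_injective 𝓛 𝓧)
    intro s t hst
    rw [mapBi_eq_comp _ _ s, mapBi_eq_comp _ _ t] at hst
    have e : (mapBi (incl 𝓛 𝓧) (incl 𝓛 𝓧)) = (mapBi (incl 𝓛 𝓧) (BimodHom.id B B _)).comp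
      (mapBi (BimodHom.id B B _) (incl 𝓛 𝓧)) := BimodHom.ext fun t => mapBi_eq_comp _ _ t
    have hst' := i₃ hst
    rw [e, ← mapBi_id_comp, ← mapBi_id_comp] at hst'
    exact i₁ (i₂ hst')
  · obtain ⟨ζ, hζ, hc⟩ := h.exists_retraction 𝓧
    obtain ⟨p, -, hp, -⟩ := split_of_retraction 𝓛 𝓧 ζ hζ hc
    have hpE : p.comp (incl 𝓛 𝓧) = BimodHom.id B B _ := BimodHom.ext hp
    have e : (mapBi p p).comp (mapBi (incl 𝓛 𝓧) (incl 𝓛 𝓧)) = BimodHom.id B B _ :=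
      BimodHom.ext fun t => by
        refine (mapBi_mapBi p p (incl 𝓛 𝓧) (incl 𝓛 𝓧) t).trans ?_
        rw [hpE]
        exact mapBi_id t
    refine Function.LeftInverse.injective (g := mapBi p (mapBi p p)) fun t => ?_
    refine (mapBi_mapBi p (mapBi p p) (incl 𝓛 𝓧) (mapBi (incl 𝓛 𝓧) (incl 𝓛 𝓧)) t).trans ?_
    rw [hpE, e]
    exact mapBi_id t

variable {S : Bicomod 𝓒 𝓒 (Cotensor 𝓧 𝓛)} {T : Bicomod 𝓓 𝓓 (Cotensor 𝓛 𝓧)}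
  {V : Bicomod 𝓒 𝓓 (Cotensor 𝓒.self 𝓧)} {U : Bicomod 𝓒 𝓓 (Cotensor S 𝓧)}

/-- The composite `L ≃ L □ C → L □ (X □ L) ≃ (L □ X) □ L ↪ (L □ X) ⊗ L` is a lift of
`leftInsert` along `L □ X ↪ L ⊗ X`. -/
theorem IsAssoc.mapRight_coactRight {α : Cotensor 𝓛 S ≃+ Cotensor T 𝓛} (hα : IsAssoc T S α)
    (ψ : BicomodHom 𝓒.self S) (l : L) :
    mapBi (incl 𝓛 𝓧) (BimodHom.id B A L) (incl T 𝓛 (α (mapRight 𝓛 ψ (coactRight 𝓛 l)))) =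
      leftInsert ((incl 𝓧 𝓛).comp ψ.toHom) 𝓛.rcoact l := by
  refine ((assoc A B L X L).eq_symm_apply.2 (hα _)).trans (congrArg (assoc A B L X L).symm ?_)
  exact mapBi_id_comp (incl 𝓧 𝓛) ψ.toHom (𝓛.rcoact l)

/-- The composite `X ≃ C □ X → (X □ L) □ X ≃ X □ (L □ X) ↪ X ⊗ (L □ X)` is a lift of
`rightInsert` along `L □ X ↪ L ⊗ X`. -/
theorem IsAssoc.symm_mapLeft_coactLeft {β : Cotensor 𝓧 T ≃+ Cotensor S 𝓧} (hβ : IsAssoc S T β)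
    (ψ : BicomodHom 𝓒.self S) (x : X) :
    mapBi (BimodHom.id A B X) (incl 𝓛 𝓧)
        (incl 𝓧 T (β.symm (mapLeft ψ 𝓧 (coactLeft 𝓧 x)))) =
      rightInsert ((incl 𝓧 𝓛).comp ψ.toHom) 𝓧.lcoact x := by
  refine (hβ _).symm.trans ?_
  rw [AddEquiv.apply_symm_apply]
  exact congrArg (assoc B A X L X) (mapBi_comp_id (incl 𝓧 𝓛) ψ.toHom (𝓧.lcoact x))

/-- The comultiplication of `L □ X` is the restriction of `l ⊗ x ↦ l ⊗ Ψ(x₋₁) ⊗ x₀`. -/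
theorem IsMiddleAssoc.mapRight_mapRight {γ : Cotensor 𝓛 U ≃+ Cotensor T T}
    (hγ : IsMiddleAssoc S T U γ) (ψ : BicomodHom 𝓒.self S) {ξ : BicomodHom 𝓧 V}
    {χ : BicomodHom V U} (hξ : ξ.toHom = coactLeft 𝓧) (hχ : χ.toHom = mapLeft ψ 𝓧)
    (u : Cotensor 𝓛 𝓧) :
    mapBi (incl 𝓛 𝓧) (incl 𝓛 𝓧) (incl T T (γ (mapRight 𝓛 χ (mapRight 𝓛 ξ u)))) =
      tensorRightCoact (A := B) L (rightInsert ((incl 𝓧 𝓛).comp ψ.toHom) 𝓧.lcoact)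
        (incl 𝓛 𝓧 u) := by
  refine ((assoc A B L X (BTensor A L X)).eq_symm_apply.2 (hγ _)).trans
    (congrArg (assoc A B L X (BTensor A L X)).symm ?_)
  have h1 : incl 𝓛 U (mapRight 𝓛 χ (mapRight 𝓛 ξ u)) =
      mapBi (BimodHom.id B A L) χ.toHom (mapBi (BimodHom.id B A L) ξ.toHom (incl 𝓛 𝓧 u)) := rfl
  rw [h1, hξ, hχ, mapBi_id_comp, mapBi_id_comp]
  refine DFunLike.congr_fun (congrArg (mapBi (BimodHom.id B A L)) (BimodHom.ext fun x => ?_)) _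
  exact congrArg (assoc B A X L X) (mapBi_comp_id (incl 𝓧 𝓛) ψ.toHom (𝓧.lcoact x))

end Cotensor

end Pair

end GenComatrix

/-! ### The three sufficient conditions and the coring `L □ X` -/

open GenComatrix BTensor in
theorem theorem2p1 {k : Type v} [CommRing k] {A B C D X L : Type u}
    [Ring A] [Algebra k A] [Ring B] [Algebra k B]
    [AddCommGroup C] [Module A C] [Module Aᵐᵒᵖ C] [SMulCommClass A Aᵐᵒᵖ C]
    [AddCommGroup D] [Module B D] [Module Bᵐᵒᵖ D] [SMulCommClass B Bᵐᵒᵖ D]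
    [AddCommGroup X] [Module A X] [Module Bᵐᵒᵖ X] [SMulCommClass A Bᵐᵒᵖ X]
    [AddCommGroup L] [Module B L] [Module Aᵐᵒᵖ L] [SMulCommClass B Aᵐᵒᵖ L]
    (𝓒 : GenComatrix.Coring k A C) (𝓓 : GenComatrix.Coring k B D)
    (𝓧 : GenComatrix.Bicomod 𝓒 𝓓 X) (𝓛 : GenComatrix.Bicomod 𝓓 𝓒 L)
    (h :
      ((GenComatrix.LeftFlat A C ∧ GenComatrix.LeftFlat B D ∧
          GenComatrix.RightFlat A C ∧ GenComatrix.RightFlat B D) ∧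
        GenComatrix.IsCoflat 𝓒 𝓧.lcoact.left ∧ GenComatrix.IsCoflat 𝓓 𝓛.lcoact.left) ∨
      (GenComatrix.IsVonNeumannRegular A ∧ GenComatrix.IsVonNeumannRegular B) ∨
      ((GenComatrix.LeftFlat A C ∧ GenComatrix.LeftFlat B D) ∧
        𝓒.IsCoseparable ∧ 𝓓.IsCoseparable)) :
    -- the bicomodules `X □ L`, `L □ X`, `C □ X` and `(X □ L) □ X`
    ∃ (S : GenComatrix.Bicomod 𝓒 𝓒 (GenComatrix.Cotensor 𝓧 𝓛))
      (T : GenComatrix.Bicomod 𝓓 𝓓 (GenComatrix.Cotensor 𝓛 𝓧))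
      (V : GenComatrix.Bicomod 𝓒 𝓓 (GenComatrix.Cotensor 𝓒.self 𝓧))
      (U : GenComatrix.Bicomod 𝓒 𝓓 (GenComatrix.Cotensor S 𝓧)),
      (∀ S', GenComatrix.Cotensor.IsInduced 𝓧 𝓛 S' ↔ S' = S) ∧
      (∀ T', GenComatrix.Cotensor.IsInduced 𝓛 𝓧 T' ↔ T' = T) ∧
      (∀ V', GenComatrix.Cotensor.IsInduced 𝓒.self 𝓧 V' ↔ V' = V) ∧
      (∀ U', GenComatrix.Cotensor.IsInduced S 𝓧 U' ↔ U' = U) ∧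
      -- the canonical isomorphisms `L □ (X □ L) ≃ (L □ X) □ L`, `X □ (L □ X) ≃ (X □ L) □ X`,
      -- `L □ ((X □ L) □ X) ≃ (L □ X) □ (L □ X)` and `X ≃ C □ X`
      ∃ (α : GenComatrix.Cotensor 𝓛 S ≃+ GenComatrix.Cotensor T 𝓛)
        (β : GenComatrix.Cotensor 𝓧 T ≃+ GenComatrix.Cotensor S 𝓧)
        (γ : GenComatrix.Cotensor 𝓛 U ≃+ GenComatrix.Cotensor T T)
        (ξ : GenComatrix.BicomodHom 𝓧 V),
        (∀ α', GenComatrix.Cotensor.IsAssoc T S α' ↔ α' = α) ∧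
        (∀ β', GenComatrix.Cotensor.IsAssoc S T β' ↔ β' = β) ∧
        (∀ γ', GenComatrix.Cotensor.IsMiddleAssoc S T U γ' ↔ γ' = γ) ∧
        ξ.toHom = GenComatrix.Cotensor.coactLeft 𝓧 ∧ Function.Bijective ξ.toHom ∧
        -- the maps `ψ : C → X □ L` and `ω : L □ X → D` and the two triangles
        ∀ (ψ : GenComatrix.BicomodHom 𝓒.self S) (ω : GenComatrix.BicomodHom T 𝓓.self),
          (∀ l : L,
            GenComatrix.Cotensor.mapLeft ω 𝓛
                (α (GenComatrix.Cotensor.mapRight 𝓛 ψ (GenComatrix.Cotensor.coactRight 𝓛 l))) =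
              GenComatrix.Cotensor.coactLeft 𝓛 l) →
          (∀ x : X,
            GenComatrix.Cotensor.mapRight 𝓧 ω
                (β.symm (GenComatrix.Cotensor.mapLeft ψ 𝓧 (GenComatrix.Cotensor.coactLeft 𝓧 x))) =
              GenComatrix.Cotensor.coactRight 𝓧 x) →
          -- `χ` is `ψ □ X : C □ X → (X □ L) □ X`
          ∃ (χ : GenComatrix.BicomodHom V U)
            (E : GenComatrix.Coring k B (GenComatrix.Cotensor 𝓛 𝓧)),
            χ.toHom = GenComatrix.Cotensor.mapLeft ψ 𝓧 ∧
            (∀ u, E.comul u = GenComatrix.Cotensor.incl T T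
              (γ (GenComatrix.Cotensor.mapRight 𝓛 χ (GenComatrix.Cotensor.mapRight 𝓛 ξ u)))) ∧
            (∀ u, E.counit u = 𝓓.counit (ω.toHom u)) := by
  obtain ⟨hC, hD, ⟨hXC, hXD⟩, ⟨hLC, hLD⟩, hR⟩ : LeftFlat A C ∧ LeftFlat B D ∧
      (Cotensor.LPreserving 𝓒 𝓧 ∧ Cotensor.LPreserving 𝓓 𝓧) ∧
      (Cotensor.LPreserving 𝓒 𝓛 ∧ Cotensor.LPreserving 𝓓 𝓛) ∧
      ((LeftFlat A X ∧ LeftFlat B L) ∨ (𝓒.IsCoseparable ∧ 𝓓.IsCoseparable)) := by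
    rcases h with ⟨⟨hC, hD, -, -⟩, hX, hL⟩ | ⟨hA, hB⟩ | ⟨⟨hC, hD⟩, hC', hD'⟩
    · exact ⟨hC, hD,
        ⟨fun _ _ _ _ _ P W _ _ => hX.lPres P 𝓧 hC W, fun _ _ _ _ _ P W _ _ => hX.lPres P 𝓧 hC W⟩,
        ⟨fun _ _ _ _ _ P W _ _ => hL.lPres P 𝓛 hD W, fun _ _ _ _ _ P W _ _ => hL.lPres P 𝓛 hD W⟩,
        .inl ⟨hX.leftFlat 𝓧 hC, hL.leftFlat 𝓛 hD⟩⟩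
    · exact ⟨hA.leftFlat C, hB.leftFlat D,
        ⟨fun _ _ _ _ _ P W _ _ => Cotensor.lPres_of_rightFlat (hA.rightFlat W) P 𝓧,
          fun _ _ _ _ _ P W _ _ => Cotensor.lPres_of_rightFlat (hB.rightFlat W) P 𝓧⟩,
        ⟨fun _ _ _ _ _ P W _ _ => Cotensor.lPres_of_rightFlat (hA.rightFlat W) P 𝓛,
          fun _ _ _ _ _ P W _ _ => Cotensor.lPres_of_rightFlat (hB.rightFlat W) P 𝓛⟩,
        .inl ⟨hA.leftFlat X, hB.leftFlat L⟩⟩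
    · exact ⟨hC, hD,
        ⟨fun _ _ _ _ _ P W _ _ => Cotensor.lPres_of_isCoseparable hC' W P 𝓧,
          fun _ _ _ _ _ P W _ _ => Cotensor.lPres_of_isCoseparable hC' W P 𝓧⟩,
        ⟨fun _ _ _ _ _ P W _ _ => Cotensor.lPres_of_isCoseparable hD' W P 𝓛,
          fun _ _ _ _ _ P W _ _ => Cotensor.lPres_of_isCoseparable hD' W P 𝓛⟩,
        .inr ⟨hC', hD'⟩⟩
  -- for the modules `V` that occur here, `- ⊗ V` preserves cotensor products, because `V` is flat
  -- or because the coring is coseparable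
  have fX : LeftFlat A X ∨ 𝓓.IsCoseparable := hR.imp (·.1) (·.2)
  have fCX : LeftFlat A (BTensor A C X) ∨ 𝓓.IsCoseparable := hR.imp (hC.bTensor ·.1) (·.2)
  have fX' : LeftFlat A X ∨ 𝓒.IsCoseparable := hR.imp (·.1) (·.1)
  have fCX' : LeftFlat A (BTensor A C X) ∨ 𝓒.IsCoseparable := hR.imp (hC.bTensor ·.1) (·.1)
  have fL : LeftFlat B L ∨ 𝓒.IsCoseparable := hR.imp (·.2) (·.1)
  have fDL : LeftFlat B (BTensor B D L) ∨ 𝓒.IsCoseparable := hR.imp (hD.bTensor ·.2) (·.1)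
  have fLX : LeftFlat B (BTensor A L X) ∨ 𝓒.IsCoseparable :=
    hR.imp (fun h => h.2.bTensor h.1) (·.1)
  obtain ⟨S, hS, hS'⟩ := Cotensor.exists_induced hC 𝓧 𝓛 (fun W => hLC _ 𝓧 W)
  obtain ⟨T, hT, hT'⟩ := Cotensor.exists_induced hD 𝓛 𝓧 (fun W => hXD _ 𝓛 W)
  obtain ⟨V, hV, hV'⟩ := Cotensor.exists_induced hD 𝓒.self 𝓧 (fun W => hXC _ 𝓒.self W)
  obtain ⟨U, hU, hU'⟩ := Cotensor.exists_induced hD S 𝓧 (fun W => hXC _ S W)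
  obtain ⟨α, hα'⟩ := Cotensor.exists_isAssoc hT hS
    (Cotensor.rPres_of_leftFlat_or_isCoseparable fL 𝓛 𝓧)
    (Cotensor.rPres_of_leftFlat_or_isCoseparable fDL 𝓛 𝓧) (hLC _ 𝓧 _) (hLC _ 𝓧 _)
  obtain ⟨β, hβ'⟩ := Cotensor.exists_isAssoc hS hT
    (Cotensor.rPres_of_leftFlat_or_isCoseparable fX 𝓧 𝓛)
    (Cotensor.rPres_of_leftFlat_or_isCoseparable fCX 𝓧 𝓛) (hXD _ 𝓛 _) (hXD _ 𝓛 _)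
  have hα := (hα' α).2 rfl
  have hβ := (hβ' β).2 rfl
  obtain ⟨γ, hγ'⟩ := Cotensor.exists_isMiddleAssoc hS hT hU α hα hC hLD hLC hXD hXC
    (Cotensor.rPres_of_leftFlat_or_isCoseparable fX' 𝓛 S)
    (Cotensor.rPres_of_leftFlat_or_isCoseparable fCX' 𝓛 S)
    (Cotensor.rPres_of_leftFlat_or_isCoseparable fX T 𝓛)
    (Cotensor.rPres_of_leftFlat_or_isCoseparable fCX T 𝓛)
    (Cotensor.rPres_of_leftFlat_or_isCoseparable fLX 𝓛 𝓧)
  have hγ := (hγ' γ).2 rfl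
  let ξ : BicomodHom 𝓧 V :=
    ⟨Cotensor.coactLeft 𝓧, Cotensor.isBicolinear_coactLeft hV hD (hXC _ 𝓒.self C)⟩
  refine ⟨S, T, V, U, hS', hT', hV', hU', α, β, γ, ξ, hα', hβ', hγ', rfl,
    Cotensor.coactLeft_bijective 𝓧, fun ψ ω h₁ h₂ => ?_⟩
  let χ : BicomodHom V U :=
    ⟨Cotensor.mapLeft ψ 𝓧, Cotensor.isBicolinear_mapLeft hV hU ψ hD (hXC _ S C)⟩
  -- below, `Δ`, `θ` and `θ'` are the comultiplication and the lifts of `leftInsert` and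
  -- `rightInsert`, bundled as bimodule maps
  let i := Cotensor.incl 𝓛 𝓧
  let Ψ : BimodHom A A C (BTensor B X L) := (Cotensor.incl 𝓧 𝓛).comp ψ.toHom
  have hΔ := hγ.mapRight_mapRight ψ (ξ := ξ) (χ := χ) rfl rfl
  have hθ := hα.mapRight_coactRight ψ
  have hθ' := hβ.symm_mapLeft_coactLeft ψ
  have hii : Function.Injective (mapBi i i) := fun s t hst =>
    (hXD _ 𝓛 _).1 ((Cotensor.rPres_of_leftFlat_or_isCoseparable fLX 𝓛 𝓧).1
      ((mapBi_eq_comp i i s).symm.trans (hst.trans (mapBi_eq_comp i i t))))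
  have hl : Function.Injective (mapBi i (BimodHom.id B A L)) :=
    (Cotensor.rPres_of_leftFlat_or_isCoseparable fL 𝓛 𝓧).1
  have hr : Function.Injective (mapBi (BimodHom.id A B X) i) := (hXD _ 𝓛 X).1
  obtain ⟨Δ, hΔE⟩ := BimodHom.exists_lift hii
    ((tensorRightCoact (A := B) L (rightInsert Ψ 𝓧.lcoact)).comp i) fun u => ⟨_, hΔ u⟩
  obtain ⟨θ, hθE⟩ := BimodHom.exists_lift hl (leftInsert Ψ 𝓛.rcoact) fun l => ⟨_, hθ l⟩
  obtain ⟨θ', hθE'⟩ := BimodHom.exists_lift hr (rightInsert Ψ 𝓧.lcoact) fun x => ⟨_, hθ' x⟩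
  -- the triangle identities
  have hθω : ∀ l, mapBi ω.toHom (BimodHom.id B A L) (θ l) = 𝓛.lcoact l := fun l => by
    rw [hl ((hθE l).trans (hθ l).symm)]
    exact congrArg (Cotensor.incl 𝓓.self 𝓛) (h₁ l)
  have hθω' : ∀ x, mapBi (BimodHom.id A B X) ω.toHom (θ' x) = 𝓧.rcoact x := fun x => by
    rw [hr ((hθE' x).trans (hθ' x).symm)]
    exact congrArg (Cotensor.incl 𝓧 𝓓.self) (h₂ x)
  obtain ⟨E, rfl, hE⟩ := exists_coring (i := i) T.central (Cotensor.incl_injective 𝓛 𝓧)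
    (Cotensor.injective_mapBi_incl_mapBi_incl_incl fLX (hXD _ 𝓛 _) (hXD _ 𝓛 _))
    (Cotensor.rPres_of_leftFlat_or_isCoseparable fLX 𝓛 𝓧).1 (hXD _ 𝓛 _).1
    (fun u => tensorLeftCoact_leftInsert Ψ 𝓛.rcoact 𝓧.lcoact _ (Cotensor.incl_balanced 𝓛 𝓧 u))
    Δ hΔE (𝓓.counit.comp ω.toHom) hθE hθE'
    (fun l => by rw [← mapBi_comp_id, hθω, 𝓛.lcounit])
    (fun x => by rw [← mapBi_id_comp, hθω', 𝓧.rcounit])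
  exact ⟨χ, E, rfl, fun u => hii ((hΔE u).trans (hΔ u).symm), fun u => by rw [hE]; rfl⟩
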